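/- Let $\mathcal L$ be a set of $n\ge 1$ lines in the plane and let $0<\varepsilon\le 1$. For a point $p\in\mathbb R^2$ let $\Box_p$ be the boundary of the axis-aligned unit square centred at $p$. An \emph{$\varepsilon$-segment} of $p$ is a connected component of $\Box_p\setminus\bigcup\mathcal L$ whose length is exactly $\varepsilon$ (the length of a component containing a corner is the sum of the lengths of its parts), and $p$ is an \emph{$\varepsilon$-placement} if it has at least one $\varepsilon$-segment. For a vector $\tau$ let $S(\tau)$ be the set of all $q$ such that $q+\tau$ lies on an $\varepsilon$-segment of $q$. The movements allowed by an $\varepsilon$-segment $s$ of $p$ are given by $S(x-p)$ near $p$, where $x\in s$ (near $p$ this does not depend on the choice of $x$). Assume that $\mathcal L$ is in general position: no $\varepsilon$-segment $s$ of any placement $p$ leaves two degrees of freedom, i.e. $S(x-p)$, $x\in s$, is not a neighbourhood of $p$; and no two distinct $\varepsilon$-segments $s,t$ of the same placement $p$ allow the same movement, i.e. $S(x-p)$ and $S(y-p)$, $x\in s$, $y\in t$, do not coincide in any neighbourhood of $p$. Let $P$ be the set of all $\varepsilon$-placements. In the arrangement of $P$, the vertices are the points of $\overline P$ that have no neighbourhood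 in which $P$ coincides with a straight line through the point; the edges are the connected components of $P$ minus the vertices; the faces are the connected components of $\mathbb R^2\setminus\overline P$. The complexity of the arrangement is the total number of its vertices, edges and faces. Theorem. There is an absolute constant $C$ such that, for all such $n$, $\varepsilon$ and $\mathcal L$, the arrangement of $\varepsilon$-placements has finite complexity, at most $C\,n^2/\varepsilon^2$. -/

import Mathlib

open Filter Topology MeasureTheory

noncomputable section

namespace SquarePlacement

/-- The Euclidean plane. -/
abbrev Plane : Type := EuclideanSpace ℝ (Fin 2)

/-- An affine subspace of the plane that is a (straight) line. -/
def IsLine (l : AffineSubspace ℝ Plane) : Prop := Module.finrank ℝ l.direction = 1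

/-- The connected components of a subset `X` of the plane. -/
def components (X : Set Plane) : Set (Set Plane) :=
  {K | ∃ x ∈ X, K = connectedComponentIn X x}

/-! ### Placements of the unit square among lines -/

/-- The boundary of the axis-aligned unit square centred at `p`. -/
def squareBoundary (p : Plane) : Set Plane :=
  {q | max |q 0 - p 0| |q 1 - p 1| = 1 / 2}

/-- The boundary of the square at `p` with all points on the lines removed. -/
def cutBoundary (L : Finset (AffineSubspace ℝ Plane)) (p : Plane) : Set Plane :=
  squareBoundary p \ ⋃ l ∈ L, (l : Set Plane)

/-- `s` is an `ε`-segment of the placement `p`: a connected component, of length exactly `ε`, of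
the boundary of the square minus the lines. Length is one-dimensional Hausdorff measure (so the
length of a component that turns around a corner is the sum of the lengths of its two parts). -/
def IsEpsSegment (L : Finset (AffineSubspace ℝ Plane)) (ε : ℝ) (p : Plane) (s : Set Plane) :
    Prop :=
  s ∈ components (cutBoundary L p) ∧ μH[1] s = ENNReal.ofReal ε

/-- The set of all `ε`-placements (critical placements). -/
def epsPlacements (L : Finset (AffineSubspace ℝ Plane)) (ε : ℝ) : Set Plane :=
  {p | ∃ s, IsEpsSegment L ε p s}

/-! ### General position -/

/-- For a fixed vector `τ`, the placements `q` for which the point `q + τ`, which moves rigidly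
with the square, lies on an `ε`-segment of `q`. -/
def placementCurve (L : Finset (AffineSubspace ℝ Plane)) (ε : ℝ) (τ : Plane) : Set Plane :=
  {q | ∃ s, IsEpsSegment L ε q s ∧ q + τ ∈ s}

/-- General position of the lines with respect to `ε`. If `x` lies on an `ε`-segment `s` of `p`,
then the movements of the square near `p` that `s` allows (those that maintain `s` as an
`ε`-segment) are the points near `p` of the placement curve of the vector `x - p`; near `p` this
set depends only on `s`, not on the choice of `x` in `s`. The condition is that an `ε`-segment
never leaves two degrees of freedom, and that two different `ε`-segments of the same placement
never allow the same movements. -/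
def GeneralPosition (L : Finset (AffineSubspace ℝ Plane)) (ε : ℝ) : Prop :=
  (∀ (p : Plane) (s : Set Plane), IsEpsSegment L ε p s → ∀ x ∈ s,
    ¬ ∀ᶠ q in 𝓝 p, q ∈ placementCurve L ε (x - p)) ∧
  (∀ (p : Plane) (s t : Set Plane), IsEpsSegment L ε p s → IsEpsSegment L ε p t → s ≠ t →
    ∀ x ∈ s, ∀ y ∈ t,
      ¬ ∀ᶠ q in 𝓝 p, (q ∈ placementCurve L ε (x - p) ↔ q ∈ placementCurve L ε (y - p)))

/-! ### The arrangement (planar subdivision) induced by a set made of straight pieces -/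

/-- The vertices of the arrangement of `P`: the points of `P` and the limit points of `P` around
which `P` is not simply a straight line (crossings, bends, end points, isolated points). -/
def vertices (P : Set Plane) : Set Plane :=
  {v | v ∈ closure P ∧
    ¬ ∃ l : AffineSubspace ℝ Plane, IsLine l ∧ v ∈ l ∧ ∀ᶠ z in 𝓝 v, (z ∈ P ↔ z ∈ l)}

/-- The edges of the arrangement of `P`: the maximal connected parts of `P` without vertices. -/
def edges (P : Set Plane) : Set (Set Plane) := components (P \ vertices P)

/-- The faces of the arrangement of `P`: the regions into which `P`, together with its limit
points, divides the plane. -/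
def faces (P : Set Plane) : Set (Set Plane) := components (closure P)ᶜ

/-- The complexity of the arrangement of `P`: the total number of vertices, edges and faces. -/
def complexity (P : Set Plane) : ℕ∞ :=
  (vertices P).encard + (edges P).encard + (faces P).encard

end SquarePlacement

end

/-!
Fix a vector `τ` such that `p + τ` is on the boundary of the square at `p`, and consider the
placements `p` that have an `ε`-segment through `x = p + τ`. From `x` the boundary of the square runs
straight in two directions: to the two neighbouring corners if `τ` leads to a corner, or along a
side. If the lines first met in these two directions are fixed, and also the face of the arrangement
of lines that contains `x`, then the length of the component of `x` is an affine function of `x`, and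
the placements form a convex set, called a piece here. Since every `ε`-segment contains a corner or
one of `O(1 / ε)` grid points on the sides with spacing less than `ε`, the set of `ε`-placements is
the union of `O(1 / ε)` families of pieces, one for each such `τ` (`epsPlacements_eq`). By general
position the pieces have empty interior (`noInterior_of_generalPosition`), so that each is a point or
a segment.

Each family has `O(n ^ 2)` pieces (`card_pieceIndices_corner`, `card_pieceIndices_side`). The pairs
of a face and a line on which rays in a fixed direction leave this face are `O(n ^ 2)` in number, as a
line is adjacent to `O(n)` faces (`card_rows_le`). In one face, the distance to the first line in a
fixed direction is the minimum of affine functions, so that the length of the component of `x` is a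
concave function of `x`. Where its gradient lies in a fixed quadrant, the pieces of a face form a
monotone staircase, with at most one piece for each such pair; within a side, a face contains at most
three pieces.

By concavity again, a line crosses the pieces of one family in one face at most three times in
points of pieces that are not on the line. Hence a line crosses only `O(n)` pieces of a family, and
a piece has at most a constant number of crossings with another family plus a constant for each
line (translated for that family) that it crosses. Summing over the pieces of one family, and
exchanging the order of summation over pieces and lines, two families have `O(n ^ 2)` crossings
(`complexity_le_of_families`), so that there are `O(n ^ 2 / ε ^ 2)` crossings in all.

The vertices of a union of segments and points are among the isolated points, end points and
crossings. The edges are bounded by cutting the segments at these points, after segments on a common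
line have been merged, and every face but at most one has an edge on its boundary, which is adjacent
to at most two faces (`complexity_le_of_union`).
-/

namespace SquarePlacement

/-! ### Lines in the plane -/

lemma IsLine.exists_coord {l : AffineSubspace ℝ Plane} (hl : IsLine l) :
    ∃ (x d : Plane) (f : Plane →L[ℝ] ℝ), d ≠ 0 ∧ f d = 1 ∧ f x = 0 ∧
      ∀ z, z ∈ l ↔ z = x + f z • d := by
  obtain ⟨⟨d, hd⟩, hd0, hspan⟩ := finrank_eq_one_iff'.1 hl
  have hd0' : d ≠ 0 := fun h => hd0 (by simpa using h)
  have hne : (l : Set Plane).Nonempty := by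
    rw [AffineSubspace.nonempty_iff_ne_bot]
    rintro rfl
    simp [AffineSubspace.direction_bot] at hd
    exact hd0' hd
  obtain ⟨x, hx⟩ := hne
  let f : Plane →L[ℝ] ℝ := (‖d‖ ^ 2)⁻¹ • innerSL ℝ d
  have hn : ‖d‖ ^ 2 ≠ 0 := by positivity
  have hfd : f d = 1 := by
    simp [f, inv_mul_cancel₀ hn]
  refine ⟨x - f x • d, d, f, hd0', hfd, by simp [hfd], fun z => ?_⟩
  have key : z ∈ l ↔ ∃ c : ℝ, z = x + c • d := by
    constructor
    · intro hz
      obtain ⟨c, hc⟩ := hspan ⟨z -ᵥ x, AffineSubspace.vsub_mem_direction hz hx⟩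
      refine ⟨c, ?_⟩
      have : c • d = z - x := by simpa using congrArg Subtype.val hc
      rw [this]; abel
    · rintro ⟨c, rfl⟩
      have := AffineSubspace.vadd_mem_of_mem_direction (Submodule.smul_mem _ c hd) hx
      rwa [vadd_eq_add, add_comm] at this
  rw [key]
  constructor
  · rintro ⟨c, rfl⟩
    simp only [map_add, map_smul, hfd, smul_eq_mul, mul_one, add_smul]
    abel
  · intro h
    exact ⟨f z - f x, by rw [sub_smul]; nth_rewrite 1 [h]; abel⟩

lemma IsLine.exists_equation {l : AffineSubspace ℝ Plane} (hl : IsLine l) :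
    ∃ φ : Plane →ᵃ[ℝ] ℝ, (∃ v, φ.linear v ≠ 0) ∧ ∀ z, z ∈ l ↔ φ z = 0 := by
  obtain ⟨x, d, f, hd, hfd, hfx, h⟩ := hl.exists_coord
  let g : Plane →ₗ[ℝ] ℝ := d 0 • (EuclideanSpace.proj (1 : Fin 2) : Plane →L[ℝ] ℝ).toLinearMap
    - d 1 • (EuclideanSpace.proj (0 : Fin 2) : Plane →L[ℝ] ℝ).toLinearMap
  have hg : ∀ v : Plane, g v = d 0 * v 1 - d 1 * v 0 := fun v => by simp [g]
  have hpos : 0 < d 0 ^ 2 + d 1 ^ 2 := by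
    by_contra hcon
    have h0 : d 0 = 0 := by nlinarith [sq_nonneg (d 0), sq_nonneg (d 1)]
    have h1 : d 1 = 0 := by nlinarith [sq_nonneg (d 0), sq_nonneg (d 1)]
    exact hd (by ext i; fin_cases i <;> simp [h0, h1])
  refine ⟨g.toAffineMap - AffineMap.const ℝ Plane (g x), ⟨!₂[-d 1, d 0], ?_⟩, fun z => ?_⟩
  · simp only [AffineMap.sub_linear, LinearMap.toAffineMap_linear, AffineMap.const_linear, sub_zero,
      hg]
    simp; nlinarith
  · have e : (g.toAffineMap - AffineMap.const ℝ Plane (g x)) z = g z - g x := by simp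
    rw [e, h]
    constructor
    · intro hz
      rw [hz, map_add, map_smul, hg d]; simp; right; ring
    · intro hz
      rw [hg, hg] at hz
      -- `z - x` is a multiple of `d`; applying `f` identifies the factor as `f z`
      have hc : ∃ c : ℝ, z = x + c • d := by
        refine ⟨(d 0 * (z 0 - x 0) + d 1 * (z 1 - x 1)) / (d 0 ^ 2 + d 1 ^ 2), ?_⟩
        ext i
        fin_cases i
        · simp; field_simp; linear_combination (-d 1) * hz
        · simp; field_simp; linear_combination (d 0) * hz
      obtain ⟨c, rfl⟩ := hc
      simp [hfd, hfx]

lemma IsLine.eq_of_le {l m : AffineSubspace ℝ Plane} (hl : IsLine l) (hm : IsLine m)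
    (h : l ≤ m) : l = m := by
  have hne : (l : Set Plane).Nonempty := by
    obtain ⟨x, d, f, -, -, hfx, h⟩ := hl.exists_coord
    exact ⟨x, (h x).2 (by simp [hfx])⟩
  refine AffineSubspace.eq_of_direction_eq_of_nonempty_of_le ?_ hne h
  exact Submodule.eq_of_le_of_finrank_eq (AffineSubspace.direction_le h) (by rw [hl, hm])

/-- A coordinate along a line: a continuous linear functional injective on it. -/
lemma IsLine.exists_injOn {l : AffineSubspace ℝ Plane} (hl : IsLine l) :
    ∃ f : Plane →L[ℝ] ℝ, Set.InjOn f l := by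
  obtain ⟨x, d, f, hd, hfd, hfx, h⟩ := hl.exists_coord
  refine ⟨f, fun y hy z hz hyz => ?_⟩
  rw [(h y).1 hy, (h z).1 hz, hyz]

/-- Betweenness on a line can be read off a coordinate. -/
lemma mem_of_between {l : AffineSubspace ℝ Plane} {f : Plane →L[ℝ] ℝ} (hf : Set.InjOn f l)
    {s : Set Plane} (hs : Convex ℝ s) (hsl : s ⊆ l) {a b z : Plane} (ha : a ∈ s) (hb : b ∈ s)
    (hz : z ∈ l) (h1 : f a ≤ f z) (h2 : f z ≤ f b) : z ∈ s := by
  rcases eq_or_lt_of_le (h1.trans h2) with hab | hab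
  · have : f a = f z := le_antisymm h1 (by linarith)
    rwa [← hf (hsl ha) hz this]
  · have hm : AffineMap.lineMap a b ((f z - f a) / (f b - f a)) ∈ s := by
      apply hs.lineMap_mem ha hb
      have : 0 < f b - f a := by linarith
      constructor
      · apply div_nonneg <;> linarith
      · rw [div_le_one this]; linarith
    have : AffineMap.lineMap a b ((f z - f a) / (f b - f a)) = z := by
      apply hf (hsl hm) hz
      have : f b - f a ≠ 0 := by linarith
      simp only [AffineMap.lineMap_apply, vsub_eq_sub, vadd_eq_add, map_add, map_smul, map_sub,
        smul_eq_mul]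
      field_simp; ring
    rwa [this] at hm

/-- A subset of a line in which no point lies between two others has at most two points. -/
lemma encard_le_two_of_between {l : AffineSubspace ℝ Plane} {f : Plane →L[ℝ] ℝ}
    (hf : Set.InjOn f l) {s : Set Plane} (hsl : s ⊆ l)
    (h : ∀ a ∈ s, ∀ b ∈ s, ∀ c ∈ s, f a < f b → f b < f c → False) : s.encard ≤ 2 := by
  by_contra hcon
  obtain ⟨t, hts, htc⟩ := Set.exists_subset_encard_eq (s := s) (k := 3)
    (by
      have := not_le.1 hcon
      have h3 : (3 : ℕ∞) = 2 + 1 := by norm_num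
      rw [h3]; exact Order.add_one_le_of_lt this)
  obtain ⟨x, y, z, hxy, hxz, hyz, rfl⟩ := Set.encard_eq_three.1 htc
  have hx : x ∈ s := hts (by simp)
  have hy : y ∈ s := hts (by simp)
  have hz : z ∈ s := hts (by simp)
  have h1 : f x ≠ f y := fun e => hxy (hf (hsl hx) (hsl hy) e)
  have h2 : f x ≠ f z := fun e => hxz (hf (hsl hx) (hsl hz) e)
  have h3 : f y ≠ f z := fun e => hyz (hf (hsl hy) (hsl hz) e)
  rcases lt_or_gt_of_ne h1 with a | a <;> rcases lt_or_gt_of_ne h2 with b | b <;>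
    rcases lt_or_gt_of_ne h3 with c | c
  · exact h x hx y hy z hz a c
  · exact h x hx z hz y hy b c
  · linarith
  · exact h z hz x hx y hy b a
  · exact h y hy x hx z hz a b
  · linarith
  · exact h y hy z hz x hx c b
  · exact h z hz y hy x hx c a

/-! ### Faces are bounded by edges -/

lemma isOpen_face {P F : Set Plane} (hF : F ∈ faces P) : IsOpen F := by
  obtain ⟨x, hx, rfl⟩ := hF
  exact isClosed_closure.isOpen_compl.connectedComponentIn

lemma face_subset {P F : Set Plane} (hF : F ∈ faces P) : F ⊆ (closure P)ᶜ := by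
  obtain ⟨x, hx, rfl⟩ := hF
  exact connectedComponentIn_subset _ _

lemma components_eq_of_mem {X K K' : Set Plane} (hK : K ∈ components X) (hK' : K' ∈ components X)
    {z : Plane} (hz : z ∈ K) (hz' : z ∈ K') : K = K' := by
  obtain ⟨x, hx, rfl⟩ := hK
  obtain ⟨y, hy, rfl⟩ := hK'
  rw [connectedComponentIn_eq hz, connectedComponentIn_eq hz']

lemma subset_component {X K s : Set Plane} (hK : K ∈ components X) (hs : IsPreconnected s)
    (hsX : s ⊆ X) {z : Plane} (hz : z ∈ s) (hzK : z ∈ K) : s ⊆ K := by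
  obtain ⟨x, hx, rfl⟩ := hK
  rw [connectedComponentIn_eq hzK]
  exact hs.subset_connectedComponentIn hz hsX

lemma nonempty_of_mem_components {X K : Set Plane} (hK : K ∈ components X) : K.Nonempty := by
  obtain ⟨x, hx, rfl⟩ := hK
  exact ⟨x, mem_connectedComponentIn hx⟩

lemma exists_line_of_not_vertex {P : Set Plane} {z : Plane} (hz : z ∈ closure P)
    (hv : z ∉ vertices P) :
    ∃ l : AffineSubspace ℝ Plane, IsLine l ∧ z ∈ l ∧ ∀ᶠ w in 𝓝 z, (w ∈ P ↔ w ∈ l) := by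
  by_contra h
  exact hv ⟨hz, h⟩

lemma mem_of_not_vertex {P : Set Plane} {z : Plane} (hz : z ∈ closure P)
    (hv : z ∉ vertices P) : z ∈ P := by
  obtain ⟨l, -, hzl, h⟩ := exists_line_of_not_vertex hz hv
  exact h.self_of_nhds.2 hzl

/-- The faces whose closure contains `z`. -/
def facesAt (P : Set Plane) (z : Plane) : Set (Set Plane) := {F | F ∈ faces P ∧ z ∈ closure F}

/-- Near a point that is not a vertex, the two sides of the edge are the only adjacent faces. -/
lemma facesAt_locally {P : Set Plane} {z : Plane} (hz : z ∈ P) (hv : z ∉ vertices P) :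
    ∃ F₁ F₂ : Set Plane, ∀ᶠ w in 𝓝 z, w ∈ P → facesAt P w = {F₁, F₂} := by
  obtain ⟨l, hl, hzl, h⟩ := exists_line_of_not_vertex (subset_closure hz) hv
  obtain ⟨φ, ⟨v, hv⟩, hφ⟩ := hl.exists_equation
  have hφc : Continuous φ := φ.continuous_of_finiteDimensional
  obtain ⟨r, hr, hB⟩ := Metric.eventually_nhds_iff_ball.1 h
  have hconv : ∀ σ : ℝ, Convex ℝ {w | 0 < σ * φ w} := by
    intro σ
    have : {w | 0 < σ * φ w} = (σ • φ) ⁻¹' (Set.Ioi 0) := by ext; simp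
    rw [this]
    exact (convex_Ioi 0).affine_preimage _
  -- the open half discs
  let H : ℝ → Set Plane := fun σ => Metric.ball z r ∩ {w | 0 < σ * φ w}
  have hHopen : ∀ σ, IsOpen (H σ) := fun σ =>
    Metric.isOpen_ball.inter (isOpen_lt continuous_const (continuous_const.mul hφc))
  have hHpre : ∀ σ, IsPreconnected (H σ) := fun σ =>
    ((convex_ball z r).inter (hconv σ)).isPreconnected
  have hHX : ∀ σ, H σ ⊆ (closure P)ᶜ := by
    intro σ w hw hwP
    obtain ⟨y, hyH, hyP⟩ := mem_closure_iff.1 hwP _ (hHopen σ) hw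
    have := (hφ y).1 ((hB y hyH.1).1 hyP)
    have h2 := hyH.2
    simp [this] at h2
  have hcl : ∀ σ : ℝ, σ ≠ 0 → ∀ w ∈ Metric.ball z r, w ∈ l → w ∈ closure (H σ) := by
    intro σ hσ w hw hwl
    rw [mem_closure_iff_nhds]
    intro t ht
    have hc : Tendsto (fun c : ℝ => w + c • ((σ * φ.linear v) • v)) (𝓝[>] 0) (𝓝 w) := by
      have : Tendsto (fun c : ℝ => w + c • ((σ * φ.linear v) • v)) (𝓝 0)
          (𝓝 (w + (0 : ℝ) • ((σ * φ.linear v) • v))) := by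
        apply Continuous.tendsto; fun_prop
      rw [zero_smul, add_zero] at this
      exact this.mono_left nhdsWithin_le_nhds
    have h1 := hc.eventually ht
    have h2 := hc.eventually (Metric.isOpen_ball.mem_nhds hw)
    obtain ⟨c, ⟨hc1, hc2⟩, hc3⟩ := ((h1.and h2).and self_mem_nhdsWithin).exists
    refine ⟨_, hc1, hc2, ?_⟩
    have : φ (w + c • ((σ * φ.linear v) • v)) = c * (σ * φ.linear v) * φ.linear v := by
      have e := φ.map_vadd w (c • ((σ * φ.linear v) • v))
      rw [vadd_eq_add, add_comm] at e
      rw [e, (hφ w).1 hwl]; simp [mul_assoc]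
    show 0 < σ * _
    rw [this]
    have hc0 : 0 < c := hc3
    have : σ * (c * (σ * φ.linear v) * φ.linear v) = c * (σ * φ.linear v) ^ 2 := by ring
    rw [this]; positivity
  have hne : ∀ σ : ℝ, σ ≠ 0 → (H σ).Nonempty := fun σ hσ =>
    closure_nonempty_iff.1 ⟨z, hcl σ hσ z (Metric.mem_ball_self hr) hzl⟩
  obtain ⟨a, ha⟩ := hne 1 one_ne_zero
  obtain ⟨b, hb⟩ := hne (-1) (by norm_num)
  have hFa : connectedComponentIn (closure P)ᶜ a ∈ faces P := ⟨a, hHX _ ha, rfl⟩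
  have hFb : connectedComponentIn (closure P)ᶜ b ∈ faces P := ⟨b, hHX _ hb, rfl⟩
  have hsa : H 1 ⊆ connectedComponentIn (closure P)ᶜ a :=
    (hHpre 1).subset_connectedComponentIn ha (hHX 1)
  have hsb : H (-1) ⊆ connectedComponentIn (closure P)ᶜ b :=
    (hHpre (-1)).subset_connectedComponentIn hb (hHX (-1))
  refine ⟨connectedComponentIn (closure P)ᶜ a, connectedComponentIn (closure P)ᶜ b,
    Metric.eventually_nhds_iff_ball.2 ⟨r, hr, fun w hw hwP => ?_⟩⟩
  have hwl := (hB w hw).1 hwP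
  ext F
  simp only [facesAt, Set.mem_ofPred_eq, Set.mem_insert_iff, Set.mem_singleton_iff]
  constructor
  · rintro ⟨hF, hwF⟩
    obtain ⟨y, hyB, hyF⟩ := mem_closure_iff.1 hwF _ Metric.isOpen_ball hw
    have hyP : y ∉ P := fun hyP => face_subset hF hyF (subset_closure hyP)
    have hy0 : φ y ≠ 0 := fun h0 => hyP ((hB y hyB).2 ((hφ y).2 h0))
    rcases lt_or_gt_of_ne hy0 with h0 | h0
    · right
      exact components_eq_of_mem hF hFb hyF (hsb ⟨hyB, by simpa using h0⟩)
    · left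
      exact components_eq_of_mem hF hFa hyF (hsa ⟨hyB, by simpa using h0⟩)
  · rintro (rfl | rfl)
    · exact ⟨hFa, closure_mono hsa (hcl 1 one_ne_zero w hw hwl)⟩
    · exact ⟨hFb, closure_mono hsb (hcl (-1) (by norm_num) w hw hwl)⟩

/-- The faces on the two sides of an edge do not change along it. -/
lemma facesAt_eq_of_edge {P K : Set Plane} (hK : K ∈ edges P) {x y : Plane} (hx : x ∈ K)
    (hy : y ∈ K) : facesAt P x = facesAt P y := by
  have hKs : K ⊆ P \ vertices P := by
    obtain ⟨z, -, rfl⟩ := hK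
    exact connectedComponentIn_subset _ _
  have hpre : IsPreconnected K := by
    obtain ⟨z, -, rfl⟩ := hK
    exact isPreconnected_connectedComponentIn
  refine hpre.induction₂ (fun x y => facesAt P x = facesAt P y) ?_
    (fun _ _ _ _ _ _ h1 h2 => h1.trans h2) (fun _ _ _ _ h => h.symm) hx hy
  intro w hw
  obtain ⟨F₁, F₂, h⟩ := facesAt_locally (hKs hw).1 (hKs hw).2
  filter_upwards [nhdsWithin_le_nhds h, self_mem_nhdsWithin] with u hu huK
  rw [h.self_of_nhds (hKs hw).1, hu (hKs huK).1]

/-- A face that is adjacent to no edge contains everything but the vertices. -/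
lemma compl_vertices_subset_face {P F : Set Plane} (hfin : (vertices P).Finite) (hF : F ∈ faces P)
    (h : ∀ z ∈ P \ vertices P, z ∉ closure F) : (vertices P)ᶜ ⊆ F := by
  have hopen := isOpen_face hF
  have hrank : 1 < Module.rank ℝ Plane := by
    rw [← Module.finrank_eq_rank]; simp
  have hconn := (hfin.countable.isPathConnected_compl_of_one_lt_rank hrank).isConnected
  have hsub : (vertices P)ᶜ ⊆ F ∪ (closure F)ᶜ := by
    intro z hz
    by_cases hzF : z ∈ closure F
    · left
      have hzP : z ∉ closure P := fun hzP => h z ⟨mem_of_not_vertex hzP hz, hz⟩ hzF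
      have hz' : connectedComponentIn (closure P)ᶜ z ∈ faces P := ⟨z, hzP, rfl⟩
      obtain ⟨y, hy1, hy2⟩ := mem_closure_iff.1 hzF _ (isOpen_face hz')
        (mem_connectedComponentIn hzP)
      rw [← components_eq_of_mem hz' hF hy1 hy2]
      exact mem_connectedComponentIn hzP
    · exact Or.inr hzF
  refine hconn.isPreconnected.subset_left_of_subset_union hopen isClosed_closure.isOpen_compl
    ?_ hsub ?_
  · exact Set.disjoint_left.2 fun z hz hz' => hz' (subset_closure hz)
  · obtain ⟨z, hz⟩ := nonempty_of_mem_components hF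
    by_contra hcon
    have hFV : F ⊆ vertices P := fun y hy => by
      by_contra hyV
      exact hcon ⟨y, hyV, hy⟩
    exact (infinite_of_mem_nhds z (hopen.mem_nhds hz)) (hfin.subset hFV)

/-- Every face but at most one lies on one of the two sides of some edge. -/
lemma encard_faces_le {P : Set Plane} (hfin : (vertices P).Finite) :
    (faces P).encard ≤ 2 * (edges P).encard + 1 := by
  have hex : ∀ K ∈ edges P, ∃ F₁ F₂ : Set Plane, ∀ z ∈ K, facesAt P z = {F₁, F₂} := by
    intro K hK
    obtain ⟨z, hz⟩ := nonempty_of_mem_components hK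
    have hKs : K ⊆ P \ vertices P := by
      obtain ⟨z, -, rfl⟩ := hK
      exact connectedComponentIn_subset _ _
    obtain ⟨F₁, F₂, h⟩ := facesAt_locally (hKs hz).1 (hKs hz).2
    exact ⟨F₁, F₂, fun w hw => by
      rw [facesAt_eq_of_edge hK hw hz, h.self_of_nhds (hKs hz).1]⟩
  choose! F₁ F₂ hFF using hex
  let Z : Set (Set Plane) := {F | F ∈ faces P ∧ ∀ z ∈ P \ vertices P, z ∉ closure F}
  have hZ : Z.encard ≤ 1 := by
    rw [Set.encard_le_one_iff]
    intro F F' hF hF'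
    have h1 := compl_vertices_subset_face hfin hF.1 hF.2
    have h2 := compl_vertices_subset_face hfin hF'.1 hF'.2
    obtain ⟨z, hz⟩ := hfin.infinite_compl.nonempty
    exact components_eq_of_mem hF.1 hF'.1 (h1 hz) (h2 hz)
  have hsub : faces P ⊆ (F₁ '' edges P ∪ F₂ '' edges P) ∪ Z := by
    intro F hF
    by_cases h : ∀ z ∈ P \ vertices P, z ∉ closure F
    · exact Or.inr ⟨hF, h⟩
    · push Not at h
      obtain ⟨z, hz, hzF⟩ := h
      have hK : connectedComponentIn (P \ vertices P) z ∈ edges P := ⟨z, hz, rfl⟩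
      have : F ∈ facesAt P z := ⟨hF, hzF⟩
      rw [hFF _ hK z (mem_connectedComponentIn hz)] at this
      left
      rcases this with rfl | h'
      · exact Or.inl ⟨_, hK, rfl⟩
      · rw [Set.mem_singleton_iff] at h'
        exact Or.inr ⟨_, hK, h'.symm⟩
  calc (faces P).encard ≤ _ := Set.encard_le_encard hsub
    _ ≤ (F₁ '' edges P ∪ F₂ '' edges P).encard + Z.encard := Set.encard_union_le _ _
    _ ≤ ((edges P).encard + (edges P).encard) + 1 := by
        gcongr
        exact (Set.encard_union_le _ _).trans (add_le_add (Set.encard_image_le _ _)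
          (Set.encard_image_le _ _))
    _ = 2 * (edges P).encard + 1 := by rw [two_mul]

/-! ### Families of intervals on lines -/

/-- A convex subset of a line. -/
def IsInterval (s : Set Plane) : Prop :=
  Convex ℝ s ∧ ∃ l : AffineSubspace ℝ Plane, IsLine l ∧ s ⊆ l

lemma convex_of_between {l : AffineSubspace ℝ Plane} (f : Plane →L[ℝ] ℝ)
    {s : Set Plane} (hsl : s ⊆ l)
    (h : ∀ a ∈ s, ∀ b ∈ s, ∀ z ∈ l, f a ≤ f z → f z ≤ f b → z ∈ s) : Convex ℝ s := by
  have key : ∀ a ∈ s, ∀ b ∈ s, f a ≤ f b → ∀ t ∈ Set.Icc (0 : ℝ) 1,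
      AffineMap.lineMap a b t ∈ s := by
    intro a ha b hb hab t ht
    apply h a ha b hb _ (AffineMap.lineMap_mem t (hsl ha) (hsl hb))
    · simp only [AffineMap.lineMap_apply, vsub_eq_sub, vadd_eq_add, map_add, map_smul, map_sub,
        smul_eq_mul]
      nlinarith [ht.1]
    · simp only [AffineMap.lineMap_apply, vsub_eq_sub, vadd_eq_add, map_add, map_smul, map_sub,
        smul_eq_mul]
      nlinarith [ht.2]
  rw [convex_iff_segment_subset]
  intro a ha b hb z hz
  rcases le_total (f a) (f b) with hab | hab
  · rw [segment_eq_image_lineMap] at hz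
    obtain ⟨t, ht, rfl⟩ := hz
    exact key a ha b hb hab t ht
  · rw [segment_symm, segment_eq_image_lineMap] at hz
    obtain ⟨t, ht, rfl⟩ := hz
    exact key b hb a ha hab t ht

lemma convex_union_of_line {l : AffineSubspace ℝ Plane} (hl : IsLine l) {s t : Set Plane}
    (hs : Convex ℝ s) (ht : Convex ℝ t) (hsl : s ⊆ l) (htl : t ⊆ l) (h : (s ∩ t).Nonempty) :
    Convex ℝ (s ∪ t) := by
  obtain ⟨f, hf⟩ := hl.exists_injOn
  obtain ⟨v, hvs, hvt⟩ := h
  refine convex_of_between f (Set.union_subset hsl htl) ?_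
  intro a ha b hb z hz h1 h2
  rcases le_total (f z) (f v) with hzv | hzv
  · rcases ha with ha | ha
    · exact Or.inl (mem_of_between hf hs hsl ha hvs hz h1 hzv)
    · exact Or.inr (mem_of_between hf ht htl ha hvt hz h1 hzv)
  · rcases hb with hb | hb
    · exact Or.inl (mem_of_between hf hs hsl hvs hb hz hzv h2)
    · exact Or.inr (mem_of_between hf ht htl hvt hb hz hzv h2)

lemma IsInterval.exists_split {s : Set Plane} (hs : IsInterval s) (v : Plane) :
    ∃ a b : Set Plane, IsInterval a ∧ IsInterval b ∧ a ∪ b = s \ {v} ∧ Disjoint a b := by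
  obtain ⟨hc, l, hl, hsl⟩ := hs
  obtain ⟨f, hf⟩ := hl.exists_injOn
  by_cases hv : v ∈ s
  · refine ⟨s ∩ {z | f z < f v}, s ∩ {z | f v < f z}, ⟨?_, l, hl, ?_⟩, ⟨?_, l, hl, ?_⟩, ?_, ?_⟩
    · exact hc.inter (convex_halfSpace_lt f.toLinearMap.isLinear _)
    · exact Set.inter_subset_left.trans hsl
    · exact hc.inter (convex_halfSpace_gt f.toLinearMap.isLinear _)
    · exact Set.inter_subset_left.trans hsl
    · ext z
      constructor
      · rintro (⟨hz, h⟩ | ⟨hz, h⟩)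
        · exact ⟨hz, fun e => (ne_of_lt (show f z < f v from h)) (congrArg f e)⟩
        · exact ⟨hz, fun e => (ne_of_gt (show f v < f z from h)) (congrArg f e)⟩
      · rintro ⟨hz, h⟩
        have : f z ≠ f v := fun e => h (hf (hsl hz) (hsl hv) e)
        rcases lt_or_gt_of_ne this with h | h
        · exact Or.inl ⟨hz, h⟩
        · exact Or.inr ⟨hz, h⟩
    · exact Set.disjoint_left.2 fun z hz hz' => lt_asymm (show f z < f v from hz.2) hz'.2
  · refine ⟨s, ∅, ⟨hc, l, hl, hsl⟩, ⟨convex_empty, l, hl, Set.empty_subset _⟩, ?_, by simp⟩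
    rw [Set.union_empty, Set.sdiff_singleton_eq_self hv]

open Classical in
lemma exists_family_diff_singleton (F : Finset (Set Plane)) (hF : ∀ s ∈ F, IsInterval s)
    (hd : (F : Set (Set Plane)).PairwiseDisjoint id) (v : Plane) :
    ∃ F' : Finset (Set Plane), (∀ s ∈ F', IsInterval s) ∧
      (F' : Set (Set Plane)).PairwiseDisjoint id ∧ ⋃₀ (F' : Set (Set Plane)) = ⋃₀ F \ {v} ∧
      F'.card ≤ F.card + 1 := by
  by_cases hv : v ∈ ⋃₀ (F : Set (Set Plane))
  swap
  · exact ⟨F, hF, hd, (Set.sdiff_singleton_eq_self hv).symm, by omega⟩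
  obtain ⟨s, hsF, hvs⟩ := hv
  obtain ⟨a, b, ha, hb, hab, habd⟩ := (hF s hsF).exists_split v
  have hsF' : s ∈ F := hsF
  have hother : ∀ t ∈ F.erase s, Disjoint s t := fun t ht =>
    hd hsF (Finset.mem_of_mem_erase ht) (Finset.ne_of_mem_erase ht).symm
  have has : a ⊆ s := fun z hz => (hab.subset (Or.inl hz)).1
  have hbs : b ⊆ s := fun z hz => (hab.subset (Or.inr hz)).1
  refine ⟨insert a (insert b (F.erase s)), ?_, ?_, ?_, ?_⟩
  · intro t ht
    simp only [Finset.mem_insert] at ht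
    rcases ht with rfl | rfl | ht
    · exact ha
    · exact hb
    · exact hF t (Finset.mem_of_mem_erase ht)
  · rw [Finset.coe_insert, Finset.coe_insert]
    refine Set.PairwiseDisjoint.insert (Set.PairwiseDisjoint.insert (hd.subset ?_) ?_) ?_
    · exact Finset.coe_subset.2 (Finset.erase_subset _ _)
    · intro t ht _
      exact (hother t ht).mono_left hbs
    · rintro t (rfl | ht) _
      · exact habd
      · exact (hother t ht).mono_left has
  · rw [Finset.coe_insert, Finset.coe_insert, Set.sUnion_insert, Set.sUnion_insert, ← Set.union_assoc,
      hab]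
    ext z
    constructor
    · rintro (⟨hz, hzv⟩ | ⟨t, ht, hz⟩)
      · exact ⟨⟨s, hsF, hz⟩, hzv⟩
      · refine ⟨⟨t, Finset.mem_of_mem_erase ht, hz⟩, fun e => ?_⟩
        rw [Set.mem_singleton_iff.1 e] at hz
        exact Set.disjoint_left.1 (hother t ht) hvs hz
    · rintro ⟨⟨t, ht, hz⟩, hzv⟩
      by_cases hts : t = s
      · exact Or.inl ⟨hts ▸ hz, hzv⟩
      · exact Or.inr ⟨t, Finset.mem_coe.2 (Finset.mem_erase.2 ⟨hts, ht⟩), hz⟩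
  · have h1 := Finset.card_insert_le a (insert b (F.erase s))
    have h2 := Finset.card_insert_le b (F.erase s)
    have h3 := Finset.card_erase_add_one hsF'
    omega

/-- Removing `k` points from a disjoint family of intervals adds at most `k` intervals. -/
lemma exists_family_diff (F : Finset (Set Plane)) (hF : ∀ s ∈ F, IsInterval s)
    (hd : (F : Set (Set Plane)).PairwiseDisjoint id) (E : Finset Plane) :
    ∃ F' : Finset (Set Plane), (∀ s ∈ F', IsInterval s) ∧
      (F' : Set (Set Plane)).PairwiseDisjoint id ∧ ⋃₀ (F' : Set (Set Plane)) = ⋃₀ F \ E ∧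
      F'.card ≤ F.card + E.card := by
  classical
  induction E using Finset.induction_on with
  | empty => exact ⟨F, hF, hd, by simp, by simp⟩
  | insert v E hv ih =>
    obtain ⟨F₁, h1, h2, h3, h4⟩ := ih
    obtain ⟨F₂, g1, g2, g3, g4⟩ := exists_family_diff_singleton F₁ h1 h2 v
    refine ⟨F₂, g1, g2, ?_, ?_⟩
    · rw [g3, h3, Set.sdiff_sdiff, Finset.coe_insert, Set.union_singleton]
    · rw [Finset.card_insert_of_notMem hv]; omega

/-- A finite family whose intersecting members can be merged may be made disjoint. -/
lemma exists_disjoint_family {Q : Set Plane → Prop}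
    (hQ : ∀ s t, Q s → Q t → (s ∩ t).Nonempty → Q (s ∪ t)) (F : Finset (Set Plane))
    (hF : ∀ s ∈ F, Q s) :
    ∃ F' : Finset (Set Plane), (∀ s ∈ F', Q s) ∧
      (F' : Set (Set Plane)).PairwiseDisjoint id ∧ ⋃₀ (F' : Set (Set Plane)) = ⋃₀ F ∧
      F'.card ≤ F.card := by
  classical
  induction hn : F.card using Nat.strong_induction_on generalizing F with
  | _ n ih =>
    by_cases hd : (F : Set (Set Plane)).PairwiseDisjoint id
    · exact ⟨F, hF, hd, rfl, hn.le⟩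
    simp only [Set.PairwiseDisjoint, Set.Pairwise] at hd
    push Not at hd
    obtain ⟨s, hs, t, ht, hst, hnd⟩ := hd
    have hs' : s ∈ F := hs
    have hte : t ∈ F.erase s := Finset.mem_erase.2 ⟨hst.symm, ht⟩
    have hmeet : (s ∩ t).Nonempty := Set.not_disjoint_iff_nonempty_inter.1 hnd
    have hc1 := Finset.card_erase_add_one hs'
    have hc2 := Finset.card_erase_add_one hte
    have hc3 := Finset.card_insert_le (s ∪ t) ((F.erase s).erase t)
    obtain ⟨F', h1, h2, h3, h4⟩ := ih (insert (s ∪ t) ((F.erase s).erase t)).card (by omega)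
      (insert (s ∪ t) ((F.erase s).erase t)) (by
        intro r hr
        rcases Finset.mem_insert.1 hr with rfl | hr
        · exact hQ s t (hF s hs) (hF t ht) hmeet
        · exact hF r (Finset.mem_of_mem_erase (Finset.mem_of_mem_erase hr))) rfl
    refine ⟨F', h1, h2, ?_, by omega⟩
    rw [h3, Finset.coe_insert, Set.sUnion_insert]
    ext z
    constructor
    · rintro ((hz | hz) | ⟨r, hr, hz⟩)
      · exact ⟨s, hs, hz⟩
      · exact ⟨t, ht, hz⟩
      · exact ⟨r, Finset.mem_of_mem_erase (Finset.mem_of_mem_erase hr), hz⟩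
    · rintro ⟨r, hr, hz⟩
      by_cases hrs : r = s
      · exact Or.inl (Or.inl (hrs ▸ hz))
      by_cases hrt : r = t
      · exact Or.inl (Or.inr (hrt ▸ hz))
      · exact Or.inr ⟨r, Finset.mem_coe.2 (Finset.mem_erase.2
          ⟨hrt, Finset.mem_erase.2 ⟨hrs, hr⟩⟩), hz⟩

/-! ### The complexity of a union of segments -/

/-- The end points of a convex subset of a line, whether they belong to it or not. -/
def endPoints (s : Set Plane) : Set Plane :=
  {v | v ∈ closure s ∧ ¬ ∀ᶠ z in 𝓝 v, z ∈ affineSpan ℝ s → z ∈ s}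

lemma closure_subset_affineSpan (s : Set Plane) :
    closure s ⊆ (affineSpan ℝ s : Set Plane) :=
  closure_minimal (subset_affineSpan ℝ s) (affineSpan ℝ s).closed_of_finiteDimensional

lemma encard_endPoints_le {s : Set Plane} (hs : Convex ℝ s) (hl : IsLine (affineSpan ℝ s)) :
    (endPoints s).encard ≤ 2 := by
  obtain ⟨f, hf⟩ := hl.exists_injOn
  refine encard_le_two_of_between hf (fun v hv => closure_subset_affineSpan s hv.1) ?_
  intro a ha b hb c hc hab hbc
  obtain ⟨a', ha', has⟩ := mem_closure_iff.1 ha.1 {z | f z < f b}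
    (isOpen_lt f.continuous continuous_const) hab
  obtain ⟨c', hc', hcs⟩ := mem_closure_iff.1 hc.1 {z | f b < f z}
    (isOpen_lt continuous_const f.continuous) hbc
  apply hb.2
  filter_upwards [(isOpen_lt continuous_const f.continuous).mem_nhds ha',
    (isOpen_lt f.continuous continuous_const).mem_nhds hc'] with z h1 h2 hz
  exact mem_of_between hf hs (subset_affineSpan ℝ s) has hcs hz (le_of_lt h1) (le_of_lt h2)

/-- The points of the piece `σ i` that also lie on a piece in another direction. -/
def crossings {ι : Type*} (σ : ι → Set Plane) (i : ι) : Set Plane :=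
  {v | v ∈ σ i ∧ ∃ k, v ∈ σ k ∧ ¬ σ k ⊆ affineSpan ℝ (σ i)}

section Union

variable {ι : Type*} [Fintype ι] {σ : ι → Set Plane} {D : Finset Plane} {P : Set Plane}

lemma affineSpan_eq_of_subset {s t : Set Plane} (hs : IsLine (affineSpan ℝ s))
    (ht : IsLine (affineSpan ℝ t)) (h : t ⊆ affineSpan ℝ s) :
    affineSpan ℝ t = affineSpan ℝ s :=
  ht.eq_of_le hs (affineSpan_le.2 h)

lemma vertices_subset (hP : P = (D : Set Plane) ∪ ⋃ i, σ i) (hl : ∀ i, IsLine (affineSpan ℝ (σ i))) :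
    vertices P ⊆ ((D : Set Plane) ∪ ⋃ i, endPoints (σ i)) ∪ ⋃ i, crossings σ i := by
  intro v hv
  by_contra hcon
  simp only [Set.mem_union, Set.mem_iUnion, not_or, not_exists] at hcon
  obtain ⟨⟨hD, hE⟩, hX⟩ := hcon
  have hloc : ∀ k, v ∈ closure (σ k) → ∀ᶠ z in 𝓝 v, z ∈ affineSpan ℝ (σ k) → z ∈ σ k := by
    intro k hk
    by_contra h
    exact hE k ⟨hk, h⟩
  have hmem : ∀ k, v ∈ closure (σ k) → v ∈ σ k := fun k hk =>
    (hloc k hk).self_of_nhds (closure_subset_affineSpan _ hk)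
  have hcl : v ∈ ⋃ i, closure (σ i) := by
    have := hv.1
    rw [hP, closure_union, closure_iUnion_of_finite, D.finite_toSet.isClosed.closure_eq] at this
    exact this.resolve_left hD
  obtain ⟨i, hi⟩ := Set.mem_iUnion.1 hcl
  have hsub : ∀ k, v ∈ σ k → σ k ⊆ affineSpan ℝ (σ i) := by
    intro k hk
    by_contra h
    exact hX i ⟨hmem i hi, k, hk, h⟩
  refine hv.2 ⟨affineSpan ℝ (σ i), hl i, closure_subset_affineSpan _ hi, ?_⟩
  have h1 : ∀ᶠ z in 𝓝 v, z ∉ (D : Set Plane) :=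
    D.finite_toSet.isClosed.isOpen_compl.mem_nhds hD
  have h2 : ∀ᶠ z in 𝓝 v, ∀ k, z ∈ σ k → z ∈ affineSpan ℝ (σ i) := by
    rw [eventually_all]
    intro k
    by_cases hk : v ∈ closure (σ k)
    · exact Eventually.of_forall fun z hz => hsub k (hmem k hk) hz
    · filter_upwards [isClosed_closure.isOpen_compl.mem_nhds hk] with z hz hz'
      exact absurd (subset_closure hz') hz
  filter_upwards [h1, h2, hloc i hi] with z hz1 hz2 hz3
  rw [hP]
  constructor
  · rintro (hz | hz)
    · exact absurd hz hz1
    · obtain ⟨k, hk⟩ := Set.mem_iUnion.1 hz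
      exact hz2 k hk
  · intro hz
    exact Or.inr (Set.mem_iUnion.2 ⟨i, hz3 hz⟩)

lemma infinite_of_mem_edges {K : Set Plane} (hK : K ∈ edges P) : K.Infinite := by
  obtain ⟨z, hz⟩ := nonempty_of_mem_components hK
  have hKs : K ⊆ P \ vertices P := by
    obtain ⟨z, -, rfl⟩ := hK
    exact connectedComponentIn_subset _ _
  obtain ⟨l, hl, hzl, h⟩ := exists_line_of_not_vertex (subset_closure (hKs hz).1) (hKs hz).2
  obtain ⟨r, hr, hB⟩ := Metric.eventually_nhds_iff_ball.1 h
  have hsub : Metric.ball z r ∩ l ⊆ P \ vertices P := by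
    rintro w ⟨hw, hwl⟩
    refine ⟨(hB w hw).2 hwl, fun hwV => hwV.2 ⟨l, hl, hwl, ?_⟩⟩
    filter_upwards [Metric.isOpen_ball.mem_nhds hw] with y hy using hB y hy
  have hpre : IsPreconnected (Metric.ball z r ∩ (l : Set Plane)) :=
    ((convex_ball z r).inter l.convex).isPreconnected
  have hsubK := subset_component hK hpre hsub ⟨Metric.mem_ball_self hr, hzl⟩ hz
  refine Set.Infinite.mono hsubK ?_
  obtain ⟨x, d, f, hd, hfd, hfx, hx⟩ := hl.exists_coord
  intro hfin
  have hc : Tendsto (fun c : ℝ => z + c • d) (𝓝 0) (𝓝 z) := by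
    have : Tendsto (fun c : ℝ => z + c • d) (𝓝 0) (𝓝 (z + (0 : ℝ) • d)) := by
      apply Continuous.tendsto; fun_prop
    simpa using this
  have hnb : (fun c : ℝ => z + c • d) ⁻¹' Metric.ball z r ∈ 𝓝 (0 : ℝ) :=
    hc (Metric.ball_mem_nhds z hr)
  refine infinite_of_mem_nhds (0 : ℝ) hnb ?_
  refine Set.Finite.of_finite_image (f := fun c : ℝ => z + c • d) (hfin.subset ?_) ?_
  · rintro _ ⟨c, hc, rfl⟩
    refine ⟨hc, (hx _).2 ?_⟩
    have := (hx z).1 hzl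
    simp only [map_add, map_smul, hfd, smul_eq_mul, mul_one, add_smul]
    rw [← add_assoc, ← this]
  · intro c _ c' _ h
    simpa [hd] using h

/-- The edges are controlled by the number of pieces, crossings and end points: pieces are cut at
their crossings, overlapping parts on the same line are merged, and the remaining exceptional points
are then removed from a disjoint family, each adding at most one interval. -/
lemma encard_edges_le (hP : P = (D : Set Plane) ∪ ⋃ i, σ i) (hc : ∀ i, Convex ℝ (σ i))
    (hl : ∀ i, IsLine (affineSpan ℝ (σ i))) (X : ι → Finset Plane)
    (hX : ∀ i, (X i : Set Plane) = crossings σ i) (E : Finset Plane)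
    (hE : ((D : Set Plane) ∪ ⋃ i, endPoints (σ i)) ⊆ E) :
    (edges P).encard ≤ ((Fintype.card ι + ∑ i, (X i).card + E.card : ℕ) : ℕ∞) := by
  classical
  have hexF : ∀ i, ∃ F : Finset (Set Plane), (∀ s ∈ F, IsInterval s) ∧
      ⋃₀ (F : Set (Set Plane)) = σ i \ X i ∧ F.card ≤ 1 + (X i).card := by
    intro i
    obtain ⟨F, h1, -, h3, h4⟩ := exists_family_diff {σ i}
      (by simpa using ⟨hc i, _, hl i, subset_affineSpan ℝ (σ i)⟩) (by simp) (X i)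
    exact ⟨F, h1, by simpa using h3, by simpa using h4⟩
  choose F₀ hF₀ hF₀u hF₀c using hexF
  -- the union of all pieces on one line, without crossings
  let U : ι → Set Plane := fun i =>
    (⋃ k ∈ {k | affineSpan ℝ (σ k) = affineSpan ℝ (σ i)}, σ k) \ ⋃ k, X k
  have hXmem : ∀ i v, v ∈ σ i → v ∉ X i → v ∉ ⋃ k, (X k : Set Plane) := by
    intro i v hvi hvX hv
    obtain ⟨k, hk⟩ := Set.mem_iUnion.1 hv
    rw [hX] at hk
    obtain ⟨hvk, m, hvm, hm⟩ := hk
    apply hvX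
    rw [← Finset.mem_coe, hX]
    by_cases h : affineSpan ℝ (σ k) = affineSpan ℝ (σ i)
    · exact ⟨hvi, m, hvm, by rwa [← h]⟩
    · exact ⟨hvi, k, hvk, fun h' => h (affineSpan_eq_of_subset (hl i) (hl k) h')⟩
  have hU : ∀ i k v, v ∈ U i → v ∈ U k → affineSpan ℝ (σ i) = affineSpan ℝ (σ k) := by
    rintro i k v ⟨hvi, hvX⟩ ⟨hvk, -⟩
    simp only [Set.mem_iUnion, Set.mem_ofPred_eq] at hvi hvk
    obtain ⟨i', hi', hvi⟩ := hvi
    obtain ⟨k', hk', hvk⟩ := hvk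
    rw [← hi', ← hk']
    by_contra hne
    apply hvX
    refine Set.mem_iUnion.2 ⟨k', ?_⟩
    rw [hX]
    exact ⟨hvk, i', hvi, fun h => hne (affineSpan_eq_of_subset (hl k') (hl i') h)⟩
  let Q : Set Plane → Prop := fun s => Convex ℝ s ∧ ∃ i, s ⊆ U i
  have hUl : ∀ i, U i ⊆ affineSpan ℝ (σ i) := by
    rintro i v ⟨hv, -⟩
    simp only [Set.mem_iUnion, Set.mem_ofPred_eq] at hv
    obtain ⟨k, hk, hvk⟩ := hv
    rw [← hk]; exact subset_affineSpan ℝ _ hvk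
  have hQ : ∀ s t, Q s → Q t → (s ∩ t).Nonempty → Q (s ∪ t) := by
    rintro s t ⟨hs, i, hsi⟩ ⟨ht, k, htk⟩ ⟨v, hvs, hvt⟩
    have hik := hU i k v (hsi hvs) (htk hvt)
    have hUik : U i = U k := by simp only [U, hik]
    rw [← hUik] at htk
    exact ⟨convex_union_of_line (hl i) hs ht (hsi.trans (hUl i)) (htk.trans (hUl i)) ⟨v, hvs, hvt⟩,
      i, Set.union_subset hsi htk⟩
  obtain ⟨F₁, hF₁, hF₁d, hF₁u, hF₁c⟩ := exists_disjoint_family hQ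
    (Finset.univ.biUnion F₀) (by
      intro s hs
      obtain ⟨i, -, hsi⟩ := Finset.mem_biUnion.1 hs
      refine ⟨(hF₀ i s hsi).1, i, fun v hv => ?_⟩
      have hvs : v ∈ σ i \ X i := hF₀u i ▸ ⟨s, hsi, hv⟩
      exact ⟨Set.mem_biUnion (x := i) rfl hvs.1, hXmem i v hvs.1 hvs.2⟩)
  obtain ⟨F₂, hF₂, -, hF₂u, hF₂c⟩ := exists_family_diff F₁
    (fun s hs => by
      obtain ⟨h1, i, hi⟩ := hF₁ s hs
      exact ⟨h1, _, hl i, hi.trans (hUl i)⟩) hF₁d E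
  have hcover : ⋃₀ (F₂ : Set (Set Plane)) = ((⋃ i, σ i) \ ⋃ i, X i) \ E := by
    rw [hF₂u, hF₁u]
    congr 1
    ext v
    constructor
    · rintro ⟨s, hs, hv⟩
      obtain ⟨i, -, hsi⟩ := Finset.mem_biUnion.1 hs
      have hvs : v ∈ σ i \ X i := hF₀u i ▸ ⟨s, hsi, hv⟩
      exact ⟨Set.mem_iUnion.2 ⟨i, hvs.1⟩, hXmem i v hvs.1 hvs.2⟩
    · rintro ⟨hv, hvX⟩
      obtain ⟨i, hi⟩ := Set.mem_iUnion.1 hv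
      have : v ∈ ⋃₀ (F₀ i : Set (Set Plane)) := by
        rw [hF₀u]; exact ⟨hi, fun h => hvX (Set.mem_iUnion.2 ⟨i, h⟩)⟩
      obtain ⟨s, hs, hvs⟩ := this
      exact ⟨s, Finset.mem_coe.2 (Finset.mem_biUnion.2 ⟨i, Finset.mem_univ _, hs⟩), hvs⟩
  have hV : vertices P ⊆ E ∪ ⋃ i, (X i : Set Plane) := by
    refine (vertices_subset hP hl).trans (Set.union_subset_union hE ?_)
    simp only [hX]; rfl
  have hfin : ((E : Set Plane) ∪ ⋃ i, (X i : Set Plane)).Finite :=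
    E.finite_toSet.union (Set.finite_iUnion fun i => (X i).finite_toSet)
  have hchoose : ∀ K ∈ edges P, ∃ s ∈ F₂, s.Nonempty ∧ s ⊆ K := by
    intro K hK
    have hKs : K ⊆ P \ vertices P := by
      obtain ⟨z, -, rfl⟩ := hK
      exact connectedComponentIn_subset _ _
    obtain ⟨z, hzK, hz⟩ := ((infinite_of_mem_edges hK).sdiff hfin).nonempty
    have hzP := (hKs hzK).1
    have hz2 : z ∈ ⋃₀ (F₂ : Set (Set Plane)) := by
      rw [hcover]
      rw [hP] at hzP
      refine ⟨⟨hzP.resolve_left fun h => hz (Or.inl (hE (Or.inl h))), fun h => hz (Or.inr h)⟩,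
        fun h => hz (Or.inl h)⟩
    obtain ⟨s, hs, hzs⟩ := hz2
    refine ⟨s, hs, ⟨z, hzs⟩, subset_component hK (hF₂ s hs).1.isPreconnected ?_ hzs hzK⟩
    intro w hw
    have hwc : w ∈ ((⋃ i, σ i) \ ⋃ i, (X i : Set Plane)) \ E := hcover ▸ ⟨s, hs, hw⟩
    refine ⟨hP ▸ Or.inr hwc.1.1, fun hwV => ?_⟩
    rcases hV hwV with h | h
    · exact hwc.2 h
    · exact hwc.1.2 h
  choose! g hgF hgne hgK using hchoose
  have hinj : Set.InjOn g (edges P) := by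
    intro K hK K' hK' h
    obtain ⟨z, hz⟩ := hgne K hK
    exact components_eq_of_mem hK hK' (hgK K hK hz) (hgK K' hK' (h ▸ hz))
  have hcard : F₂.card ≤ Fintype.card ι + ∑ i, (X i).card + E.card := by
    have h1 : (Finset.univ.biUnion F₀).card ≤ ∑ i, (1 + (X i).card) :=
      Finset.card_biUnion_le.trans (Finset.sum_le_sum fun i _ => hF₀c i)
    rw [Finset.sum_add_distrib] at h1
    simp only [Finset.sum_const, Finset.card_univ, smul_eq_mul, mul_one] at h1
    omega
  calc (edges P).encard ≤ (F₂ : Set (Set Plane)).encard :=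
        Set.encard_le_encard_of_injOn (fun K hK => hgF K hK) hinj
    _ = F₂.card := Set.encard_coe_eq_coe_finsetCard F₂
    _ ≤ _ := by exact_mod_cast hcard

/-- The complexity of a finite union of segments and points is linear in the number of pieces and
of crossings, counted with the pieces they lie on. -/
theorem complexity_le_of_union (hP : P = (D : Set Plane) ∪ ⋃ i, σ i) (hc : ∀ i, Convex ℝ (σ i))
    (hl : ∀ i, IsLine (affineSpan ℝ (σ i))) {N : ι → ℕ}
    (hN : ∀ i, (crossings σ i).encard ≤ N i) :
    complexity P ≤
      ((4 * D.card + 11 * Fintype.card ι + 4 * ∑ i, N i + 1 : ℕ) : ℕ∞) := by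
  classical
  have hXfin : ∀ i, (crossings σ i).Finite := fun i => Set.finite_of_encard_le_coe (hN i)
  have hEfin : ∀ i, (endPoints (σ i)).Finite := fun i =>
    Set.finite_of_encard_le_coe (k := 2) (encard_endPoints_le (hc i) (hl i))
  let X : ι → Finset Plane := fun i => (hXfin i).toFinset
  have hXc : ∀ i, (X i).card ≤ N i := by
    intro i
    have := hN i
    rw [(hXfin i).encard_eq_coe_toFinset_card] at this
    exact_mod_cast this
  have hEc : ∀ i, (hEfin i).toFinset.card ≤ 2 := by
    intro i
    have := encard_endPoints_le (hc i) (hl i)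
    rw [(hEfin i).encard_eq_coe_toFinset_card] at this
    exact_mod_cast this
  let E : Finset Plane := D ∪ Finset.univ.biUnion fun i => (hEfin i).toFinset
  have hEcard : E.card ≤ D.card + 2 * Fintype.card ι := by
    refine (Finset.card_union_le _ _).trans (Nat.add_le_add_left ?_ _)
    refine Finset.card_biUnion_le.trans ((Finset.sum_le_sum fun i _ => hEc i).trans ?_)
    simp [mul_comm]
  have hEeq : ((D : Set Plane) ∪ ⋃ i, endPoints (σ i)) = E := by
    simp [E]
  have hXsum : ∑ i, (X i).card ≤ ∑ i, N i := Finset.sum_le_sum fun i _ => hXc i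
  let W : Finset Plane := E ∪ Finset.univ.biUnion X
  have hVW : vertices P ⊆ W := by
    refine (vertices_subset hP hl).trans ?_
    rw [hEeq]
    simp [W, X]
  have hWcard : W.card ≤ D.card + 2 * Fintype.card ι + ∑ i, N i :=
    (Finset.card_union_le _ _).trans (Nat.add_le_add hEcard (Finset.card_biUnion_le.trans hXsum))
  have hV : (vertices P).encard ≤ (W.card : ℕ∞) := by
    rw [← Set.encard_coe_eq_coe_finsetCard]; exact Set.encard_le_encard hVW
  have hfin : (vertices P).Finite := W.finite_toSet.subset hVW
  have hEd := encard_edges_le hP hc hl X (by simp [X]) E hEeq.subset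
  have hEd' : (edges P).encard ≤ ((D.card + 3 * Fintype.card ι + ∑ i, N i : ℕ) : ℕ∞) :=
    hEd.trans (by norm_cast; omega)
  have hF := encard_faces_le hfin
  calc complexity P ≤ (vertices P).encard + (edges P).encard + (2 * (edges P).encard + 1) := by
        unfold complexity; gcongr
    _ ≤ ((D.card + 2 * Fintype.card ι + ∑ i, N i : ℕ) : ℕ∞) +
        ((D.card + 3 * Fintype.card ι + ∑ i, N i : ℕ) : ℕ∞) +
        (2 * ((D.card + 3 * Fintype.card ι + ∑ i, N i : ℕ) : ℕ∞) + 1) := by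
        gcongr
        exact hV.trans (by exact_mod_cast hWcard)
    _ ≤ _ := by norm_cast; omega

end Union

/-! ### Affine functions on the plane -/

lemma exists_lineMap_eq {l : AffineSubspace ℝ Plane} {f : Plane →L[ℝ] ℝ} (hf : Set.InjOn f l)
    {a b z : Plane} (ha : a ∈ l) (hb : b ∈ l) (hz : z ∈ l) (h1 : f a < f z) (h2 : f z < f b) :
    ∃ θ ∈ Set.Ioo (0 : ℝ) 1, AffineMap.lineMap a b θ = z := by
  have hab : 0 < f b - f a := by linarith
  refine ⟨(f z - f a) / (f b - f a), ⟨div_pos (by linarith) hab, ?_⟩, ?_⟩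
  · rw [div_lt_one hab]; linarith
  · apply hf (AffineMap.lineMap_mem _ ha hb) hz
    simp only [AffineMap.lineMap_apply, vsub_eq_sub, vadd_eq_add, map_add, map_smul, map_sub,
      smul_eq_mul]
    field_simp; ring

lemma affine_add (h : Plane →ᵃ[ℝ] ℝ) (x v : Plane) : h (x + v) = h x + h.linear v := by
  have := h.map_vadd x v
  rwa [vadd_eq_add, add_comm, vadd_eq_add, add_comm (h.linear v)] at this

lemma affine_lineMap (h : Plane →ᵃ[ℝ] ℝ) (x y : Plane) (θ : ℝ) :
    h (AffineMap.lineMap x y θ) = (1 - θ) * h x + θ * h y := by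
  rw [AffineMap.apply_lineMap, AffineMap.lineMap_apply]; simp; ring

lemma finrank_ker_eq_one {g : Plane →ₗ[ℝ] ℝ} (hg : g ≠ 0) :
    Module.finrank ℝ (LinearMap.ker g) = 1 := by
  have h1 := g.finrank_range_add_finrank_ker
  have h2 : LinearMap.range g = ⊤ := LinearMap.range_eq_top.2 (LinearMap.surjective hg)
  rw [h2, finrank_top, Module.finrank_self] at h1
  have h3 : Module.finrank ℝ Plane = 2 := by simp
  omega

/-- An affine function that vanishes at two points of a line and at one point off it is zero. -/
lemma affine_eq_zero {l : AffineSubspace ℝ Plane} (hl : IsLine l) {h : Plane →ᵃ[ℝ] ℝ}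
    {a b w : Plane} (ha : a ∈ l) (hb : b ∈ l) (hab : a ≠ b) (hw : w ∉ l) (ha0 : h a = 0)
    (hb0 : h b = 0) (hw0 : h w = 0) (z : Plane) : h z = 0 := by
  have hlin : h.linear = 0 := by
    by_contra hne
    have hker := finrank_ker_eq_one hne
    have hv : ∀ v, h (a + v) = h.linear v := fun v => by rw [affine_add, ha0, zero_add]
    have hdir : l.direction ≤ LinearMap.ker h.linear := by
      have hba : b -ᵥ a ∈ l.direction := AffineSubspace.vsub_mem_direction hb ha
      have hne' : (⟨b -ᵥ a, hba⟩ : l.direction) ≠ 0 := by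
        intro e
        have := congrArg Subtype.val e
        simp [sub_eq_zero] at this
        exact hab this.symm
      intro v hvd
      obtain ⟨c, hc⟩ := (finrank_eq_one_iff_of_nonzero' _ hne').1 hl ⟨v, hvd⟩
      have hc' : c • (b - a) = v := by simpa using congrArg Subtype.val hc
      rw [LinearMap.mem_ker, ← hc', map_smul, ← hv]
      simp [hb0]
    have heq := Submodule.eq_of_le_of_finrank_eq hdir (by rw [hker]; exact hl)
    apply hw
    have hmem : w - a ∈ l.direction := by
      rw [heq, LinearMap.mem_ker, ← hv]; simpa using hw0
    have := AffineSubspace.vadd_mem_of_mem_direction hmem ha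
    simpa using this
  have := affine_add h a (z - a)
  rw [hlin, ha0] at this
  simpa using this

lemma isLine_affineSpan {s : Set Plane} (hs : Convex ℝ s) (hi : interior s = ∅)
    (hn : s.Nontrivial) : IsLine (affineSpan ℝ s) := by
  have hne : ((affineSpan ℝ s : AffineSubspace ℝ Plane) : Set Plane).Nonempty :=
    hn.nonempty.mono (subset_affineSpan ℝ s)
  have htop : affineSpan ℝ s ≠ ⊤ := by
    rw [Ne, ← hs.interior_nonempty_iff_affineSpan_eq_top, hi]; simp
  have hdir : (affineSpan ℝ s).direction ≠ ⊤ := fun h =>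
    htop ((AffineSubspace.direction_eq_top_iff_of_nonempty hne).1 h)
  have h2 : Module.finrank ℝ Plane = 2 := by simp
  have hlt := Submodule.finrank_lt hdir
  have hpos : 0 < Module.finrank ℝ (affineSpan ℝ s).direction := by
    obtain ⟨x, hx, y, hy, hxy⟩ := hn
    have hmem := AffineSubspace.vsub_mem_direction (subset_affineSpan ℝ s hy)
      (subset_affineSpan ℝ s hx)
    rw [Module.finrank_pos_iff_exists_ne_zero]
    refine ⟨⟨_, hmem⟩, fun e => hxy ?_⟩
    have := congrArg Subtype.val e
    simp [sub_eq_zero] at this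
    exact this.symm
  unfold IsLine
  omega

/-! ### Exits of rays through a family of lines -/

section Exits

set_option linter.unusedSectionVars false

variable {ι : Type*} [Fintype ι] [LinearOrder ι] (φ : ι → Plane →ᵃ[ℝ] ℝ)

/-- The number `t` for which `x - t • e` is on the line `φ i = 0`, as a function of `x`. If `e` is
parallel to the line this is the constant `0`, which the positivity in `Exit` excludes. -/
noncomputable def reach (e : Plane) (i : ι) : Plane →ᵃ[ℝ] ℝ := ((φ i).linear e)⁻¹ • φ i

/-- The sides of the lines on which `x` lies. Off the lines, `sgn φ` encodes the face of their
arrangement that contains `x`. -/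
noncomputable def sgn (x : Plane) : ι → SignType := fun i => SignType.sign (φ i x)

/-- The ray from `x` in direction `-e` first meets the line `i`. Among several lines through the
same point the least index is taken, so that an exit is unique. -/
def Exit (e x : Plane) (i : ι) : Prop :=
  0 < reach φ e i x ∧ ∀ k, 0 < reach φ e k x →
    reach φ e i x < reach φ e k x ∨ (reach φ e i x = reach φ e k x ∧ i ≤ k)

variable {φ}

lemma reach_apply (e : Plane) (i : ι) (x : Plane) :
    reach φ e i x = ((φ i).linear e)⁻¹ * φ i x := by simp [reach]

lemma reach_linear (e : Plane) (i : ι) (v : Plane) :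
    (reach φ e i).linear v = ((φ i).linear e)⁻¹ * (φ i).linear v := by simp [reach]

lemma linear_ne_zero_of_reach_pos {e x : Plane} {i : ι} (h : 0 < reach φ e i x) :
    (φ i).linear e ≠ 0 := by
  intro h0
  rw [reach_apply, h0] at h
  simp at h

lemma reach_linear_self {e x : Plane} {i : ι} (h : 0 < reach φ e i x) :
    (reach φ e i).linear e = 1 := by
  rw [reach_linear, inv_mul_cancel₀ (linear_ne_zero_of_reach_pos h)]

lemma reach_pos_congr {e x y : Plane} (h : sgn φ x = sgn φ y) {i : ι} (hx : 0 < reach φ e i x) :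
    0 < reach φ e i y := by
  have hi := congrFun h i
  simp only [sgn] at hi
  rw [← sign_eq_one_iff, reach_apply, sign_mul, ← hi, ← sign_mul, ← reach_apply]
  exact sign_eq_one_iff.2 hx

lemma Exit.le {e x : Plane} {i k : ι} (h : Exit φ e x i) (hk : 0 < reach φ e k x) :
    reach φ e i x ≤ reach φ e k x := by
  rcases h.2 k hk with h | h
  · exact h.le
  · exact h.1.le

lemma Exit.unique {e x : Plane} {i k : ι} (hi : Exit φ e x i) (hk : Exit φ e x k) : i = k := by
  rcases hi.2 k hk.1 with h1 | h1 <;> rcases hk.2 i hi.1 with h2 | h2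
  · exact absurd h1 h2.not_gt
  · exact absurd h2.1.symm h1.ne
  · exact absurd h1.1.symm h2.ne
  · exact le_antisymm h1.2 h2.2

lemma exists_exit {e x : Plane} {k : ι} (hk : 0 < reach φ e k x) : ∃ i, Exit φ e x i := by
  classical
  obtain ⟨i, hi, hmin⟩ := Finset.exists_min_image
    (Finset.univ.filter fun k => 0 < reach φ e k x) (fun k => toLex (reach φ e k x, k))
    ⟨k, by simpa using hk⟩
  refine ⟨i, by simpa using hi, fun m hm => ?_⟩
  have := hmin m (by simpa using hm)
  rwa [Prod.Lex.toLex_le_toLex] at this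

/-- The points of a face from which rays leave through a given line form a strip. -/
lemma Exit.of_between {e x y z : Plane} {i : ι} (hxy : sgn φ x = sgn φ y)
    (hxz : sgn φ x = sgn φ z) (hx : Exit φ e x i) (hy : Exit φ e y i) {θ r : ℝ}
    (hθ : θ ∈ Set.Icc (0 : ℝ) 1) (hz : z = AffineMap.lineMap x y θ + r • e) :
    Exit φ e z i := by
  have hval : ∀ k, 0 < reach φ e k x →
      reach φ e k z = (1 - θ) * reach φ e k x + θ * reach φ e k y + r := by
    intro k hk
    rw [hz, affine_add, map_smul, reach_linear_self hk, affine_lineMap]; simp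
  refine ⟨reach_pos_congr hxz hx.1, fun k hk => ?_⟩
  have hkx := reach_pos_congr hxz.symm hk
  have hky := reach_pos_congr hxy hkx
  rw [hval i hx.1, hval k hkx]
  have h1 := hx.le hkx
  have h2 := hy.le hky
  obtain ⟨h3, h4⟩ := hθ
  have hle : (1 - θ) * reach φ e i x + θ * reach φ e i y ≤
      (1 - θ) * reach φ e k x + θ * reach φ e k y := by
    have := mul_le_mul_of_nonneg_left h1 (sub_nonneg.2 h4)
    have := mul_le_mul_of_nonneg_left h2 h3
    linarith
  rcases hx.2 k hkx with g1 | g1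
  · rcases hy.2 k hky with g2 | g2
    · left
      have hθ' : 0 < 1 - θ ∨ 0 < θ := by
        by_contra hcon
        push Not at hcon
        linarith [hcon.1, hcon.2]
      rcases hθ' with h | h
      · nlinarith [mul_lt_mul_of_pos_left g1 h, mul_le_mul_of_nonneg_left h2 h3]
      · nlinarith [mul_lt_mul_of_pos_left g2 h, mul_le_mul_of_nonneg_left h1 (sub_nonneg.2 h4)]
    · rcases hle.lt_or_eq with g | g
      · left; linarith
      · right; exact ⟨by linarith, g2.2⟩
  · rcases hle.lt_or_eq with g | g
    · left; linarith
    · right; exact ⟨by linarith, g1.2⟩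

lemma sgn_lineMap {x y : Plane} (hx : ∀ i, φ i x ≠ 0) (hxy : sgn φ x = sgn φ y) {θ : ℝ}
    (hθ : θ ∈ Set.Icc (0 : ℝ) 1) : sgn φ (AffineMap.lineMap x y θ) = sgn φ x := by
  funext i
  have hi := congrFun hxy i
  simp only [sgn] at hi ⊢
  rw [affine_lineMap]
  obtain ⟨h3, h4⟩ := hθ
  have hθ' : 0 < 1 - θ ∨ 0 < θ := by
    by_contra hcon
    push Not at hcon
    linarith [hcon.1, hcon.2]
  rcases lt_or_gt_of_ne (hx i) with h | h
  · rw [sign_neg h] at hi ⊢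
    have hy := sign_eq_neg_one_iff.1 hi.symm
    rw [sign_eq_neg_one_iff]
    rcases hθ' with g | g <;> nlinarith
  · rw [sign_pos h] at hi ⊢
    have hy := sign_eq_one_iff.1 hi.symm
    rw [sign_eq_one_iff]
    rcases hθ' with g | g <;> nlinarith

lemma ne_zero_of_sgn_eq {x y : Plane} (hx : ∀ i, φ i x ≠ 0) (hxy : sgn φ x = sgn φ y) (i : ι) :
    φ i y ≠ 0 := by
  have hi := congrFun hxy i
  simp only [sgn] at hi
  intro h
  rw [h, sign_zero, sign_eq_zero_iff] at hi
  exact hx i hi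

lemma eventually_sgn_eq {x : Plane} (hx : ∀ i, φ i x ≠ 0) :
    ∀ᶠ y in 𝓝 x, sgn φ x = sgn φ y := by
  have : ∀ᶠ y in 𝓝 x, ∀ i, SignType.sign (φ i x) = SignType.sign (φ i y) := by
    rw [eventually_all]
    intro i
    have hc : Continuous (φ i) := (φ i).continuous_of_finiteDimensional
    rcases lt_or_gt_of_ne (hx i) with h | h
    · filter_upwards [(isOpen_lt hc continuous_const).mem_nhds h] with y hy
      rw [sign_neg h, sign_neg hy]
    · filter_upwards [(isOpen_lt continuous_const hc).mem_nhds h] with y hy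
      rw [sign_pos h, sign_pos hy]
  filter_upwards [this] with y hy using funext hy

variable (φ) in
/-- The points `x` in a fixed face of the arrangement whose rays in the directions `-e` and `-e'`
first meet fixed lines, at distances that sum to `ε` and are at most `κ` and `κ'`. The index
consists of the face, as a sign vector, and the two lines. -/
def piece (ε : ℝ) (e e' : Plane) (κ κ' : ℝ) (t : (ι → SignType) × ι × ι) : Set Plane :=
  {x | (∀ i, φ i x ≠ 0) ∧ sgn φ x = t.1 ∧ Exit φ e x t.2.1 ∧ Exit φ e' x t.2.2 ∧
    reach φ e t.2.1 x + reach φ e' t.2.2 x = ε ∧ reach φ e t.2.1 x ≤ κ ∧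
    reach φ e' t.2.2 x ≤ κ'}

variable {ε : ℝ} {e e' : Plane} {κ κ' : ℝ}

lemma piece_index_unique {t t' : (ι → SignType) × ι × ι} {x : Plane}
    (h : x ∈ piece φ ε e e' κ κ' t) (h' : x ∈ piece φ ε e e' κ κ' t') : t = t' := by
  obtain ⟨s, i, k⟩ := t
  obtain ⟨s', i', k'⟩ := t'
  obtain ⟨-, h1, h2, h3, -⟩ := h
  obtain ⟨-, g1, g2, g3, -⟩ := h'
  simp only at h1 h2 h3 g1 g2 g3
  rw [← h1, ← g1, h2.unique g2, h3.unique g3]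

lemma convex_piece (t : (ι → SignType) × ι × ι) : Convex ℝ (piece φ ε e e' κ κ' t) := by
  rw [convex_iff_segment_subset]
  intro x hx y hy z hz
  rw [segment_eq_image_lineMap] at hz
  obtain ⟨θ, hθ, rfl⟩ := hz
  obtain ⟨h0, h1, h2, h3, h4, h5, h6⟩ := hx
  obtain ⟨g0, g1, g2, g3, g4, g5, g6⟩ := hy
  have hxy : sgn φ x = sgn φ y := h1.trans g1.symm
  have hz := sgn_lineMap h0 hxy hθ
  refine ⟨ne_zero_of_sgn_eq h0 hz.symm, hz.trans h1, ?_, ?_, ?_, ?_, ?_⟩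
  · exact h2.of_between hxy hz.symm g2 hθ (r := 0) (by simp)
  · exact h3.of_between hxy hz.symm g3 hθ (r := 0) (by simp)
  · rw [affine_lineMap, affine_lineMap]; linear_combination (1 - θ) * h4 + θ * g4
  · rw [affine_lineMap]; nlinarith [hθ.1, hθ.2]
  · rw [affine_lineMap]; nlinarith [hθ.1, hθ.2]

variable (φ ε e e' κ κ') in
/-- The pieces cover no neighbourhood of a point: they leave no two degrees of freedom. -/
def NoInterior : Prop :=
  ∀ x, ¬ ∀ᶠ y in 𝓝 x, ∃ t, y ∈ piece φ ε e e' κ κ' t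

lemma NoInterior.isLine (h : NoInterior φ ε e e' κ κ') {t : (ι → SignType) × ι × ι}
    (ht : (piece φ ε e e' κ κ' t).Nontrivial) :
    IsLine (affineSpan ℝ (piece φ ε e e' κ κ' t)) := by
  refine isLine_affineSpan (convex_piece t) ?_ ht
  rw [Set.eq_empty_iff_forall_notMem]
  intro x hx
  apply h x
  filter_upwards [mem_interior_iff_mem_nhds.1 hx] with y hy using ⟨t, hy⟩

lemma le_reach_add_reach {x y : Plane} {t : (ι → SignType) × ι × ι}
    (hx : x ∈ piece φ ε e e' κ κ' t) (hxy : sgn φ x = sgn φ y) {i k : ι}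
    (hi : 0 < reach φ e i y) (hk : 0 < reach φ e' k y) :
    ε ≤ reach φ e i x + reach φ e' k x := by
  obtain ⟨-, -, h2, h3, h4, -, -⟩ := hx
  have := h2.le (reach_pos_congr hxy.symm hi)
  have := h3.le (reach_pos_congr hxy.symm hk)
  linarith

/-- In one face, a line crosses pieces in other directions at most twice, if the bounds `κ`, `κ'`
are not active: the length is a concave function, so it would otherwise be constant around a point
of the triangle spanned by two of the crossings and a further point of the piece through the middle
one. -/
lemma encard_crossing_le_two (hε : ε ≤ κ) (hε' : ε ≤ κ') (hno : NoInterior φ ε e e' κ κ')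
    {l : AffineSubspace ℝ Plane} (hl : IsLine l) (s : ι → SignType) :
    {x | x ∈ l ∧ ∃ t, t.1 = s ∧ x ∈ piece φ ε e e' κ κ' t ∧
      ¬ piece φ ε e e' κ κ' t ⊆ l}.encard ≤ 2 := by
  obtain ⟨f, hf⟩ := hl.exists_injOn
  refine encard_le_two_of_between hf (fun x hx => hx.1) ?_
  rintro a ⟨hal, ta, rfl, hat, -⟩ b ⟨hbl, tb, hbs, hbt, hbn⟩ c ⟨hcl, tc, hcs, hct, -⟩ hab hbc
  obtain ⟨w, hwt, hwl⟩ := Set.not_subset.1 hbn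
  obtain ⟨θ, hθ, hbθ⟩ := exists_lineMap_eq hf hal hcl hbl hab hbc
  have hzt : AffineMap.lineMap b w (1 / 2 : ℝ) ∈ piece φ ε e e' κ κ' tb :=
    (convex_piece tb).lineMap_mem hbt hwt (by norm_num)
  set z : Plane := AffineMap.lineMap b w (1 / 2 : ℝ) with hzdef
  have hza : sgn φ z = sgn φ a := by rw [hzt.2.1, hat.2.1, hbs]
  have hzc : sgn φ z = sgn φ c := by rw [hzt.2.1, hct.2.1, hbs, hcs]
  have hzw : sgn φ z = sgn φ w := by rw [hzt.2.1, hwt.2.1]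
  -- an upper bound of the length that is attained at `z` is constant
  have hflat : ∀ i k, 0 < reach φ e i z → 0 < reach φ e' k z →
      reach φ e i z + reach φ e' k z = ε → ∀ y, reach φ e i y + reach φ e' k y = ε := by
    intro i k hi hk hik y
    have h1 := le_reach_add_reach hat hza.symm hi hk
    have h2 := le_reach_add_reach hct hzc.symm hi hk
    have h3 := le_reach_add_reach hwt hzw.symm hi hk
    let h : Plane →ᵃ[ℝ] ℝ := reach φ e i + reach φ e' k - AffineMap.const ℝ Plane ε
    have hh : ∀ y, h y = reach φ e i y + reach φ e' k y - ε := fun y => by simp [h]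
    have hz0 : (1 - (1 / 2 : ℝ)) * ((1 - θ) * h a + θ * h c) + (1 / 2) * h w = 0 := by
      rw [← affine_lineMap, hbθ, ← affine_lineMap, ← hzdef, hh]; linarith
    have ha : 0 ≤ h a := by rw [hh]; linarith
    have hc : 0 ≤ h c := by rw [hh]; linarith
    have hw : 0 ≤ h w := by rw [hh]; linarith
    have e1 : 0 ≤ (1 - θ) * h a := mul_nonneg (by linarith [hθ.2]) ha
    have e2 : 0 ≤ θ * h c := mul_nonneg hθ.1.le hc
    have ha0 : h a = 0 := by
      have : (1 - θ) * h a = 0 := by linarith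
      exact (mul_eq_zero.1 this).resolve_left (by linarith [hθ.2])
    have hc0 : h c = 0 := by
      have : θ * h c = 0 := by linarith
      exact (mul_eq_zero.1 this).resolve_left (by linarith [hθ.1])
    have hw0 : h w = 0 := by linarith
    have hac : a ≠ c := fun e => by rw [e] at hab; linarith
    have := affine_eq_zero hl hal hcl hac hwl ha0 hc0 hw0 y
    rw [hh] at this
    linarith
  apply hno z
  have hge : ∀ᶠ y in 𝓝 z, ∀ i k, 0 < reach φ e i z → 0 < reach φ e' k z →
      ε ≤ reach φ e i y + reach φ e' k y := by
    rw [eventually_all]; intro i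
    rw [eventually_all]; intro k
    by_cases hi : 0 < reach φ e i z
    swap
    · exact Eventually.of_forall fun y h => absurd h hi
    by_cases hk : 0 < reach φ e' k z
    swap
    · exact Eventually.of_forall fun y _ h => absurd h hk
    rcases (le_reach_add_reach hzt rfl hi hk).lt_or_eq with h | h
    · have hc : Continuous fun y => reach φ e i y + reach φ e' k y :=
        (reach φ e i).continuous_of_finiteDimensional.add
          (reach φ e' k).continuous_of_finiteDimensional
      filter_upwards [(isOpen_lt continuous_const hc).mem_nhds h] with y hy _ _ using le_of_lt hy
    · exact Eventually.of_forall fun y _ _ => (hflat i k hi hk h.symm y).ge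
  filter_upwards [hge, eventually_sgn_eq hzt.1] with y hy hzy
  obtain ⟨h0, h1, h2, h3, h4, -, -⟩ := hzt
  obtain ⟨i, hi⟩ := exists_exit (reach_pos_congr hzy h2.1)
  obtain ⟨k, hk⟩ := exists_exit (reach_pos_congr hzy h3.1)
  have hsum : reach φ e i y + reach φ e' k y = ε := by
    refine le_antisymm ?_ (hy i k (reach_pos_congr hzy.symm hi.1) (reach_pos_congr hzy.symm hk.1))
    have := hi.le (reach_pos_congr hzy h2.1)
    have := hk.le (reach_pos_congr hzy h3.1)
    have := hflat _ _ h2.1 h3.1 h4 y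
    linarith
  refine ⟨(sgn φ y, i, k), ne_zero_of_sgn_eq h0 hzy, rfl, hi, hk, hsum, ?_, ?_⟩
  · have := hk.1
    simp only at *
    linarith
  · have := hi.1
    simp only at *
    linarith

end Exits

/-! ### Faces along a line -/

/-- A function on the reals that changes only at given thresholds takes few values. The bound allows
for exceptional values at the thresholds themselves. -/
lemma card_image_le_of_thresholds {ι α : Type*} [DecidableEq α] (K : Finset ι) (r : ι → ℝ)
    (ψ : ℝ → α) (T : Finset ℝ)
    (h : ∀ t ∈ T, ∀ t' ∈ T, t < t' → ψ t ≠ ψ t' → ∃ k ∈ K, t ≤ r k ∧ r k ≤ t') :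
    (T.image ψ).card ≤ 2 * K.card + 1 := by
  classical
  -- `N` takes at most `2 * K.card + 1` values and increases whenever `ψ` changes
  let N : ℝ → ℕ := fun t => (K.filter fun k => r k < t).card + (K.filter fun k => r k ≤ t).card
  have hmono : ∀ t ∈ T, ∀ t' ∈ T, t < t' → ψ t ≠ ψ t' → N t < N t' := by
    intro t ht t' ht' htt hne
    obtain ⟨k, hk, h1, h2⟩ := h t ht t' ht' htt hne
    have s1 : K.filter (fun k => r k < t) ⊆ K.filter (fun k => r k < t') := fun m hm => by
      simp only [Finset.mem_filter] at hm ⊢; exact ⟨hm.1, hm.2.trans htt⟩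
    have s2 : K.filter (fun k => r k ≤ t) ⊆ K.filter (fun k => r k ≤ t') := fun m hm => by
      simp only [Finset.mem_filter] at hm ⊢; exact ⟨hm.1, hm.2.trans htt.le⟩
    rcases h2.lt_or_eq with h3 | h3
    · refine add_lt_add_of_lt_of_le (Finset.card_lt_card ⟨s1, fun hs => ?_⟩) (Finset.card_le_card s2)
      have := hs (Finset.mem_filter.2 ⟨hk, h3⟩)
      simp only [Finset.mem_filter] at this
      linarith [this.2]
    · refine add_lt_add_of_le_of_lt (Finset.card_le_card s1) (Finset.card_lt_card ⟨s2, fun hs => ?_⟩)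
      have := hs (Finset.mem_filter.2 ⟨hk, h2⟩)
      simp only [Finset.mem_filter] at this
      linarith [this.2]
  have hrep : ∀ y ∈ T.image ψ, ∃ t ∈ T, ψ t = y := fun y hy => Finset.mem_image.1 hy
  choose! rep hrepT hrepψ using hrep
  have := Finset.card_le_card_of_injOn (s := T.image ψ) (t := Finset.range (2 * K.card + 1))
    (fun y => N (rep y)) (by
      intro y _
      have h1 := Finset.card_filter_le K (fun k => r k < rep y)
      have h2 := Finset.card_filter_le K (fun k => r k ≤ rep y)
      simp only [Finset.coe_range, Set.mem_Iio, N]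
      omega) (by
      intro y hy y' hy' hyy
      by_contra hne
      have hne' : ψ (rep y) ≠ ψ (rep y') := by rwa [hrepψ y hy, hrepψ y' hy']
      rcases lt_trichotomy (rep y) (rep y') with hlt | heq | hgt
      · exact (hmono _ (hrepT y hy) _ (hrepT y' hy') hlt hne').ne hyy
      · exact hne' (by rw [heq])
      · exact (hmono _ (hrepT y' hy') _ (hrepT y hy) hgt hne'.symm).ne hyy.symm)
  simpa using this

section Exits

set_option linter.unusedSectionVars false

variable {ι : Type*} [Fintype ι] [LinearOrder ι] (φ : ι → Plane →ᵃ[ℝ] ℝ)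

open Classical in
/-- The pairs of a face and a line that bounds the face on the side of the direction `-e`. -/
noncomputable def rows (e : Plane) : Finset ((ι → SignType) × ι) :=
  Finset.univ.filter fun a => ∃ x, (∀ i, φ i x ≠ 0) ∧ sgn φ x = a.1 ∧ Exit φ e x a.2

variable {φ}

/-- The face of `x` is determined by the point at which the ray from `x` leaves it, so that it is
among the `2n + 1` faces met along one side of a line. -/
lemma card_rows_le (e : Plane) : (rows φ e).card ≤ Fintype.card ι * (2 * Fintype.card ι + 1) := by
  classical
  have himg : ((rows φ e).image Prod.snd).card ≤ Fintype.card ι := Finset.card_le_univ _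
  have hfib : ∀ i ∈ (rows φ e).image Prod.snd,
      ((rows φ e).filter fun a => a.2 = i).card ≤ 2 * Fintype.card ι + 1 := by
    intro i hi
    have hex : ∀ a ∈ (rows φ e).filter fun a => a.2 = i,
        ∃ x, (∀ i, φ i x ≠ 0) ∧ sgn φ x = a.1 ∧ Exit φ e x i := by
      rintro ⟨s, k⟩ ha
      simp only [rows, Finset.mem_filter, Finset.mem_univ, true_and] at ha
      obtain ⟨⟨x, h1, h2, h3⟩, rfl⟩ := ha
      exact ⟨x, h1, h2, h3⟩
    choose! x hx0 hxs hxe using hex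
    obtain ⟨a₀, ha₀, rfl⟩ := Finset.mem_image.1 hi
    have ha₀' : a₀ ∈ (rows φ e).filter fun a => a.2 = a₀.2 := by simp [ha₀]
    have hlin := linear_ne_zero_of_reach_pos (hxe a₀ ha₀').1
    have hφne : (φ a₀.2).linear ≠ 0 := fun h => hlin (by rw [h]; rfl)
    obtain ⟨⟨d, hd⟩, hd0, hspan⟩ := finrank_eq_one_iff'.1 (finrank_ker_eq_one hφne)
    -- the point at which the ray leaves the face
    let foot : (ι → SignType) × ι → Plane := fun a => x a - reach φ e a₀.2 (x a) • e
    have hfoot : ∀ a, φ a₀.2 (foot a) = 0 := by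
      intro a
      simp only [foot, sub_eq_add_neg, ← neg_smul]
      rw [affine_add, map_smul, reach_apply, smul_eq_mul]
      linear_combination (-φ a₀.2 (x a)) * inv_mul_cancel₀ hlin
    have hpar : ∀ a, ∃ t : ℝ, foot a = foot a₀ + t • d := by
      intro a
      have hk : foot a - foot a₀ ∈ LinearMap.ker (φ a₀.2).linear := by
        have := affine_add (φ a₀.2) (foot a₀) (foot a - foot a₀)
        rw [add_sub_cancel, hfoot, hfoot] at this
        rw [LinearMap.mem_ker]; linarith
      obtain ⟨c, hc⟩ := hspan ⟨_, hk⟩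
      have hc' : c • d = foot a - foot a₀ := by simpa using congrArg Subtype.val hc
      exact ⟨c, by rw [hc']; abel⟩
    choose t ht using hpar
    -- the face just beyond the point of the line with parameter `u`
    let ψ : ℝ → ι → SignType := fun u k =>
      if φ k (foot a₀ + u • d) = 0 then SignType.sign ((φ k).linear e)
      else SignType.sign (φ k (foot a₀ + u • d))
    have hψ : ∀ a ∈ (rows φ e).filter fun a => a.2 = a₀.2, a.1 = ψ (t a) := by
      intro a ha
      rw [← hxs a ha]
      funext k
      simp only [sgn, ψ, ← ht]
      have hρ := (hxe a ha).1
      have hxk : φ k (x a) = φ k (foot a) + reach φ e a₀.2 (x a) * (φ k).linear e := by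
        have := affine_add (φ k) (foot a) (reach φ e a₀.2 (x a) • e)
        simpa [foot] using this
      split_ifs with h0
      · rw [hxk, h0, zero_add, sign_mul, sign_pos hρ, one_mul]
      · by_contra hne
        set u := φ k (foot a)
        set g := (φ k).linear e with hg
        set ρ := reach φ e a₀.2 (x a) with hρdef
        have hxne := hx0 a ha k
        have hopp : u * φ k (x a) < 0 := by
          rcases lt_or_gt_of_ne h0 with p | p <;> rcases lt_or_gt_of_ne hxne with q | q
          · exact absurd (by rw [sign_neg p, sign_neg q]) hne
          · exact mul_neg_of_neg_of_pos p q
          · exact mul_neg_of_pos_of_neg p q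
          · exact absurd (by rw [sign_pos p, sign_pos q]) hne
        have hgne : g ≠ 0 := by
          intro h
          rw [h, mul_zero, add_zero] at hxk
          rw [hxk] at hopp
          nlinarith [mul_self_nonneg u]
        have hr : reach φ e k (x a) = u / g + ρ := by
          rw [reach_apply, hxk, ← hg]; field_simp
        have hopp' : (u / g) * (u / g + ρ) < 0 := by
          have : (u / g) * (u / g + ρ) = u * φ k (x a) / g ^ 2 := by rw [hxk]; field_simp
          rw [this]
          exact div_neg_of_neg_of_pos hopp (by positivity)
        have hpos : 0 < u / g + ρ := by nlinarith
        have hneg : u / g < 0 := by nlinarith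
        have := (hxe a ha).le (hr ▸ hpos)
        rw [hr] at this
        linarith
    have hinj : Set.InjOn (Prod.fst : (ι → SignType) × ι → ι → SignType)
        ((rows φ e).filter fun a => a.2 = a₀.2 : Finset _) := by
      rintro a ha b hb hab
      have h1 := (Finset.mem_filter.1 ha).2
      have h2 := (Finset.mem_filter.1 hb).2
      exact Prod.ext hab (h1.trans h2.symm)
    rw [← Finset.card_image_of_injOn hinj]
    refine (Finset.card_le_card (t := (((rows φ e).filter fun a => a.2 = a₀.2).image t).image ψ)
      ?_).trans ?_
    · intro s hs
      obtain ⟨a, ha, rfl⟩ := Finset.mem_image.1 hs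
      exact Finset.mem_image.2 ⟨t a, Finset.mem_image_of_mem t ha, (hψ a ha).symm⟩
    · refine card_image_le_of_thresholds Finset.univ
        (fun k => -(φ k (foot a₀)) / (φ k).linear d) ψ _ ?_
      intro u _ u' _ huu hne
      obtain ⟨k, hk⟩ := Function.ne_iff.1 hne
      refine ⟨k, Finset.mem_univ k, ?_⟩
      have hval : ∀ u : ℝ, φ k (foot a₀ + u • d) = φ k (foot a₀) + u * (φ k).linear d := by
        intro u; rw [affine_add, map_smul, smul_eq_mul]
      simp only [ψ, hval] at hk
      have hα : (φ k).linear d ≠ 0 := by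
        intro h; simp [h] at hk
      generalize φ k (foot a₀) = β at hk ⊢
      generalize (φ k).linear d = α at hk hα ⊢
      by_contra hcon
      have hsame : 0 < (β + u * α) * (β + u' * α) := by
        have e1 : (β + u * α) * (β + u' * α) = α ^ 2 * ((u - -β / α) * (u' - -β / α)) := by
          field_simp; ring
        rw [e1]
        have hα2 : 0 < α ^ 2 := by positivity
        apply mul_pos hα2
        by_cases h1 : u ≤ -β / α
        · have h2 : u' < -β / α := by
            by_contra h2
            exact hcon ⟨h1, not_lt.1 h2⟩
          exact mul_pos_of_neg_of_neg (by linarith) (by linarith)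
        · have h1 := not_le.1 h1
          exact mul_pos (by linarith) (by linarith)
      have n1 : β + u * α ≠ 0 := fun h => by rw [h] at hsame; simp at hsame
      have n2 : β + u' * α ≠ 0 := fun h => by rw [h] at hsame; simp at hsame
      rw [if_neg n1, if_neg n2] at hk
      rcases pos_and_pos_or_neg_and_neg_of_mul_pos hsame with ⟨p, q⟩ | ⟨p, q⟩
      · rw [sign_pos p, sign_pos q] at hk; exact hk rfl
      · rw [sign_neg p, sign_neg q] at hk; exact hk rfl
  calc (rows φ e).card ≤ (2 * Fintype.card ι + 1) * ((rows φ e).image Prod.snd).card :=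
        Finset.card_le_mul_card_image _ _ hfib
    _ ≤ (2 * Fintype.card ι + 1) * Fintype.card ι := Nat.mul_le_mul_left _ himg
    _ = _ := mul_comm _ _

/-! ### The number of pieces -/

/-- The exit in direction `-e` depends only on a coordinate that is transversal to `e`. -/
lemma Exit.of_coord {e : Plane} {η : Plane →ₗ[ℝ] ℝ} (hη : ∀ v, η v = 0 → ∃ r : ℝ, v = r • e)
    {x y z : Plane} {i : ι} (hxy : sgn φ x = sgn φ y) (hxz : sgn φ x = sgn φ z)
    (hx : Exit φ e x i) (hy : Exit φ e y i) (h1 : η x ≤ η z) (h2 : η z ≤ η y) :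
    Exit φ e z i := by
  have hex : ∃ θ ∈ Set.Icc (0 : ℝ) 1, η z = (1 - θ) * η x + θ * η y := by
    rcases eq_or_lt_of_le (h1.trans h2) with h | h
    · exact ⟨0, by simp, by linarith⟩
    · have h' : 0 < η y - η x := by linarith
      refine ⟨(η z - η x) / (η y - η x), ⟨div_nonneg (by linarith) h'.le, ?_⟩, ?_⟩
      · rw [div_le_one h']; linarith
      · field_simp; ring
  obtain ⟨θ, hθ, h⟩ := hex
  obtain ⟨r, hr⟩ := hη (z - AffineMap.lineMap x y θ) (by
    rw [map_sub, h]
    simp only [AffineMap.lineMap_apply, vsub_eq_sub, vadd_eq_add, map_add, map_smul, map_sub,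
      smul_eq_mul]
    ring)
  exact hx.of_between hxy hxz hy hθ (r := r) (by rw [← hr]; abel)

variable {ε : ℝ} {e e' : Plane} {κ κ' : ℝ}

open Classical in
variable (φ ε e e' κ κ') in
/-- The indices of the nonempty pieces. -/
noncomputable def pieceIndices : Finset ((ι → SignType) × ι × ι) :=
  Finset.univ.filter fun t => (piece φ ε e e' κ κ' t).Nonempty

lemma mem_rows_left {t : (ι → SignType) × ι × ι} {x : Plane}
    (hx : x ∈ piece φ ε e e' κ κ' t) : (t.1, t.2.1) ∈ rows φ e := by
  simp only [rows, Finset.mem_filter, Finset.mem_univ, true_and]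
  exact ⟨x, hx.1, hx.2.1, hx.2.2.1⟩

lemma mem_rows_right {t : (ι → SignType) × ι × ι} {x : Plane}
    (hx : x ∈ piece φ ε e e' κ κ' t) : (t.1, t.2.2) ∈ rows φ e' := by
  simp only [rows, Finset.mem_filter, Finset.mem_univ, true_and]
  exact ⟨x, hx.1, hx.2.1, hx.2.2.2.1⟩

/-- Pieces on which the length has a gradient in a fixed quadrant, in one face: no representative
dominates another, so that the representatives form a monotone staircase. Hence each piece is
the first one of those that share its first line or the last one of those that share its second
line. -/
lemma card_le_of_quadrant {ξ η : Plane →ₗ[ℝ] ℝ} {δ δ' : ℝ}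
    (hdec : ∀ v, v = (δ * ξ v) • e + (δ' * η v) • e') (T : Finset ((ι → SignType) × ι × ι))
    (x : (ι → SignType) × ι × ι → Plane) (hx : ∀ t ∈ T, x t ∈ piece φ ε e e' κ κ' t)
    (hp : ∀ t ∈ T, 0 ≤ δ * (1 + (reach φ e' t.2.2).linear e))
    (hq : ∀ t ∈ T, 0 ≤ δ' * (1 + (reach φ e t.2.1).linear e'))
    (hpq : ∀ t ∈ T, δ * (1 + (reach φ e' t.2.2).linear e) ≠ 0 ∨
      δ' * (1 + (reach φ e t.2.1).linear e') ≠ 0) :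
    T.card ≤ (rows φ e).card + (rows φ e').card := by
  classical
  have hη : ∀ v, η v = 0 → ∃ r : ℝ, v = r • e := fun v hv =>
    ⟨δ * ξ v, by have := hdec v; rw [hv] at this; simpa using this⟩
  have hξ : ∀ v, ξ v = 0 → ∃ r : ℝ, v = r • e' := fun v hv =>
    ⟨δ' * η v, by have := hdec v; rw [hv] at this; simpa using this⟩
  have hsgn : ∀ t ∈ T, ∀ t' ∈ T, t.1 = t'.1 → sgn φ (x t) = sgn φ (x t') := fun t ht t' ht' h => by
    rw [(hx t ht).2.1, (hx t' ht').2.1, h]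
  -- the length decreases strictly from `x t` to a point below it in both coordinates
  have hdom : ∀ t ∈ T, ∀ t' ∈ T, t.1 = t'.1 → ξ (x t') < ξ (x t) → η (x t') < η (x t) → False := by
    intro t ht t' ht' hs h1 h2
    have hi := (hx t ht).2.2.1.1
    have hk := (hx t ht).2.2.2.1.1
    have hge := le_reach_add_reach (hx t' ht') (hsgn t' ht' t ht hs.symm) hi hk
    have heq := (hx t ht).2.2.2.2.1
    have hd : x t' = x t + ((δ * ξ (x t' - x t)) • e + (δ' * η (x t' - x t)) • e') := by
      rw [← hdec]; abel
    rw [hd, affine_add, affine_add, map_add, map_add, map_smul, map_smul, map_smul, map_smul,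
      reach_linear_self hi, reach_linear_self hk, map_sub, map_sub] at hge
    simp only [smul_eq_mul] at hge
    have hp' := hp t ht
    have hq' := hq t ht
    have hpq' := hpq t ht
    set p := δ * (1 + (reach φ e' t.2.2).linear e) with hpdef
    set q := δ' * (1 + (reach φ e t.2.1).linear e') with hqdef
    have hsum : 0 ≤ (ξ (x t') - ξ (x t)) * p + (η (x t') - η (x t)) * q := by
      rw [hpdef, hqdef]; linarith
    rcases hpq' with h | h
    · have : 0 < p := lt_of_le_of_ne hp' h.symm
      nlinarith
    · have : 0 < q := lt_of_le_of_ne hq' h.symm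
      nlinarith
  have heqi : ∀ t ∈ T, ∀ t' ∈ T, t.1 = t'.1 → t.2.2 = t'.2.2 → Exit φ e (x t') t.2.1 → t = t' := by
    intro t _ t' ht' h1 h2 h3
    exact Prod.ext h1 (Prod.ext (h3.unique (hx t' ht').2.2.1) h2)
  have heqk : ∀ t ∈ T, ∀ t' ∈ T, t.1 = t'.1 → t.2.1 = t'.2.1 → Exit φ e' (x t') t.2.2 → t = t' := by
    intro t _ t' ht' h1 h2 h3
    exact Prod.ext h1 (Prod.ext h2 (h3.unique (hx t' ht').2.2.2.1))
  -- the first pieces in the rows of their first line, the last ones in those of their second line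
  let A := T.filter fun t => ∀ t' ∈ T, t'.1 = t.1 → t'.2.1 = t.2.1 → ξ (x t) ≤ ξ (x t')
  let B := T.filter fun t => ∀ t' ∈ T, t'.1 = t.1 → t'.2.2 = t.2.2 → η (x t') ≤ η (x t)
  have hA : A.card ≤ (rows φ e).card := by
    refine Finset.card_le_card_of_injOn (fun t => (t.1, t.2.1)) ?_ ?_
    · intro t ht
      exact mem_rows_left (hx t (Finset.mem_filter.1 ht).1)
    · intro t ht t' ht' h
      obtain ⟨ht, hmin⟩ := Finset.mem_filter.1 ht
      obtain ⟨ht', hmin'⟩ := Finset.mem_filter.1 ht'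
      obtain ⟨hs, hi⟩ := Prod.ext_iff.1 h
      simp only at hs hi
      have h1 := hmin t' ht' hs.symm hi.symm
      have h2 := hmin' t ht hs hi
      refine heqk t ht t' ht' hs hi ?_
      exact (hx t ht).2.2.2.1.of_coord hξ rfl (hsgn t ht t' ht' hs) (hx t ht).2.2.2.1 h1 h2
  have hB : B.card ≤ (rows φ e').card := by
    refine Finset.card_le_card_of_injOn (fun t => (t.1, t.2.2)) ?_ ?_
    · intro t ht
      exact mem_rows_right (hx t (Finset.mem_filter.1 ht).1)
    · intro t ht t' ht' h
      obtain ⟨ht, hmin⟩ := Finset.mem_filter.1 ht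
      obtain ⟨ht', hmin'⟩ := Finset.mem_filter.1 ht'
      obtain ⟨hs, hi⟩ := Prod.ext_iff.1 h
      simp only at hs hi
      have h1 := hmin t' ht' hs.symm hi.symm
      have h2 := hmin' t ht hs hi
      refine heqi t ht t' ht' hs hi ?_
      exact (hx t ht).2.2.1.of_coord hη rfl (hsgn t ht t' ht' hs) (hx t ht).2.2.1 h2 h1
  have hAB : T ⊆ A ∪ B := by
    intro t ht
    by_contra hcon
    simp only [A, B, Finset.mem_union, Finset.mem_filter, not_or, not_and, not_forall, not_le]
      at hcon
    obtain ⟨a, ha, has, hai, hξa⟩ := hcon.1 ht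
    obtain ⟨b, hb, hbs, hbk, hηb⟩ := hcon.2 ht
    have h1 : η (x t) ≤ η (x a) := by
      by_contra h
      exact hdom t ht a ha has.symm hξa (not_le.1 h)
    have h2 : ξ (x b) ≤ ξ (x t) := by
      by_contra h
      exact hdom b hb t ht hbs (not_le.1 h) hηb
    have h3 : ξ (x a) < ξ (x b) := by
      by_contra h
      have hE : Exit φ e' (x b) b.2.2 := (hx b hb).2.2.2.1
      rw [hbk] at hE
      have := heqk t ht a ha has.symm hai.symm (hE.of_coord hξ (hsgn b hb t ht hbs)
        (hsgn b hb a ha (hbs.trans has.symm)) (hx t ht).2.2.2.1 (not_lt.1 h) hξa.le)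
      rw [this] at hξa
      exact lt_irrefl _ hξa
    have h4 : η (x a) < η (x b) := by
      by_contra h
      have hE : Exit φ e (x a) a.2.1 := (hx a ha).2.2.1
      rw [hai] at hE
      have := heqi t ht b hb hbs.symm hbk.symm ((hx t ht).2.2.1.of_coord hη
        (hsgn t ht a ha has.symm) (hsgn t ht b hb hbs.symm) hE hηb.le (not_lt.1 h))
      rw [this] at hηb
      exact lt_irrefl _ hηb
    exact hdom b hb a ha (hbs.trans has.symm) h3 h4
  calc T.card ≤ (A ∪ B).card := Finset.card_le_card hAB
    _ ≤ A.card + B.card := Finset.card_union_le _ _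
    _ ≤ _ := Nat.add_le_add hA hB

/-- The number of pieces around a corner. On a piece, the two components of the gradient of the length
are `p` and `q`; each of the four sign patterns gives a monotone staircase in every face. Pieces with
`p = q = 0` have parallel lines, so that the first line determines the second. -/
lemma card_pieceIndices_corner {ξ η : Plane →ₗ[ℝ] ℝ} (hdec : ∀ v, v = ξ v • e + η v • e') :
    (pieceIndices φ ε e e' κ κ').card ≤
      9 * (Fintype.card ι * (2 * Fintype.card ι + 1)) := by
  classical
  have hex : ∀ t ∈ pieceIndices φ ε e e' κ κ', (piece φ ε e e' κ κ' t).Nonempty := fun t ht =>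
    (Finset.mem_filter.1 ht).2
  choose! x hx using hex
  set S := pieceIndices φ ε e e' κ κ'
  let p : (ι → SignType) × ι × ι → ℝ := fun t => 1 + (reach φ e' t.2.2).linear e
  let q : (ι → SignType) × ι × ι → ℝ := fun t => 1 + (reach φ e t.2.1).linear e'
  let Q : ℝ → ℝ → Finset ((ι → SignType) × ι × ι) := fun δ δ' =>
    S.filter fun t => (0 ≤ δ * p t ∧ 0 ≤ δ' * q t) ∧ (δ * p t ≠ 0 ∨ δ' * q t ≠ 0)
  have hQ : ∀ δ δ' : ℝ, δ * δ = 1 → δ' * δ' = 1 →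
      (Q δ δ').card ≤ (rows φ e).card + (rows φ e').card := by
    intro δ δ' h h'
    refine card_le_of_quadrant (ξ := δ • ξ) (η := δ' • η) (δ := δ) (δ' := δ') ?_ (Q δ δ') x
      (fun t ht => hx t (Finset.mem_filter.1 ht).1) (fun t ht => (Finset.mem_filter.1 ht).2.1.1)
      (fun t ht => (Finset.mem_filter.1 ht).2.1.2) (fun t ht => (Finset.mem_filter.1 ht).2.2)
    intro v
    simp only [LinearMap.smul_apply, smul_eq_mul, ← mul_assoc, h, h', one_mul]
    exact hdec v
  let Z := S.filter fun t => p t = 0 ∧ q t = 0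
  have hZ : Z.card ≤ (rows φ e).card := by
    refine Finset.card_le_card_of_injOn (fun t => (t.1, t.2.1)) ?_ ?_
    · intro t ht
      exact mem_rows_left (hx t (Finset.mem_filter.1 ht).1)
    · intro t ht t' ht' h
      obtain ⟨ht, hp, -⟩ := Finset.mem_filter.1 ht
      obtain ⟨ht', hp', -⟩ := Finset.mem_filter.1 ht'
      obtain ⟨hs, hi⟩ := Prod.ext_iff.1 h
      simp only at hs hi
      refine Prod.ext hs (Prod.ext hi ?_)
      -- the two lines are parallel
      have hk := (hx t ht).2.2.2.1
      have hk' := (hx t' ht').2.2.2.1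
      have hsg : sgn φ (x t) = sgn φ (x t') := by rw [(hx t ht).2.1, (hx t' ht').2.1, hs]
      have hd : x t' = x t + (ξ (x t' - x t) • e + η (x t' - x t) • e') := by
        rw [← hdec]; abel
      have e1 := affine_add (reach φ e' t.2.2) (x t) (ξ (x t' - x t) • e + η (x t' - x t) • e')
      have e2 := affine_add (reach φ e' t'.2.2) (x t) (ξ (x t' - x t) • e + η (x t' - x t) • e')
      rw [← hd, map_add, map_smul, map_smul, reach_linear_self hk.1] at e1
      rw [← hd, map_add, map_smul, map_smul, reach_linear_self hk'.1] at e2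
      simp only [p] at hp hp'
      have hp1 : (reach φ e' t.2.2).linear e = -1 := by linarith
      have hp2 : (reach φ e' t'.2.2).linear e = -1 := by linarith
      rw [hp1] at e1
      rw [hp2] at e2
      rcases hk.2 _ (reach_pos_congr hsg.symm hk'.1) with h1 | h1 <;>
        rcases hk'.2 _ (reach_pos_congr hsg hk.1) with h2 | h2
      · linarith
      · linarith [h2.1]
      · linarith [h1.1]
      · exact le_antisymm h1.2 h2.2
  have hcov : S ⊆ ((Q 1 1 ∪ Q 1 (-1)) ∪ (Q (-1) 1 ∪ Q (-1) (-1))) ∪ Z := by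
    intro t ht
    by_cases hz : p t = 0 ∧ q t = 0
    · exact Finset.mem_union_right _ (Finset.mem_filter.2 ⟨ht, hz⟩)
    refine Finset.mem_union_left _ ?_
    have hmem : ∀ δ δ' : ℝ, δ ≠ 0 → δ' ≠ 0 → 0 ≤ δ * p t → 0 ≤ δ' * q t → t ∈ Q δ δ' :=
      fun δ δ' hδ hδ' h h' => Finset.mem_filter.2 ⟨ht, ⟨h, h'⟩,
        (not_and_or.1 hz).imp (mul_ne_zero hδ) (mul_ne_zero hδ')⟩
    rcases le_total 0 (p t) with h1 | h1 <;> rcases le_total 0 (q t) with h2 | h2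
    · exact Finset.mem_union_left _ (Finset.mem_union_left _
        (hmem 1 1 (by norm_num) (by norm_num) (by linarith) (by linarith)))
    · exact Finset.mem_union_left _ (Finset.mem_union_right _
        (hmem 1 (-1) (by norm_num) (by norm_num) (by linarith) (by linarith)))
    · exact Finset.mem_union_right _ (Finset.mem_union_left _
        (hmem (-1) 1 (by norm_num) (by norm_num) (by linarith) (by linarith)))
    · exact Finset.mem_union_right _ (Finset.mem_union_right _
        (hmem (-1) (-1) (by norm_num) (by norm_num) (by linarith) (by linarith)))
  have c1 := hQ 1 1 (by norm_num) (by norm_num)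
  have c2 := hQ 1 (-1) (by norm_num) (by norm_num)
  have c3 := hQ (-1) 1 (by norm_num) (by norm_num)
  have c4 := hQ (-1) (-1) (by norm_num) (by norm_num)
  have c5 := Finset.card_le_card hcov
  have c6 := Finset.card_union_le ((Q 1 1 ∪ Q 1 (-1)) ∪ (Q (-1) 1 ∪ Q (-1) (-1))) Z
  have c7 := Finset.card_union_le (Q 1 1 ∪ Q 1 (-1)) (Q (-1) 1 ∪ Q (-1) (-1))
  have c8 := Finset.card_union_le (Q 1 1) (Q 1 (-1))
  have c9 := Finset.card_union_le (Q (-1) 1) (Q (-1) (-1))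
  have r1 := card_rows_le (φ := φ) e
  have r2 := card_rows_le (φ := φ) e'
  omega

/-- In one face there are at most three pieces within a side: the width of the face is a concave
function of the transversal coordinate, and pieces strictly between two others have the same
lines. -/
lemma card_side_le_three {η : Plane →ₗ[ℝ] ℝ} (hη : ∀ v, η v = 0 → ∃ r : ℝ, v = r • e)
    (s : ι → SignType) :
    ((pieceIndices φ ε e (-e) κ κ').filter fun t => t.1 = s).card ≤ 3 := by
  classical
  set T := (pieceIndices φ ε e (-e) κ κ').filter fun t => t.1 = s with hT
  have hη' : ∀ v, η v = 0 → ∃ r : ℝ, v = r • (-e) := fun v hv => by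
    obtain ⟨r, hr⟩ := hη v hv
    exact ⟨-r, by rw [hr]; simp⟩
  have hex : ∀ t ∈ T, (piece φ ε e (-e) κ κ' t).Nonempty := fun t ht =>
    (Finset.mem_filter.1 (Finset.mem_filter.1 ht).1).2
  choose! x hx using hex
  have hs : ∀ t ∈ T, sgn φ (x t) = s := fun t ht => by
    rw [(hx t ht).2.1, (Finset.mem_filter.1 ht).2]
  have hinj : ∀ t ∈ T, ∀ t' ∈ T, η (x t) = η (x t') → t = t' := by
    intro t ht t' ht' h
    have hsg : sgn φ (x t) = sgn φ (x t') := by rw [hs t ht, hs t' ht']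
    have h1 := (hx t ht).2.2.1.of_coord hη rfl hsg (hx t ht).2.2.1 h.le h.ge
    have h2 := (hx t ht).2.2.2.1.of_coord hη' rfl hsg (hx t ht).2.2.2.1 h.le h.ge
    refine Prod.ext ?_ (Prod.ext (h1.unique (hx t' ht').2.2.1) (h2.unique (hx t' ht').2.2.2.1))
    rw [← (hx t ht).2.1, ← (hx t' ht').2.1, hsg]
  by_contra hcard
  have hne : T.Nonempty := Finset.card_pos.1 (by omega)
  obtain ⟨a, haT, ha⟩ := Finset.exists_min_image T (fun t => η (x t)) hne
  obtain ⟨c, hcT, hc⟩ := Finset.exists_max_image T (fun t => η (x t)) hne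
  have h2 : 1 < ((T.erase a).erase c).card := by
    have e1 := Finset.card_erase_add_one haT
    have e2 := Finset.pred_card_le_card_erase (s := T.erase a) (a := c)
    omega
  obtain ⟨b, hb, d, hd, hbd⟩ := Finset.one_lt_card.1 h2
  have hin : ∀ t ∈ (T.erase a).erase c, t ∈ T ∧ η (x a) < η (x t) ∧ η (x t) < η (x c) := by
    intro t ht
    obtain ⟨htc, ht⟩ := Finset.mem_erase.1 ht
    obtain ⟨hta, ht⟩ := Finset.mem_erase.1 ht
    exact ⟨ht, lt_of_le_of_ne (ha t ht) fun h => hta (hinj a haT t ht h).symm,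
      lt_of_le_of_ne (hc t ht) fun h => htc (hinj t ht c hcT h)⟩
  -- the affine extension `w` of the width from `x t` is an upper bound, so it is at least `ε` on the
  -- extreme pieces `a` and `c`, and it is `ε` at `x t` between them; hence it is constant
  have hle : ∀ t ∈ (T.erase a).erase c, ∀ t' ∈ (T.erase a).erase c,
      t'.2.1 ≤ t.2.1 ∧ t'.2.2 ≤ t.2.2 := by
    intro t ht t' ht'
    obtain ⟨htT, hat, htc⟩ := hin t ht
    obtain ⟨htT', hat', htc'⟩ := hin t' ht'
    have hi := (hx t htT).2.2.1.1
    have hk := (hx t htT).2.2.2.1.1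
    have heq := (hx t htT).2.2.2.2.1
    have heq' := (hx t' htT').2.2.2.2.1
    have hga := le_reach_add_reach (hx a haT) (by rw [hs a haT, hs t htT]) hi hk
    have hgc := le_reach_add_reach (hx c hcT) (by rw [hs c hcT, hs t htT]) hi hk
    let w : Plane →ᵃ[ℝ] ℝ := reach φ e t.2.1 + reach φ (-e) t.2.2
    have hw : ∀ y, w y = reach φ e t.2.1 y + reach φ (-e) t.2.2 y := fun y => by simp [w]
    have hwe : w.linear e = 0 := by
      have h1 : w.linear e = (reach φ e t.2.1).linear e + (reach φ (-e) t.2.2).linear e := by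
        simp [w]
      have h2 := reach_linear_self hk
      rw [map_neg] at h2
      rw [h1, reach_linear_self hi]; linarith
    have hpos : 0 < η (x c) - η (x a) := by linarith
    -- `w` depends on `η` only
    have hwη : ∀ y, (η (x c) - η (x a)) * w y =
        (η (x c) - η y) * w (x a) + (η y - η (x a)) * w (x c) := by
      intro y
      obtain ⟨r, hr⟩ := hη
        (y - AffineMap.lineMap (x a) (x c) ((η y - η (x a)) / (η (x c) - η (x a)))) (by
          rw [map_sub]
          simp only [AffineMap.lineMap_apply, vsub_eq_sub, vadd_eq_add, map_add, map_smul, map_sub,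
            smul_eq_mul]
          field_simp; ring)
      have hy : y = AffineMap.lineMap (x a) (x c) ((η y - η (x a)) / (η (x c) - η (x a))) + r • e :=
        by rw [← hr]; abel
      have := congrArg w hy
      rw [affine_add, map_smul, hwe, affine_lineMap] at this
      rw [this]; simp only [smul_zero, add_zero]; field_simp; ring
    have ht1 := hwη (x t)
    have ht2 := hwη (x t')
    rw [← hw] at hga hgc heq
    rw [heq] at ht1
    have hwa : w (x a) = ε := by nlinarith
    have hwc : w (x c) = ε := by nlinarith
    rw [hwa, hwc] at ht2
    have hwt : w (x t') = ε := by
      have : (η (x c) - η (x a)) * (w (x t') - ε) = 0 := by linear_combination ht2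
      rcases mul_eq_zero.1 this with h | h <;> linarith
    rw [hw] at hwt
    have hsg : sgn φ (x t) = sgn φ (x t') := by rw [hs t htT, hs t' htT']
    have hE := (hx t' htT').2.2.1
    have hE' := (hx t' htT').2.2.2.1
    have hi' := reach_pos_congr hsg hi
    have hk' := reach_pos_congr hsg hk
    have l1 := hE.le hi'
    have l2 := hE'.le hk'
    constructor
    · rcases hE.2 _ hi' with h | h
      · linarith
      · exact h.2
    · rcases hE'.2 _ hk' with h | h
      · linarith
      · exact h.2
  obtain ⟨h3, h4⟩ := hle b hb d hd
  obtain ⟨h5, h6⟩ := hle d hd b hb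
  apply hbd
  refine Prod.ext ?_ (Prod.ext (le_antisymm h5 h3) (le_antisymm h6 h4))
  rw [← (hx b (hin b hb).1).2.1, ← (hx d (hin d hd).1).2.1, hs b (hin b hb).1, hs d (hin d hd).1]

lemma card_pieceIndices_side {η : Plane →ₗ[ℝ] ℝ} (hη : ∀ v, η v = 0 → ∃ r : ℝ, v = r • e) :
    (pieceIndices φ ε e (-e) κ κ').card ≤ 9 * (Fintype.card ι * (2 * Fintype.card ι + 1)) := by
  classical
  have h1 := Finset.card_le_mul_card_image (f := Prod.fst) (pieceIndices φ ε e (-e) κ κ') 3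
    (fun s _ => card_side_le_three hη s)
  have h2 : (pieceIndices φ ε e (-e) κ κ').image Prod.fst ⊆ (rows φ e).image Prod.fst := by
    intro s hs
    obtain ⟨t, ht, rfl⟩ := Finset.mem_image.1 hs
    obtain ⟨x, hx⟩ := (Finset.mem_filter.1 ht).2
    exact Finset.mem_image.2 ⟨_, mem_rows_left hx, rfl⟩
  have h3 := (Finset.card_le_card h2).trans Finset.card_image_le
  have h4 := card_rows_le (φ := φ) e
  omega

/-- In one face, a line crosses pieces within a side in other directions at most three times. -/
lemma encard_crossing_le_three {η : Plane →ₗ[ℝ] ℝ} (hη : ∀ v, η v = 0 → ∃ r : ℝ, v = r • e)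
    (hno : NoInterior φ ε e (-e) κ κ') {l : AffineSubspace ℝ Plane} (hl : IsLine l)
    (s : ι → SignType) :
    {x | x ∈ l ∧ ∃ t, t.1 = s ∧ x ∈ piece φ ε e (-e) κ κ' t ∧
      ¬ piece φ ε e (-e) κ κ' t ⊆ l}.encard ≤ 3 := by
  classical
  set X := {x | x ∈ l ∧ ∃ t, t.1 = s ∧ x ∈ piece φ ε e (-e) κ κ' t ∧
      ¬ piece φ ε e (-e) κ κ' t ⊆ l} with hX
  have hex : ∀ x ∈ X, ∃ t, t.1 = s ∧ x ∈ piece φ ε e (-e) κ κ' t ∧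
      ¬ piece φ ε e (-e) κ κ' t ⊆ l := fun x hx => hx.2
  rcases X.eq_empty_or_nonempty with h0 | ⟨x₀, hx₀⟩
  · simp [h0]
  have : Nonempty ((ι → SignType) × ι × ι) := ⟨(hex x₀ hx₀).choose⟩
  choose! t hts hxt htl using hex
  have h1 : X.encard ≤
      (((pieceIndices φ ε e (-e) κ κ').filter fun t => t.1 = s :
        Finset ((ι → SignType) × ι × ι)) : Set ((ι → SignType) × ι × ι)).encard := by
    refine Set.encard_le_encard_of_injOn (f := t) ?_ ?_
    · intro x hx
      simp only [Finset.coe_filter, pieceIndices, Finset.mem_filter, Finset.mem_univ, true_and,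
        Set.mem_ofPred_eq]
      exact ⟨⟨x, hxt x hx⟩, hts x hx⟩
    · intro x hx y hy hxy
      by_contra hne
      have hy' := hxt y hy
      rw [← hxy] at hy'
      obtain ⟨w, hwt, hwl⟩ := Set.not_subset.1 (htl x hx)
      obtain ⟨h, ⟨v, hv⟩, hh⟩ := (hno.isLine ⟨x, hxt x hx, y, hy', hne⟩).exists_equation
      have hz : ∀ z ∈ piece φ ε e (-e) κ κ' (t x), h z = 0 := fun z hz =>
        (hh z).1 (subset_affineSpan ℝ _ hz)
      have h0 := affine_eq_zero hl (show x ∈ l from hx.1) (show y ∈ l from hy.1) hne hwl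
        (hz x (hxt x hx)) (hz y hy') (hz w hwt)
      have := affine_add h 0 v
      rw [h0, h0, zero_add] at this
      exact hv this.symm
  refine h1.trans ?_
  rw [Set.encard_coe_eq_coe_finsetCard]
  exact_mod_cast card_side_le_three hη s

end Exits

/-! ### Crossings between families of pieces -/

lemma encard_le_of_finset_card_le {α : Type*} {s : Set α} {N : ℕ}
    (h : ∀ T : Finset α, (T : Set α) ⊆ s → T.card ≤ N) : s.encard ≤ N := by
  by_contra hcon
  obtain ⟨t, hts, htc⟩ := Set.exists_subset_encard_eq (s := s) (k := (N + 1 : ℕ))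
    (by push_cast; exact Order.add_one_le_of_lt (not_le.1 hcon))
  have hfin : t.Finite := Set.finite_of_encard_eq_coe htc
  have := h hfin.toFinset (by simpa using hts)
  rw [hfin.encard_eq_coe_toFinset_card] at htc
  have htc' : hfin.toFinset.card = N + 1 := by exact_mod_cast htc
  omega

lemma encard_iUnion_le_sum {α J : Type*} [Fintype J] (s : J → Set α) (N : J → ℕ)
    (h : ∀ j, (s j).encard ≤ N j) : (⋃ j, s j).encard ≤ ((∑ j, N j : ℕ) : ℕ∞) := by
  refine (Set.encard_iUnion_le_of_fintype s).trans ?_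
  push_cast
  exact Finset.sum_le_sum fun j _ => h j

lemma exists_isLine_of_affine {h : Plane →ᵃ[ℝ] ℝ} (hh : h.linear ≠ 0) :
    ∃ l : AffineSubspace ℝ Plane, IsLine l ∧ ∀ z, z ∈ l ↔ h z = 0 := by
  obtain ⟨v, hv⟩ : ∃ v, h.linear v ≠ 0 := by
    by_contra hcon
    push Not at hcon
    exact hh (LinearMap.ext hcon)
  have hx : h ((-(h 0) / h.linear v) • v) = 0 := by
    have := affine_add h 0 ((-(h 0) / h.linear v) • v)
    rw [zero_add] at this
    rw [this, map_smul, smul_eq_mul, div_mul_cancel₀ _ hv, add_neg_cancel]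
  generalize (-(h 0) / h.linear v) • v = x at hx
  refine ⟨AffineSubspace.mk' x (LinearMap.ker h.linear), ?_, fun z => ?_⟩
  · unfold IsLine
    rw [AffineSubspace.direction_mk', finrank_ker_eq_one hh]
  · rw [AffineSubspace.mem_mk', LinearMap.mem_ker, vsub_eq_sub]
    have := affine_add h x (z - x)
    rw [add_sub_cancel, hx, zero_add] at this
    rw [this]

section Exits

set_option linter.unusedSectionVars false

variable {ι : Type*} [Fintype ι] [LinearOrder ι] {φ : ι → Plane →ᵃ[ℝ] ℝ}
  {ε : ℝ} {e e' : Plane} {κ κ' : ℝ}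

variable (φ ε e e' κ κ') in
/-- In one face, any line crosses pieces in other directions at most three times. -/
def FewCrossings : Prop :=
  ∀ l : AffineSubspace ℝ Plane, IsLine l → ∀ s : ι → SignType,
    {x | x ∈ l ∧ ∃ t, t.1 = s ∧ x ∈ piece φ ε e e' κ κ' t ∧
      ¬ piece φ ε e e' κ κ' t ⊆ l}.encard ≤ 3

/-- A part `S` of a line crosses pieces a bounded number of times per face that it visits, and thus
a bounded number of times per line `φ k = 0`, `k ∈ K`, that it crosses. -/
lemma encard_crossings_on_line (hcr : FewCrossings φ ε e e' κ κ') {l : AffineSubspace ℝ Plane}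
    (hl : IsLine l) {S : Set Plane} (hS : S ⊆ l) (K : Finset ι)
    (hK : ∀ k, (∃ u ∈ S, ∃ w ∈ S, φ k u < 0 ∧ 0 < φ k w) → k ∈ K) :
    {x | x ∈ S ∧ ∃ t, x ∈ piece φ ε e e' κ κ' t ∧ ¬ piece φ ε e e' κ κ' t ⊆ l}.encard ≤
      ((3 * (2 * K.card + 1) : ℕ) : ℕ∞) := by
  classical
  refine encard_le_of_finset_card_le fun T hT => ?_
  have hfib : ∀ s ∈ T.image (sgn φ), (T.filter fun x => sgn φ x = s).card ≤ 3 := by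
    intro s _
    have h1 : ((T.filter fun x => sgn φ x = s : Finset Plane) : Set Plane) ⊆
        {x | x ∈ l ∧ ∃ t, t.1 = s ∧ x ∈ piece φ ε e e' κ κ' t ∧
          ¬ piece φ ε e e' κ κ' t ⊆ l} := by
      intro x hx
      obtain ⟨hxT, hxs⟩ := Finset.mem_filter.1 (Finset.mem_coe.1 hx)
      obtain ⟨hxS, t, hxt, htl⟩ := hT hxT
      exact ⟨hS hxS, t, by rw [← hxs, hxt.2.1], hxt, htl⟩
    have h2 := (Set.encard_le_encard h1).trans (hcr l hl s)
    rw [Set.encard_coe_eq_coe_finsetCard] at h2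
    exact_mod_cast h2
  have himg : (T.image (sgn φ)).card ≤ 2 * K.card + 1 := by
    obtain ⟨x₀, d, f, hd, hfd, hfx, hmem⟩ := hl.exists_coord
    have hTl : ∀ x ∈ T, x₀ + f x • d = x := fun x hx => ((hmem x).1 (hS (hT hx).1)).symm
    have himg : T.image (sgn φ) = (T.image f).image fun u : ℝ => sgn φ (x₀ + u • d) := by
      rw [Finset.image_image]
      refine Finset.image_congr fun x hx => ?_
      simp [hTl x hx]
    rw [himg]
    refine card_image_le_of_thresholds K (fun k => -(φ k x₀) / (φ k).linear d) _ _ ?_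
    intro u hu u' hu' huu hne
    obtain ⟨x, hx, rfl⟩ := Finset.mem_image.1 hu
    obtain ⟨y, hy, rfl⟩ := Finset.mem_image.1 hu'
    obtain ⟨k, hk⟩ := Function.ne_iff.1 hne
    have hval : ∀ x ∈ T, φ k x = φ k x₀ + f x * (φ k).linear d := by
      intro x hx
      have := affine_add (φ k) x₀ (f x • d)
      rwa [hTl x hx, map_smul, smul_eq_mul] at this
    rw [hTl x hx, hTl y hy] at hk
    simp only [sgn] at hk
    obtain ⟨hxS, tx, hxt, -⟩ := hT hx
    obtain ⟨hyS, ty, hyt, -⟩ := hT hy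
    have hx0 := hxt.1 k
    have hy0 := hyt.1 k
    have hvx := hval x hx
    have hvy := hval y hy
    rcases lt_or_gt_of_ne hx0 with p | p <;> rcases lt_or_gt_of_ne hy0 with q | q
    · exact absurd (by rw [sign_neg p, sign_neg q]) hk
    · refine ⟨k, hK k ⟨x, hxS, y, hyS, p, q⟩, ?_⟩
      have hα : 0 < (φ k).linear d := by nlinarith
      rw [le_div_iff₀ hα, div_le_iff₀ hα]
      constructor <;> linarith
    · refine ⟨k, hK k ⟨y, hyS, x, hxS, q, p⟩, ?_⟩
      have hα : (φ k).linear d < 0 := by nlinarith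
      rw [le_div_iff_of_neg hα, div_le_iff_of_neg hα]
      constructor <;> linarith
    · exact absurd (by rw [sign_pos p, sign_pos q]) hk
  calc T.card ≤ 3 * (T.image (sgn φ)).card := Finset.card_le_mul_card_image _ _ hfib
    _ ≤ _ := Nat.mul_le_mul_left _ himg

/-- A line separates points of few pieces: it meets these pieces, which are disjoint, in points at
which it crosses them. -/
lemma card_separated_le (hcr : FewCrossings φ ε e e' κ κ') (h : Plane →ᵃ[ℝ] ℝ)
    (T : Finset ((ι → SignType) × ι × ι))
    (hT : ∀ t ∈ T, ∃ u ∈ piece φ ε e e' κ κ' t, ∃ w ∈ piece φ ε e e' κ κ' t, h u < 0 ∧ 0 < h w) :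
    T.card ≤ 3 * (2 * Fintype.card ι + 1) := by
  classical
  rcases T.eq_empty_or_nonempty with rfl | ⟨t₀, ht₀⟩
  · simp
  have hlin : h.linear ≠ 0 := by
    obtain ⟨u, -, w, -, hu, hw⟩ := hT t₀ ht₀
    intro h0
    have := affine_add h u (w - u)
    rw [add_sub_cancel, h0, LinearMap.zero_apply] at this
    linarith
  obtain ⟨l, hl, hmem⟩ := exists_isLine_of_affine hlin
  have hex : ∀ t ∈ T, ∃ z ∈ piece φ ε e e' κ κ' t, h z = 0 := by
    intro t ht
    obtain ⟨u, hu, w, hw, hu0, hw0⟩ := hT t ht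
    have hpos : 0 < h w - h u := by linarith
    refine ⟨AffineMap.lineMap u w (-(h u) / (h w - h u)),
      (convex_piece t).lineMap_mem hu hw ⟨div_nonneg (by linarith) hpos.le, ?_⟩, ?_⟩
    · rw [div_le_one hpos]; linarith
    · rw [affine_lineMap]; field_simp; ring
  choose! z hz hz0 using hex
  have h1 := encard_crossings_on_line hcr hl (S := l) subset_rfl Finset.univ (by simp)
  have h2 : (T : Set ((ι → SignType) × ι × ι)).encard ≤ {x | x ∈ (l : Set Plane) ∧
      ∃ t, x ∈ piece φ ε e e' κ κ' t ∧ ¬ piece φ ε e e' κ κ' t ⊆ l}.encard := by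
    refine Set.encard_le_encard_of_injOn (f := z) ?_ ?_
    · intro t ht
      refine ⟨(hmem _).2 (hz0 t ht), t, hz t ht, fun hsub => ?_⟩
      obtain ⟨u, hu, -, -, hu0, -⟩ := hT t ht
      exact hu0.ne ((hmem u).1 (hsub hu))
    · intro t ht t' ht' htt
      have := hz t ht
      rw [htt] at this
      exact piece_index_unique this (hz t' ht')
  have h3 := h2.trans h1
  rw [Set.encard_coe_eq_coe_finsetCard, Finset.card_univ] at h3
  exact_mod_cast h3

end Exits

section Families

variable {ι J : Type*} [Fintype ι] [LinearOrder ι] [Fintype J]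

/-- The complexity of the union of several families of pieces, each of which refers to its own lines.
A piece `a` crosses pieces of the family `j` at most three times in each face of the lines of `j` that
it meets, and the number of these faces is bounded by the number of lines that separate points of `a`.
The sum of the latter over all pieces `a` of one family is small as a line separates points of
few pieces; this avoids a bound that is quadratic in the number of pieces. -/
theorem complexity_le_of_families (Φ : J → ι → Plane →ᵃ[ℝ] ℝ) (ε : ℝ) (e e' : J → Plane)
    (κ κ' : J → ℝ) {P : Set Plane}
    (hP : P = ⋃ j, ⋃ t, piece (Φ j) ε (e j) (e' j) (κ j) (κ' j) t)
    (hno : ∀ j, NoInterior (Φ j) ε (e j) (e' j) (κ j) (κ' j))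
    (hcr : ∀ j, FewCrossings (Φ j) ε (e j) (e' j) (κ j) (κ' j)) {B : ℕ}
    (hB : ∀ j, (pieceIndices (Φ j) ε (e j) (e' j) (κ j) (κ' j)).card ≤ B) :
    complexity P ≤ ((15 * (Fintype.card J * B) + 4 * (Fintype.card J * (Fintype.card J *
      (3 * B + 18 * (Fintype.card ι * (2 * Fintype.card ι + 1))))) + 1 : ℕ) : ℕ∞) := by
  classical
  set n := Fintype.card ι
  set I := fun j => pieceIndices (Φ j) ε (e j) (e' j) (κ j) (κ' j)
  let σ₀ : J × ((ι → SignType) × ι × ι) → Set Plane := fun a =>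
    piece (Φ a.1) ε (e a.1) (e' a.1) (κ a.1) (κ' a.1) a.2
  let A : Finset (J × ((ι → SignType) × ι × ι)) := Finset.univ.filter fun a => (σ₀ a).Nonempty
  have hcardA : ∀ Q : J × ((ι → SignType) × ι × ι) → ℕ,
      ∑ a ∈ A, Q a = ∑ j, ∑ t ∈ I j, Q (j, t) := by
    intro Q
    simp only [A, I, pieceIndices, Finset.sum_filter, Fintype.sum_prod_type]
    rfl
  have hA : A.card ≤ Fintype.card J * B := by
    rw [Finset.card_eq_sum_ones, hcardA]
    simp only [Finset.sum_const, smul_eq_mul, mul_one]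
    refine (Finset.sum_le_sum fun j _ => hB j).trans ?_
    simp
  have hpt : ∀ a ∈ A, ∃ z, z ∈ σ₀ a := fun a ha => (Finset.mem_filter.1 ha).2
  choose! z hz using hpt
  let D : Finset Plane := A.image z
  let R := {a : J × ((ι → SignType) × ι × ι) // (σ₀ a).Nontrivial}
  let σ : R → Set Plane := fun a => σ₀ a.1
  have hRA : ∀ a : R, a.1 ∈ A := fun a => Finset.mem_filter.2 ⟨Finset.mem_univ _, a.2.nonempty⟩
  have hPD : P = (D : Set Plane) ∪ ⋃ a, σ a := by
    rw [hP]
    ext x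
    simp only [Set.mem_iUnion, Set.mem_union]
    constructor
    · rintro ⟨j, t, hx⟩
      have hx' : x ∈ σ₀ (j, t) := hx
      by_cases hnt : (σ₀ (j, t)).Nontrivial
      · exact Or.inr ⟨⟨(j, t), hnt⟩, hx'⟩
      · left
        have hjt : (j, t) ∈ A := Finset.mem_filter.2 ⟨Finset.mem_univ _, ⟨x, hx'⟩⟩
        have : z (j, t) = x := Set.not_nontrivial_iff.1 hnt (hz _ hjt) hx'
        rw [← this]
        exact Finset.mem_coe.2 (Finset.mem_image_of_mem z hjt)
    · rintro (hx | ⟨a, ha⟩)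
      · obtain ⟨a, ha, rfl⟩ := Finset.mem_image.1 (Finset.mem_coe.1 hx)
        exact ⟨a.1, a.2, hz a ha⟩
      · exact ⟨a.1.1, a.1.2, ha⟩
  have hline : ∀ a : R, IsLine (affineSpan ℝ (σ a)) := fun a => (hno a.1.1).isLine a.2
  -- the lines of the family `j` that separate points of the piece `a`
  let K : J × ((ι → SignType) × ι × ι) → J → Finset ι := fun a j => Finset.univ.filter fun k =>
    ∃ u ∈ σ₀ a, ∃ w ∈ σ₀ a, Φ j k u < 0 ∧ 0 < Φ j k w
  let N : J × ((ι → SignType) × ι × ι) → ℕ := fun a => ∑ j, 3 * (2 * (K a j).card + 1)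
  have hN : ∀ a : R, (crossings σ a).encard ≤ N a.1 := by
    intro a
    refine le_trans (Set.encard_le_encard ?_) (encard_iUnion_le_sum _ _ fun j =>
      encard_crossings_on_line (hcr j) (hline a) (subset_affineSpan ℝ _) (K a.1 j)
        (by intro k hk; exact Finset.mem_filter.2 ⟨Finset.mem_univ _, hk⟩))
    rintro v ⟨hv, b, hvb, hb⟩
    exact Set.mem_iUnion.2 ⟨b.1.1, hv, b.1.2, hvb, hb⟩
  have hsep : ∀ j j', ∑ t ∈ I j, (K (j, t) j').card ≤ n * (3 * (2 * n + 1)) := by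
    intro j j'
    have h1 : ∑ t ∈ I j, (K (j, t) j').card = ∑ k, ((I j).filter fun t =>
        ∃ u ∈ σ₀ (j, t), ∃ w ∈ σ₀ (j, t), Φ j' k u < 0 ∧ 0 < Φ j' k w).card := by
      simp only [K, Finset.card_filter]
      rw [Finset.sum_comm]
    rw [h1]
    refine (Finset.sum_le_sum fun k _ => card_separated_le (hcr j) (Φ j' k) _
      fun t ht => (Finset.mem_filter.1 ht).2).trans ?_
    simp [n]
  have hNsum : ∑ a ∈ A, N a ≤ Fintype.card J * (Fintype.card J *
      (3 * B + 18 * (n * (2 * n + 1)))) := by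
    rw [hcardA]
    have h1 : ∀ j, ∑ t ∈ I j, N (j, t) ≤ Fintype.card J * (3 * B + 18 * (n * (2 * n + 1))) := by
      intro j
      simp only [N]
      rw [Finset.sum_comm]
      have h2 : ∀ j', ∑ t ∈ I j, 3 * (2 * (K (j, t) j').card + 1) ≤
          3 * B + 18 * (n * (2 * n + 1)) := by
        intro j'
        have := hsep j j'
        have := hB j
        rw [← Finset.mul_sum, Finset.sum_add_distrib, ← Finset.mul_sum]
        simp only [Finset.sum_const, smul_eq_mul, mul_one]
        have e1 : n * (3 * (2 * n + 1)) = 3 * (n * (2 * n + 1)) := by ring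
        simp only [I] at *
        omega
      refine (Finset.sum_le_sum fun j' _ => h2 j').trans ?_
      simp
    refine (Finset.sum_le_sum fun j _ => h1 j).trans ?_
    simp
  have hRcard : Fintype.card R ≤ A.card := by
    rw [← Finset.card_univ]
    exact Finset.card_le_card_of_injOn Subtype.val (fun a _ => hRA a)
      Subtype.val_injective.injOn
  have hRsum : ∑ a : R, N a.1 ≤ ∑ a ∈ A, N a := by
    have : ∑ a : R, N a.1 = ∑ a ∈ Finset.univ.image (Subtype.val : R → _), N a :=
      (Finset.sum_image Subtype.val_injective.injOn).symm
    rw [this]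
    refine Finset.sum_le_sum_of_subset fun a ha => ?_
    obtain ⟨b, -, rfl⟩ := Finset.mem_image.1 ha
    exact hRA b
  have hDcard : D.card ≤ A.card := Finset.card_image_le
  refine (complexity_le_of_union hPD (fun a => convex_piece a.1.2) hline hN).trans ?_
  norm_cast
  omega

end Families

/-! ### Arcs of the square -/

/-- The union of two half-open segments of lengths `a` and `b` that start at `x` in the directions
`-e` and `-e'`. -/
def arc (x e e' : Plane) (a b : ℝ) : Set Plane :=
  (fun t : ℝ => x - t • e) '' Set.Ico 0 a ∪ (fun t : ℝ => x - t • e') '' Set.Ico 0 b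

/-- From the point `x` of the boundary of the square at `p` the boundary continues straight in the
directions `-e` and `-e'`, for the lengths `κ` and `κ'`, and the arcs around `x` in this part of the
boundary are relatively open and, up to their end points, relatively closed. -/
structure IsProbe (p x e e' : Plane) (κ κ' : ℝ) : Prop where
  norm_left : ‖e‖ = 1
  norm_right : ‖e'‖ = 1
  inj : ∀ t t' : ℝ, 0 ≤ t → 0 ≤ t' → t • e = t' • e' → t = 0
  mem_left : ∀ t, 0 ≤ t → t ≤ κ → x - t • e ∈ squareBoundary p
  mem_right : ∀ t, 0 ≤ t → t ≤ κ' → x - t • e' ∈ squareBoundary p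
  isOpen : ∀ a b, 0 < a → a ≤ κ → 0 < b → b ≤ κ' →
    ∃ O, IsOpen O ∧ arc x e e' a b ⊆ O ∧ squareBoundary p ∩ O ⊆ arc x e e' a b
  isClosed : ∀ a b, 0 < a → a ≤ κ → 0 < b → b ≤ κ' →
    ∃ F, IsClosed F ∧ arc x e e' a b ⊆ F ∧
      squareBoundary p ∩ F ⊆ arc x e e' a b ∪ {x - a • e, x - b • e'}

lemma mem_squareBoundary_iff {k k' : Fin 2} (hk : k ≠ k') {p q : Plane} :
    q ∈ squareBoundary p ↔ max |q k - p k| |q k' - p k'| = 1 / 2 := by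
  fin_cases k <;> fin_cases k'
  · exact absurd rfl hk
  · exact Iff.rfl
  · show max |q 0 - p 0| |q 1 - p 1| = 1 / 2 ↔ max |q 1 - p 1| |q 0 - p 0| = 1 / 2
    rw [max_comm]
  · exact absurd rfl hk

lemma plane_ext {k k' : Fin 2} (hk : k ≠ k') {q r : Plane} (h : q k = r k) (h' : q k' = r k') :
    q = r := by
  ext i
  fin_cases k <;> fin_cases k' <;> fin_cases i <;> first | exact absurd rfl hk | exact h | exact h'

lemma coord_continuous (k : Fin 2) : Continuous fun q : Plane => q k := by fun_prop

lemma norm_single (k : Fin 2) {σ : ℝ} (hσ : σ * σ = 1) :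
    ‖(EuclideanSpace.single k σ : Plane)‖ = 1 := by
  rw [PiLp.norm_single, Real.norm_eq_abs]
  nlinarith [abs_mul_abs_self σ, abs_nonneg σ]

lemma max_eq_half {X Y : ℝ} (h : max |X| |Y| = 1 / 2) :
    X ≤ 1 / 2 ∧ -(1 / 2) ≤ X ∧ Y ≤ 1 / 2 ∧ -(1 / 2) ≤ Y ∧
      (X = 1 / 2 ∨ X = -(1 / 2) ∨ Y = 1 / 2 ∨ Y = -(1 / 2)) := by
  have h1 : |X| ≤ 1 / 2 := h ▸ le_max_left _ _
  have h2 : |Y| ≤ 1 / 2 := h ▸ le_max_right _ _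
  rw [abs_le] at h1 h2
  refine ⟨h1.2, h1.1, h2.2, h2.1, ?_⟩
  rcases max_choice |X| |Y| with g | g
  · rw [g] at h
    rcases abs_eq (by norm_num : (0 : ℝ) ≤ 1 / 2) |>.1 h with h | h <;> simp [h]
  · rw [g] at h
    rcases abs_eq (by norm_num : (0 : ℝ) ≤ 1 / 2) |>.1 h with h | h <;> simp [h]

lemma abs_sign_mul {σ : ℝ} (hσ : σ * σ = 1) (X : ℝ) : |σ * X| = |X| := by
  have : |σ| = 1 := by nlinarith [abs_mul_abs_self σ, abs_nonneg σ]
  rw [abs_mul, this, one_mul]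

/-- The vector from the centre of the square to a point on the side given by a coordinate `k'` and
a sign `σ`; the other coordinate of the vector is `u`. -/
noncomputable def sideVec (k k' : Fin 2) (σ u : ℝ) : Plane :=
  EuclideanSpace.single k u + EuclideanSpace.single k' (σ / 2)

/-- The corners of the square. -/
lemma isProbe_corner {k k' : Fin 2} (hk : k ≠ k') {σ σ' : ℝ} (hσ : σ * σ = 1) (hσ' : σ' * σ' = 1)
    (p : Plane) :
    IsProbe p (p + sideVec k k' σ' (σ / 2))
      (EuclideanSpace.single k σ) (EuclideanSpace.single k' σ') 1 1 := by
  have hσ0 : σ ≠ 0 := fun h => by simp [h] at hσ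
  have hσ0' : σ' ≠ 0 := fun h => by simp [h] at hσ'
  have hab : |σ| = 1 := by nlinarith [abs_mul_abs_self σ, abs_nonneg σ]
  have hab' : |σ'| = 1 := by nlinarith [abs_mul_abs_self σ', abs_nonneg σ']
  set x : Plane := p + sideVec k k' σ' (σ / 2) with hx
  have hxk : x k = p k + σ / 2 := by simp [hx, sideVec, hk]
  have hxk' : x k' = p k' + σ' / 2 := by simp [hx, sideVec, hk.symm]
  have hl : ∀ t : ℝ, (x - t • (EuclideanSpace.single k σ : Plane)) k = p k + σ * (1 / 2 - t) ∧
      (x - t • (EuclideanSpace.single k σ : Plane)) k' = p k' + σ' / 2 := by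
    intro t
    constructor
    · simp [hxk]; ring
    · simp [hxk', hk.symm]
  have hr : ∀ t : ℝ, (x - t • (EuclideanSpace.single k' σ' : Plane)) k = p k + σ / 2 ∧
      (x - t • (EuclideanSpace.single k' σ' : Plane)) k' = p k' + σ' * (1 / 2 - t) := by
    intro t
    constructor
    · simp [hxk, hk]
    · simp [hxk']; ring
  have hB : ∀ q, q ∈ squareBoundary p → max |σ * (q k - p k)| |σ' * (q k' - p k')| = 1 / 2 := by
    intro q hq
    rw [abs_sign_mul hσ, abs_sign_mul hσ']
    exact (mem_squareBoundary_iff hk).1 hq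
  have hql : ∀ q : Plane, σ' * (q k' - p k') = 1 / 2 →
      q = x - (1 / 2 - σ * (q k - p k)) • (EuclideanSpace.single k σ : Plane) := by
    intro q hq
    apply plane_ext hk
    · rw [(hl _).1]; linear_combination (p k - q k) * hσ
    · rw [(hl _).2]; linear_combination (-(q k' - p k')) * hσ' + σ' * hq
  have hqr : ∀ q : Plane, σ * (q k - p k) = 1 / 2 →
      q = x - (1 / 2 - σ' * (q k' - p k')) • (EuclideanSpace.single k' σ' : Plane) := by
    intro q hq
    apply plane_ext hk
    · rw [(hr _).1]; linear_combination (-(q k - p k)) * hσ + σ * hq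
    · rw [(hr _).2]; linear_combination (p k' - q k') * hσ'
  have hX : ∀ c : ℝ, σ * (p k + σ * c - p k) = c := fun c => by linear_combination c * hσ
  have hX' : ∀ c : ℝ, σ' * (p k' + σ' * c - p k') = c := fun c => by linear_combination c * hσ'
  have hX2 : σ * (p k + σ / 2 - p k) = 1 / 2 := by linear_combination (1 / 2) * hσ
  have hX2' : σ' * (p k' + σ' / 2 - p k') = 1 / 2 := by linear_combination (1 / 2) * hσ'
  have hc : Continuous fun q : Plane => σ * (q k - p k) :=
    continuous_const.mul ((coord_continuous k).sub continuous_const)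
  have hc' : Continuous fun q : Plane => σ' * (q k' - p k') :=
    continuous_const.mul ((coord_continuous k').sub continuous_const)
  refine ⟨norm_single k hσ, norm_single k' hσ', ?_, ?_, ?_, ?_, ?_⟩
  · intro t t' _ _ h
    have := congrArg (fun v : Plane => v k) h
    simpa [hk, hσ0] using this
  · intro t h0 h1
    rw [mem_squareBoundary_iff hk, (hl t).1, (hl t).2, add_sub_cancel_left, add_sub_cancel_left,
      abs_sign_mul hσ, abs_div, hab', abs_two, max_eq_right]
    rw [abs_le]; constructor <;> linarith
  · intro t h0 h1
    rw [mem_squareBoundary_iff hk, (hr t).1, (hr t).2, add_sub_cancel_left, add_sub_cancel_left,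
      abs_sign_mul hσ', abs_div, hab, abs_two, max_eq_left]
    rw [abs_le]; constructor <;> linarith
  · intro a b ha ha1 hb hb1
    refine ⟨{q | 1 / 2 - a < σ * (q k - p k)} ∩ {q | 1 / 2 - b < σ' * (q k' - p k')},
      (isOpen_lt continuous_const hc).inter (isOpen_lt continuous_const hc'), ?_, ?_⟩
    · rintro _ (⟨t, ⟨h0, h1⟩, rfl⟩ | ⟨t, ⟨h0, h1⟩, rfl⟩)
      · simp only [Set.mem_inter_iff, Set.mem_ofPred_eq, (hl t).1, (hl t).2, hX, hX2']
        constructor <;> linarith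
      · simp only [Set.mem_inter_iff, Set.mem_ofPred_eq, (hr t).1, (hr t).2, hX', hX2]
        constructor <;> linarith
    · rintro q ⟨hq, h1, h2⟩
      have h1 : 1 / 2 - a < σ * (q k - p k) := h1
      have h2 : 1 / 2 - b < σ' * (q k' - p k') := h2
      obtain ⟨g1, g2, g3, g4, g5⟩ := max_eq_half (hB q hq)
      rcases g5 with g5 | g5 | g5 | g5
      · exact Or.inr ⟨_, ⟨by linarith, by linarith⟩, (hqr q g5).symm⟩
      · linarith
      · exact Or.inl ⟨_, ⟨by linarith, by linarith⟩, (hql q g5).symm⟩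
      · linarith
  · intro a b ha ha1 hb hb1
    refine ⟨({q | 1 / 2 - a ≤ σ * (q k - p k)} ∩ {q | 1 / 2 - b ≤ σ' * (q k' - p k')}) ∩
      ({q | 1 / 2 ≤ σ * (q k - p k)} ∪ {q | 1 / 2 ≤ σ' * (q k' - p k')}),
      ((isClosed_le continuous_const hc).inter (isClosed_le continuous_const hc')).inter
        ((isClosed_le continuous_const hc).union (isClosed_le continuous_const hc')), ?_, ?_⟩
    · rintro _ (⟨t, ⟨h0, h1⟩, rfl⟩ | ⟨t, ⟨h0, h1⟩, rfl⟩)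
      · simp only [Set.mem_inter_iff, Set.mem_union, Set.mem_ofPred_eq, (hl t).1, (hl t).2, hX, hX2']
        exact ⟨⟨by linarith, by linarith⟩, Or.inr le_rfl⟩
      · simp only [Set.mem_inter_iff, Set.mem_union, Set.mem_ofPred_eq, (hr t).1, (hr t).2, hX', hX2]
        exact ⟨⟨by linarith, by linarith⟩, Or.inl le_rfl⟩
    · rintro q ⟨hq, ⟨h1, h2⟩, h3⟩
      have h1 : 1 / 2 - a ≤ σ * (q k - p k) := h1
      have h2 : 1 / 2 - b ≤ σ' * (q k' - p k') := h2
      obtain ⟨g1, g2, g3, g4, -⟩ := max_eq_half (hB q hq)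
      rcases h3 with h3 | h3
      · have h3 : 1 / 2 ≤ σ * (q k - p k) := h3
        have he := hqr q (le_antisymm g1 h3)
        rcases h2.lt_or_eq with h | h
        · exact Or.inl (Or.inr ⟨_, ⟨by linarith, by linarith⟩, he.symm⟩)
        · refine Or.inr (Or.inr ?_)
          rw [← h] at he
          rw [Set.mem_singleton_iff, he]
          congr 2; ring
      · have h3 : 1 / 2 ≤ σ' * (q k' - p k') := h3
        have he := hql q (le_antisymm g3 h3)
        rcases h1.lt_or_eq with h | h
        · exact Or.inl (Or.inl ⟨_, ⟨by linarith, by linarith⟩, he.symm⟩)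
        · refine Or.inr (Or.inl ?_)
          rw [← h] at he
          rw [he]
          congr 2; ring

/-- The sides of the square. -/
lemma isProbe_side {k k' : Fin 2} (hk : k ≠ k') {σ : ℝ} (hσ : σ * σ = 1) {u : ℝ}
    (hu : -(1 / 2) ≤ u) (hu' : u ≤ 1 / 2) (p : Plane) :
    IsProbe p (p + sideVec k k' σ u)
      (EuclideanSpace.single k 1) (-EuclideanSpace.single k 1) (u + 1 / 2) (1 / 2 - u) := by
  have hab : |σ| = 1 := by nlinarith [abs_mul_abs_self σ, abs_nonneg σ]
  set x : Plane := p + sideVec k k' σ u with hx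
  have hxk : x k = p k + u := by simp [hx, sideVec, hk]
  have hxk' : x k' = p k' + σ / 2 := by simp [hx, sideVec, hk.symm]
  have hl : ∀ t : ℝ, (x - t • (EuclideanSpace.single k 1 : Plane)) k = p k + (u - t) ∧
      (x - t • (EuclideanSpace.single k 1 : Plane)) k' = p k' + σ / 2 := by
    intro t
    constructor
    · simp [hxk]; ring
    · simp [hxk', hk.symm]
  have hr : ∀ t : ℝ, (x - t • (-EuclideanSpace.single k 1 : Plane)) k = p k + (u + t) ∧
      (x - t • (-EuclideanSpace.single k 1 : Plane)) k' = p k' + σ / 2 := by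
    intro t
    constructor
    · simp [hxk]; ring
    · simp [hxk', hk.symm]
  have hB : ∀ q, q ∈ squareBoundary p → max |q k - p k| |σ * (q k' - p k')| = 1 / 2 := by
    intro q hq
    rw [abs_sign_mul hσ]
    exact (mem_squareBoundary_iff hk).1 hq
  have hql : ∀ q : Plane, σ * (q k' - p k') = 1 / 2 →
      q = x - (u - (q k - p k)) • (EuclideanSpace.single k 1 : Plane) := by
    intro q hq
    apply plane_ext hk
    · rw [(hl _).1]; ring
    · rw [(hl _).2]; linear_combination (-(q k' - p k')) * hσ + σ * hq
  have hqr : ∀ q : Plane, σ * (q k' - p k') = 1 / 2 →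
      q = x - ((q k - p k) - u) • (-EuclideanSpace.single k 1 : Plane) := by
    intro q hq
    apply plane_ext hk
    · rw [(hr _).1]; ring
    · rw [(hr _).2]; linear_combination (-(q k' - p k')) * hσ + σ * hq
  have hX2 : σ * (p k' + σ / 2 - p k') = 1 / 2 := by linear_combination (1 / 2) * hσ
  have hc : Continuous fun q : Plane => q k - p k := (coord_continuous k).sub continuous_const
  have hc' : Continuous fun q : Plane => σ * (q k' - p k') :=
    continuous_const.mul ((coord_continuous k').sub continuous_const)
  refine ⟨norm_single k (by norm_num), by rw [norm_neg]; exact norm_single k (by norm_num),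
    ?_, ?_, ?_, ?_, ?_⟩
  · intro t t' h0 h1 h
    have := congrArg (fun v : Plane => v k) h
    simp at this
    linarith
  · intro t h0 h1
    rw [mem_squareBoundary_iff hk, (hl t).1, (hl t).2, add_sub_cancel_left, add_sub_cancel_left,
      abs_div, hab, abs_two, max_eq_right_iff, abs_le]
    constructor <;> linarith
  · intro t h0 h1
    rw [mem_squareBoundary_iff hk, (hr t).1, (hr t).2, add_sub_cancel_left, add_sub_cancel_left,
      abs_div, hab, abs_two, max_eq_right_iff, abs_le]
    constructor <;> linarith
  · intro a b ha ha1 hb hb1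
    refine ⟨({q | u - a < q k - p k} ∩ {q | q k - p k < u + b}) ∩ {q | 0 < σ * (q k' - p k')},
      ((isOpen_lt continuous_const hc).inter (isOpen_lt hc continuous_const)).inter
        (isOpen_lt continuous_const hc'), ?_, ?_⟩
    · rintro _ (⟨t, ⟨h0, h1⟩, rfl⟩ | ⟨t, ⟨h0, h1⟩, rfl⟩)
      · simp only [Set.mem_inter_iff, Set.mem_ofPred_eq, (hl t).1, (hl t).2, hX2]
        exact ⟨⟨by linarith, by linarith⟩, by norm_num⟩
      · simp only [Set.mem_inter_iff, Set.mem_ofPred_eq, (hr t).1, (hr t).2, hX2]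
        exact ⟨⟨by linarith, by linarith⟩, by norm_num⟩
    · rintro q ⟨hq, ⟨h1, h2⟩, h3⟩
      have h1 : u - a < q k - p k := h1
      have h2 : q k - p k < u + b := h2
      have h3 : 0 < σ * (q k' - p k') := h3
      obtain ⟨g1, g2, g3, g4, g5⟩ := max_eq_half (hB q hq)
      have g6 : σ * (q k' - p k') = 1 / 2 := by
        rcases g5 with g5 | g5 | g5 | g5 <;> linarith
      rcases le_total (q k - p k) u with h | h
      · exact Or.inl ⟨_, ⟨by linarith, by linarith⟩, (hql q g6).symm⟩
      · exact Or.inr ⟨_, ⟨by linarith, by linarith⟩, (hqr q g6).symm⟩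
  · intro a b ha ha1 hb hb1
    refine ⟨({q | u - a ≤ q k - p k} ∩ {q | q k - p k ≤ u + b}) ∩ {q | 1 / 2 ≤ σ * (q k' - p k')},
      ((isClosed_le continuous_const hc).inter (isClosed_le hc continuous_const)).inter
        (isClosed_le continuous_const hc'), ?_, ?_⟩
    · rintro _ (⟨t, ⟨h0, h1⟩, rfl⟩ | ⟨t, ⟨h0, h1⟩, rfl⟩)
      · simp only [Set.mem_inter_iff, Set.mem_ofPred_eq, (hl t).1, (hl t).2, hX2]
        exact ⟨⟨by linarith, by linarith⟩, le_rfl⟩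
      · simp only [Set.mem_inter_iff, Set.mem_ofPred_eq, (hr t).1, (hr t).2, hX2]
        exact ⟨⟨by linarith, by linarith⟩, le_rfl⟩
    · rintro q ⟨hq, ⟨h1, h2⟩, h3⟩
      have h1 : u - a ≤ q k - p k := h1
      have h2 : q k - p k ≤ u + b := h2
      have h3 : 1 / 2 ≤ σ * (q k' - p k') := h3
      obtain ⟨g1, g2, g3, g4, -⟩ := max_eq_half (hB q hq)
      have g6 : σ * (q k' - p k') = 1 / 2 := le_antisymm g3 h3
      rcases le_total (q k - p k) u with h | h
      · rcases h1.lt_or_eq with h' | h'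
        · exact Or.inl (Or.inl ⟨_, ⟨by linarith, by linarith⟩, (hql q g6).symm⟩)
        · refine Or.inr (Or.inl ?_)
          have he := hql q g6
          rw [← h'] at he
          rw [he]; congr 2; ring
      · rcases h2.lt_or_eq with h' | h'
        · exact Or.inl (Or.inr ⟨_, ⟨by linarith, by linarith⟩, (hqr q g6).symm⟩)
        · refine Or.inr (Or.inr ?_)
          have he := hqr q g6
          rw [h'] at he
          rw [Set.mem_singleton_iff, he]; congr 2; ring

/-! ### Components of the cut boundary -/

lemma isometry_ray {x e : Plane} (he : ‖e‖ = 1) : Isometry fun t : ℝ => x - t • e := by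
  refine Isometry.of_dist_eq fun s t => ?_
  rw [dist_sub_left, dist_eq_norm, ← sub_smul, norm_smul, he, mul_one, Real.dist_eq,
    Real.norm_eq_abs]

lemma hausdorffMeasure_arc {x e e' : Plane} (he : ‖e‖ = 1) (he' : ‖e'‖ = 1)
    (hinj : ∀ t t' : ℝ, 0 ≤ t → 0 ≤ t' → t • e = t' • e' → t = 0) {a b : ℝ} (ha : 0 < a)
    (hb : 0 < b) : μH[1] (arc x e e' a b) = ENNReal.ofReal (a + b) := by
  have hsplit : arc x e e' a b =
      (fun t : ℝ => x - t • e) '' Set.Ico 0 a ∪ (fun t : ℝ => x - t • e') '' Set.Ioo 0 b := by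
    apply Set.Subset.antisymm
    · rintro _ (h | ⟨t, ⟨h0, h1⟩, rfl⟩)
      · exact Or.inl h
      · rcases h0.eq_or_lt with h | h
        · exact Or.inl ⟨0, ⟨le_rfl, ha⟩, by simp [← h]⟩
        · exact Or.inr ⟨t, ⟨h, h1⟩, rfl⟩
    · exact Set.union_subset_union_right _ (Set.image_mono Set.Ioo_subset_Ico_self)
  have hdisj : Disjoint ((fun t : ℝ => x - t • e) '' Set.Ico 0 a)
      ((fun t : ℝ => x - t • e') '' Set.Ioo 0 b) := by
    rw [Set.disjoint_left]
    rintro _ ⟨t, ⟨h0, -⟩, rfl⟩ ⟨t', ⟨h0', -⟩, h⟩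
    have h : t • e = t' • e' := (sub_right_inj.1 h).symm
    have ht := hinj t t' h0 h0'.le h
    rw [ht, zero_smul] at h
    have hn := congrArg norm h
    rw [norm_zero, norm_smul, he', mul_one, Real.norm_eq_abs, abs_of_pos h0'] at hn
    exact h0'.ne hn
  rw [hsplit, measure_union hdisj
      ((isometry_ray he').isClosedEmbedding.measurableEmbedding.measurableSet_image.2
        measurableSet_Ioo),
    (isometry_ray he).hausdorffMeasure_image (Or.inl zero_le_one),
    (isometry_ray he').hausdorffMeasure_image (Or.inl zero_le_one), hausdorffMeasure_real,
    Real.volume_Ico, Real.volume_Ioo, sub_zero, sub_zero, ENNReal.ofReal_add ha.le hb.le]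

lemma isPreconnected_ray {x e : Plane} {s : Set ℝ} (hs : IsPreconnected s) :
    IsPreconnected ((fun t : ℝ => x - t • e) '' s) :=
  hs.image _ (by fun_prop)

lemma isPreconnected_arc {x e e' : Plane} {a b : ℝ} (ha : 0 < a) (hb : 0 < b) :
    IsPreconnected (arc x e e' a b) :=
  IsPreconnected.union x ⟨0, ⟨le_rfl, ha⟩, by simp⟩ ⟨0, ⟨le_rfl, hb⟩, by simp⟩
    (isPreconnected_ray isPreconnected_Ico) (isPreconnected_ray isPreconnected_Ico)

lemma mem_arc_self {x e e' : Plane} {a b : ℝ} (ha : 0 < a) : x ∈ arc x e e' a b :=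
  Or.inl ⟨0, ⟨le_rfl, ha⟩, by simp⟩

variable {p x e e' : Plane} {κ κ' : ℝ}

/-- An arc is a connected component of a subset of the boundary that omits its two end points. -/
lemma IsProbe.connectedComponentIn_eq (hp : IsProbe p x e e' κ κ') {a b : ℝ} (ha : 0 < a)
    (ha' : a ≤ κ) (hb : 0 < b) (hb' : b ≤ κ') {X : Set Plane} (hX : X ⊆ squareBoundary p)
    (harc : arc x e e' a b ⊆ X) (h1 : x - a • e ∉ X) (h2 : x - b • e' ∉ X) :
    connectedComponentIn X x = arc x e e' a b := by
  have hx := mem_arc_self (x := x) (e := e) (e' := e') (b := b) ha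
  apply Set.Subset.antisymm
  · obtain ⟨O, hO, hO1, hO2⟩ := hp.isOpen a b ha ha' hb hb'
    obtain ⟨F, hF, hF1, hF2⟩ := hp.isClosed a b ha ha' hb hb'
    have hCX := connectedComponentIn_subset X x
    have hmem : ∀ q ∈ connectedComponentIn X x, q ∈ F → q ∈ arc x e e' a b := by
      intro q hq hqF
      rcases hF2 ⟨hX (hCX hq), hqF⟩ with h | h | h
      · exact h
      · exact absurd (h ▸ hCX hq) h1
      · exact absurd (h ▸ hCX hq) h2
    intro q hq
    by_contra hqa
    obtain ⟨r, hr, hrO, hrF⟩ := isPreconnected_connectedComponentIn O Fᶜ hO hF.isOpen_compl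
      (fun r hr => by
        by_cases h : r ∈ F
        · exact Or.inl (hO1 (hmem r hr h))
        · exact Or.inr h)
      ⟨x, mem_connectedComponentIn (harc hx), hO1 hx⟩
      ⟨q, hq, fun h => hqa (hmem q hq h)⟩
    exact hrF (hF1 (hO2 ⟨hX (hCX hr), hrO⟩))
  · exact (isPreconnected_arc ha hb).subset_connectedComponentIn hx harc

section Exits

set_option linter.unusedSectionVars false

variable {ι : Type*} [Fintype ι] [LinearOrder ι] {φ : ι → Plane →ᵃ[ℝ] ℝ}

lemma affine_ray (h : Plane →ᵃ[ℝ] ℝ) (x e : Plane) (t : ℝ) :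
    h (x - t • e) = h x - t * h.linear e := by
  rw [sub_eq_add_neg, affine_add, map_neg, map_smul, smul_eq_mul, ← sub_eq_add_neg]

lemma reach_eq_of_ray_eq_zero {i : ι} {t : ℝ} (hx : φ i x ≠ 0) (ht : 0 ≤ t)
    (h : φ i (x - t • e) = 0) : 0 < t ∧ reach φ e i x = t := by
  rw [affine_ray] at h
  have h0 : t ≠ 0 := fun h0 => hx (by simpa [h0] using h)
  have he : (φ i).linear e ≠ 0 := fun he => hx (by simpa [he] using h)
  refine ⟨ht.lt_of_ne' h0, ?_⟩
  rw [reach_apply, sub_eq_zero.1 h]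
  field_simp

lemma Exit.ray_eq_zero {i : ι} (h : Exit φ e x i) : φ i (x - reach φ e i x • e) = 0 := by
  have he := linear_ne_zero_of_reach_pos h.1
  rw [affine_ray, reach_apply]
  field_simp
  ring

lemma Exit.ray_ne_zero {i : ι} (hx : ∀ k, φ k x ≠ 0) (h : Exit φ e x i) {t : ℝ} (ht : 0 ≤ t)
    (ht' : t < reach φ e i x) (k : ι) : φ k (x - t • e) ≠ 0 := by
  intro h0
  obtain ⟨h1, h2⟩ := reach_eq_of_ray_eq_zero (hx k) ht h0
  have := h.le (k := k) (h2 ▸ h1)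
  linarith

lemma exit_or_ray_ne_zero (φ : ι → Plane →ᵃ[ℝ] ℝ) (hx : ∀ k, φ k x ≠ 0) (e : Plane) (κ : ℝ) :
    (∃ i, Exit φ e x i ∧ reach φ e i x ≤ κ) ∨
      ∀ t, 0 ≤ t → t ≤ κ → ∀ k, φ k (x - t • e) ≠ 0 := by
  by_cases h : ∃ t, 0 ≤ t ∧ t ≤ κ ∧ ∃ k, φ k (x - t • e) = 0
  · obtain ⟨t, h0, h1, k, hk⟩ := h
    obtain ⟨h2, h3⟩ := reach_eq_of_ray_eq_zero (hx k) h0 hk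
    obtain ⟨i, hi⟩ := exists_exit (φ := φ) (e := e) (x := x) (k := k) (h3 ▸ h2)
    have := hi.le (k := k) (h3 ▸ h2)
    exact Or.inl ⟨i, hi, by linarith⟩
  · push Not at h
    exact Or.inr h

lemma exists_ray_ne_zero (φ : ι → Plane →ᵃ[ℝ] ℝ) (hx : ∀ k, φ k x ≠ 0) (e : Plane) (hκ : 0 < κ) :
    ∃ δ, 0 < δ ∧ δ ≤ κ ∧ ∀ t, 0 ≤ t → t < δ → ∀ k, φ k (x - t • e) ≠ 0 := by
  rcases exit_or_ray_ne_zero φ hx e κ with ⟨i, hi, h⟩ | h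
  · exact ⟨_, hi.1, h, fun t h0 h1 => hi.ray_ne_zero hx h0 h1⟩
  · exact ⟨κ, hκ, le_rfl, fun t h0 h1 => h t h0 h1.le⟩

variable (φ) in
/-- The lines of `L` are the zero sets of the functions `φ i`. -/
def IsEquation (L : Finset (AffineSubspace ℝ Plane)) : Prop :=
  ∀ z, z ∈ ⋃ l ∈ L, (l : Set Plane) ↔ ∃ i, φ i z = 0

variable {L : Finset (AffineSubspace ℝ Plane)} {ε : ℝ}

lemma IsEquation.mem_cutBoundary (hL : IsEquation φ L) {z : Plane} :
    z ∈ cutBoundary L p ↔ z ∈ squareBoundary p ∧ ∀ i, φ i z ≠ 0 := by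
  rw [cutBoundary, Set.mem_sdiff, hL z, not_exists]

lemma IsProbe.arc_subset (hL : IsEquation φ L) (hp : IsProbe p x e e' κ κ') {a b : ℝ}
    (ha : a ≤ κ) (hb : b ≤ κ') (h : ∀ t, 0 ≤ t → t < a → ∀ k, φ k (x - t • e) ≠ 0)
    (h' : ∀ t, 0 ≤ t → t < b → ∀ k, φ k (x - t • e') ≠ 0) :
    arc x e e' a b ⊆ cutBoundary L p := by
  rintro _ (⟨t, ⟨h0, h1⟩, rfl⟩ | ⟨t, ⟨h0, h1⟩, rfl⟩) <;> rw [hL.mem_cutBoundary]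
  · exact ⟨hp.mem_left t h0 (by linarith), h t h0 h1⟩
  · exact ⟨hp.mem_right t h0 (by linarith), h' t h0 h1⟩

/-- The component of a point from which both rays exit within the probe. -/
lemma IsProbe.component_eq_arc (hL : IsEquation φ L) (hp : IsProbe p x e e' κ κ')
    (hx : ∀ i, φ i x ≠ 0) {i k : ι} (hi : Exit φ e x i) (hk : Exit φ e' x k)
    (h : reach φ e i x ≤ κ) (h' : reach φ e' k x ≤ κ') :
    connectedComponentIn (cutBoundary L p) x =
      arc x e e' (reach φ e i x) (reach φ e' k x) := by
  refine hp.connectedComponentIn_eq hi.1 h hk.1 h' Set.sdiff_subset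
    (hp.arc_subset hL h h' (fun t => hi.ray_ne_zero hx) (fun t => hk.ray_ne_zero hx)) ?_ ?_
  · exact fun hm => (hL.mem_cutBoundary.1 hm).2 i hi.ray_eq_zero
  · exact fun hm => (hL.mem_cutBoundary.1 hm).2 k hk.ray_eq_zero

lemma IsProbe.mem_cutBoundary (hL : IsEquation φ L) (hp : IsProbe p x e e' κ κ') (hκ : 0 ≤ κ)
    (hx : ∀ i, φ i x ≠ 0) : x ∈ cutBoundary L p := by
  rw [hL.mem_cutBoundary]
  exact ⟨by simpa using hp.mem_left 0 le_rfl hκ, hx⟩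

/-- A point in a piece lies on an `ε`-segment. -/
lemma IsProbe.isEpsSegment (hL : IsEquation φ L) (hp : IsProbe p x e e' κ κ')
    {t : (ι → SignType) × ι × ι} (ht : x ∈ piece φ ε e e' κ κ' t) :
    ∃ s, IsEpsSegment L ε p s ∧ x ∈ s := by
  obtain ⟨hx, -, hi, hk, hs, h, h'⟩ := ht
  have hmem := hp.mem_cutBoundary hL (hi.1.le.trans h) hx
  refine ⟨_, ⟨⟨x, hmem, rfl⟩, ?_⟩, mem_connectedComponentIn hmem⟩
  rw [hp.component_eq_arc hL hx hi hk h h', hausdorffMeasure_arc hp.norm_left hp.norm_right hp.inj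
    hi.1 hk.1, hs]

lemma IsEpsSegment.eq_connectedComponentIn {s : Set Plane} (hs : IsEpsSegment L ε p s)
    (hx : x ∈ s) : s = connectedComponentIn (cutBoundary L p) x := by
  obtain ⟨⟨y, -, rfl⟩, -⟩ := hs
  exact connectedComponentIn_eq hx

lemma IsEpsSegment.subset {s : Set Plane} (hs : IsEpsSegment L ε p s) : s ⊆ cutBoundary L p := by
  obtain ⟨⟨y, -, rfl⟩, -⟩ := hs
  exact connectedComponentIn_subset _ _

lemma IsEpsSegment.subset_of_isPreconnected {s A : Set Plane} (hs : IsEpsSegment L ε p s)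
    (hx : x ∈ s) (hA : IsPreconnected A) (hxA : x ∈ A) (hAX : A ⊆ cutBoundary L p) : A ⊆ s := by
  rw [hs.eq_connectedComponentIn hx]
  exact hA.subset_connectedComponentIn hxA hAX

/-- If both rays from a point of an `ε`-segment exit within the probe, then the `ε`-segment is an
arc. -/
lemma IsProbe.arc_of_exit (hL : IsEquation φ L) (hp : IsProbe p x e e' κ κ') (hε : 0 < ε)
    {s : Set Plane} (hs : IsEpsSegment L ε p s) (hxs : x ∈ s)
    {i k : ι} (hi : Exit φ e x i) (hk : Exit φ e' x k)
    (h : reach φ e i x ≤ κ) (h' : reach φ e' k x ≤ κ') :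
    s = arc x e e' (reach φ e i x) (reach φ e' k x) ∧
      reach φ e i x + reach φ e' k x = ε := by
  have hx := (hL.mem_cutBoundary.1 (hs.subset hxs)).2
  have heq := hp.component_eq_arc hL hx hi hk h h'
  rw [← hs.eq_connectedComponentIn hxs] at heq
  refine ⟨heq, ?_⟩
  have hm := hs.2
  rw [heq, hausdorffMeasure_arc hp.norm_left hp.norm_right hp.inj hi.1 hk.1] at hm
  exact (ENNReal.ofReal_eq_ofReal_iff (add_pos hi.1 hk.1).le hε.le).1 hm

/-- Probes that are longer than `ε` detect every `ε`-segment through their point. -/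
lemma IsProbe.exists_mem_piece (hL : IsEquation φ L) (hp : IsProbe p x e e' κ κ') (hε : 0 < ε)
    (hκ : ε ≤ κ) (hκ' : ε ≤ κ') {s : Set Plane} (hs : IsEpsSegment L ε p s) (hxs : x ∈ s) :
    ∃ t, x ∈ piece φ ε e e' κ κ' t := by
  have hx := (hL.mem_cutBoundary.1 (hs.subset hxs)).2
  -- an arc in the component is no longer than `ε`
  have hlong : ∀ a b, 0 < a → 0 < b → ε < a + b → a ≤ κ → b ≤ κ' →
      (∀ t, 0 ≤ t → t < a → ∀ k, φ k (x - t • e) ≠ 0) →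
      (∀ t, 0 ≤ t → t < b → ∀ k, φ k (x - t • e') ≠ 0) → False := by
    intro a b ha hb hab ha' hb' h h'
    have hsub := hs.subset_of_isPreconnected hxs (isPreconnected_arc ha hb) (mem_arc_self ha)
      (hp.arc_subset hL ha' hb' h h')
    have hm := measure_mono (μ := μH[1]) hsub
    rw [hausdorffMeasure_arc hp.norm_left hp.norm_right hp.inj ha hb, hs.2,
      ENNReal.ofReal_le_ofReal_iff hε.le] at hm
    linarith
  rcases exit_or_ray_ne_zero φ hx e κ with ⟨i, hi, h⟩ | h
  · rcases exit_or_ray_ne_zero φ hx e' κ' with ⟨k, hk, h'⟩ | h'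
    · exact ⟨(sgn φ x, i, k), hx, rfl, hi, hk, (hp.arc_of_exit hL hε hs hxs hi hk h h').2, h, h'⟩
    · exact (hlong _ κ' hi.1 (by linarith) (by linarith [hi.1]) h le_rfl
        (fun t => hi.ray_ne_zero hx) (fun t h0 h1 => h' t h0 h1.le)).elim
  · obtain ⟨δ, hδ, hδ', hfree⟩ := exists_ray_ne_zero φ hx e' (hε.trans_le hκ')
    exact (hlong κ δ (by linarith) hδ (by linarith) le_rfl hδ'
      (fun t h0 h1 => h t h0 h1.le) hfree).elim

/-- The points `j / M - 1 / 2` are less than `ε` apart, so that one of them lies in any open interval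
of length `ε`. -/
lemma exists_grid {α ε : ℝ} (hε : 0 < ε) {M : ℕ} (hM : 1 / ε < M) (h1 : -(1 / 2) ≤ α)
    (h2 : α + ε ≤ 1 / 2) : ∃ j : Fin (M + 1),
      α < (j : ℕ) / (M : ℝ) - 1 / 2 ∧ (j : ℕ) / (M : ℝ) - 1 / 2 < α + ε := by
  have hM0 : (0 : ℝ) < M := (by positivity : (0 : ℝ) < 1 / ε).trans hM
  have hM1 : 1 < ε * M := by rwa [div_lt_iff₀ hε, mul_comm] at hM
  have hnn : 0 ≤ (α + 1 / 2) * M := mul_nonneg (by linarith) hM0.le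
  have h3 := Nat.lt_floor_add_one ((α + 1 / 2) * M)
  have h4 := Nat.floor_le hnn
  set j := ⌊(α + 1 / 2) * M⌋₊
  have h5 : (j : ℝ) + 1 < (α + ε + 1 / 2) * M := by linarith
  have h6 : (α + ε + 1 / 2) * M ≤ 1 * M := mul_le_mul_of_nonneg_right (by linarith) hM0.le
  have hj : j + 1 < M + 1 := by
    have : ((j + 1 : ℕ) : ℝ) < M := by push_cast; linarith
    have : j + 1 < M := by exact_mod_cast this
    omega
  refine ⟨⟨j + 1, hj⟩, ?_, ?_⟩
  · rw [lt_sub_iff_add_lt, lt_div_iff₀ hM0]; push_cast; exact h3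
  · rw [sub_lt_iff_lt_add, div_lt_iff₀ hM0]; push_cast; exact h5

lemma sideVec_sub (k k' : Fin 2) (σ u t : ℝ) :
    p + sideVec k k' σ u - t • (EuclideanSpace.single k 1 : Plane) = p + sideVec k k' σ (u - t) := by
  have : (EuclideanSpace.single k (u - t) : Plane) =
      EuclideanSpace.single k u - t • EuclideanSpace.single k 1 := by
    ext i; by_cases h : i = k <;> simp [h]
  rw [sideVec, sideVec, this]; abel

lemma exists_side {q : Plane} (hq : q ∈ squareBoundary p) :
    ∃ k k' : Fin 2, k ≠ k' ∧ ∃ σ : ℝ, σ * σ = 1 ∧ ∃ u, -(1 / 2) ≤ u ∧ u ≤ 1 / 2 ∧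
      q = p + sideVec k k' σ u := by
  have h01 : (0 : Fin 2) ≠ 1 := by decide
  obtain ⟨h1, h2, h3, h4, h⟩ := max_eq_half hq
  rcases h with h | h | h | h
  · refine ⟨1, 0, h01.symm, 1, by norm_num, q 1 - p 1, h4, h3, plane_ext h01 ?_ ?_⟩
    · simp [sideVec]; linarith
    · simp [sideVec]
  · refine ⟨1, 0, h01.symm, -1, by norm_num, q 1 - p 1, h4, h3, plane_ext h01 ?_ ?_⟩
    · simp [sideVec]; linarith
    · simp [sideVec]
  · refine ⟨0, 1, h01, 1, by norm_num, q 0 - p 0, h2, h1, plane_ext h01 ?_ ?_⟩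
    · simp [sideVec]
    · simp [sideVec]; linarith
  · refine ⟨0, 1, h01, -1, by norm_num, q 0 - p 0, h2, h1, plane_ext h01 ?_ ?_⟩
    · simp [sideVec]
    · simp [sideVec]; linarith

/-- Every `ε`-segment contains a corner of the square or a grid point of a side, and is detected by
the probe at that point. -/
lemma IsEpsSegment.exists_probe (hL : IsEquation φ L) (hε : 0 < ε) (hε1 : ε ≤ 1) {M : ℕ}
    (hM : 1 / ε < M) {s : Set Plane} (hs : IsEpsSegment L ε p s) :
    (∃ σ σ' : ℝ, σ * σ = 1 ∧ σ' * σ' = 1 ∧ ∃ t, p + sideVec 0 1 σ' (σ / 2) ∈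
        piece φ ε (EuclideanSpace.single 0 σ) (EuclideanSpace.single 1 σ') 1 1 t) ∨
      ∃ k k' : Fin 2, k ≠ k' ∧ ∃ σ : ℝ, σ * σ = 1 ∧ ∃ (j : Fin (M + 1)) (u : ℝ),
        u = (j : ℕ) / (M : ℝ) - 1 / 2 ∧ ∃ t, p + sideVec k k' σ u ∈
          piece φ ε (EuclideanSpace.single k 1) (-EuclideanSpace.single k 1) (u + 1 / 2)
            (1 / 2 - u) t := by
  -- if no corner is on `s`, then `s` is an open interval of length `ε` on one side
  by_cases hc : ∃ σ σ' : ℝ, σ * σ = 1 ∧ σ' * σ' = 1 ∧ p + sideVec 0 1 σ' (σ / 2) ∈ s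
  · obtain ⟨σ, σ', hσ, hσ', hmem⟩ := hc
    exact Or.inl ⟨σ, σ', hσ, hσ',
      (isProbe_corner (by decide) hσ hσ' p).exists_mem_piece hL hε hε1 hε1 hs hmem⟩
  right
  have hcorner : ∀ k k' : Fin 2, k ≠ k' → ∀ σ σ' : ℝ, σ * σ = 1 → σ' * σ' = 1 →
      p + sideVec k k' σ' (σ / 2) ∉ s := by
    intro k k' hk σ σ' hσ hσ' hmem
    fin_cases k <;> fin_cases k'
    · exact hk rfl
    · exact hc ⟨σ, σ', hσ, hσ', hmem⟩
    · refine hc ⟨σ', σ, hσ', hσ, ?_⟩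
      rwa [sideVec, add_comm (EuclideanSpace.single 0 _)]
    · exact hk rfl
  obtain ⟨q, hq⟩ : s.Nonempty := by
    obtain ⟨⟨y, hy, rfl⟩, -⟩ := hs
    exact ⟨y, mem_connectedComponentIn hy⟩
  obtain ⟨k, k', hk, σ, hσ, u, hu, hu', rfl⟩ := exists_side (hs.subset hq).1
  refine ⟨k, k', hk, σ, hσ, ?_⟩
  -- the rays along the side from a point of `s` are cut before they arrive at a corner
  have hexit : ∀ v, -(1 / 2) ≤ v → v ≤ 1 / 2 → p + sideVec k k' σ v ∈ s → ∃ i m,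
      Exit φ (EuclideanSpace.single k 1) (p + sideVec k k' σ v) i ∧
      Exit φ (-EuclideanSpace.single k 1) (p + sideVec k k' σ v) m ∧
      reach φ (EuclideanSpace.single k 1) i (p + sideVec k k' σ v) ≤ v + 1 / 2 ∧
      reach φ (-EuclideanSpace.single k 1) m (p + sideVec k k' σ v) ≤ 1 / 2 - v := by
    intro v hv hv' hvs
    have hp := isProbe_side hk hσ hv hv' p
    have hx := (hL.mem_cutBoundary.1 (hs.subset hvs)).2
    rcases exit_or_ray_ne_zero φ hx (EuclideanSpace.single k 1) (v + 1 / 2) with ⟨i, hi, h⟩ | h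
    · rcases exit_or_ray_ne_zero φ hx (-EuclideanSpace.single k 1) (1 / 2 - v) with
        ⟨m, hm, h'⟩ | h'
      · exact ⟨i, m, hi, hm, h, h'⟩
      · exfalso
        refine hcorner k k' hk 1 σ (by norm_num) hσ ?_
        refine hs.subset_of_isPreconnected hvs
          (isPreconnected_ray (x := p + sideVec k k' σ v) (e := -EuclideanSpace.single k 1)
            (isPreconnected_Icc (a := 0) (b := 1 / 2 - v)))
          ⟨0, ⟨le_rfl, by linarith⟩, by simp⟩ ?_ ⟨1 / 2 - v, ⟨by linarith, le_rfl⟩, ?_⟩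
        · rintro _ ⟨t, ⟨h0, h1⟩, rfl⟩
          exact hL.mem_cutBoundary.2 ⟨hp.mem_right t h0 h1, h' t h0 h1⟩
        · show _ - _ = _
          rw [smul_neg, ← neg_smul, sideVec_sub]; congr 2; ring
    · exfalso
      refine hcorner k k' hk (-1) σ (by norm_num) hσ ?_
      refine hs.subset_of_isPreconnected hvs
        (isPreconnected_ray (x := p + sideVec k k' σ v) (e := EuclideanSpace.single k 1)
          (isPreconnected_Icc (a := 0) (b := v + 1 / 2)))
        ⟨0, ⟨le_rfl, by linarith⟩, by simp⟩ ?_ ⟨v + 1 / 2, ⟨by linarith, le_rfl⟩, ?_⟩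
      · rintro _ ⟨t, ⟨h0, h1⟩, rfl⟩
        exact hL.mem_cutBoundary.2 ⟨hp.mem_left t h0 h1, h t h0 h1⟩
      · show _ - _ = _
        rw [sideVec_sub]; congr 2; ring
  obtain ⟨i, m, hi, hm, h, h'⟩ := hexit u hu hu' hq
  obtain ⟨harc, hsum⟩ := (isProbe_side hk hσ hu hu' p).arc_of_exit hL hε hs hq hi hm h h'
  obtain ⟨j, hj, hj'⟩ := exists_grid (α := u - reach φ (EuclideanSpace.single k 1) i
    (p + sideVec k k' σ u)) hε hM (by linarith) (by linarith)
  generalize hv : ((j : ℕ) : ℝ) / (M : ℝ) - 1 / 2 = v at hj hj'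
  have hvs : p + sideVec k k' σ v ∈ s := by
    rw [harc]
    rcases le_total v u with hvu | hvu
    · refine Or.inl ⟨u - v, ⟨by linarith, by linarith⟩, ?_⟩
      show _ - _ = _
      rw [sideVec_sub]; congr 2; ring
    · refine Or.inr ⟨v - u, ⟨by linarith, by linarith⟩, ?_⟩
      show _ - _ = _
      rw [smul_neg, ← neg_smul, sideVec_sub]; congr 2; ring
  have hv1 : -(1 / 2) ≤ v := by linarith
  have hv2 : v ≤ 1 / 2 := by linarith
  obtain ⟨i', m', hi', hm', g, g'⟩ := hexit v hv1 hv2 hvs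
  have hx := (hL.mem_cutBoundary.1 (hs.subset hvs)).2
  exact ⟨j, v, hv.symm, (sgn φ (p + sideVec k k' σ v), i', m'), hx, rfl, hi', hm',
    ((isProbe_side hk hσ hv1 hv2 p).arc_of_exit hL hε hs hvs hi' hm' g g').2, g, g'⟩

end Exits

/-! ### The probes of the square -/

/-- The data of a probe, relative to the centre of the square: the vector to its point, its two
directions, and the lengths for which the boundary of the square follows them. -/
structure Probe where
  vec : Plane
  e : Plane
  e' : Plane
  κ : ℝ
  κ' : ℝ

/-- The probes are indexed by the four corners, and by `M + 1` equally spaced points on each of the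
four sides. -/
abbrev ProbeIndex (M : ℕ) : Type := (ℤˣ × ℤˣ) ⊕ (Fin 2 × ℤˣ × Fin (M + 1))

/-- The probe with a given index. -/
noncomputable def probe (M : ℕ) : ProbeIndex M → Probe
  | Sum.inl (σ, σ') =>
    ⟨sideVec 0 1 ((σ' : ℤ) : ℝ) (((σ : ℤ) : ℝ) / 2), EuclideanSpace.single 0 ((σ : ℤ) : ℝ),
      EuclideanSpace.single 1 ((σ' : ℤ) : ℝ), 1, 1⟩
  | Sum.inr (k, σ, j) =>
    ⟨sideVec k k.rev ((σ : ℤ) : ℝ) ((j : ℕ) / (M : ℝ) - 1 / 2), EuclideanSpace.single k 1,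
      -EuclideanSpace.single k 1, (j : ℕ) / (M : ℝ) - 1 / 2 + 1 / 2,
      1 / 2 - ((j : ℕ) / (M : ℝ) - 1 / 2)⟩

lemma unit_mul_self (σ : ℤˣ) : ((σ : ℤ) : ℝ) * ((σ : ℤ) : ℝ) = 1 := by
  rcases Int.units_eq_one_or σ with rfl | rfl <;> simp

lemma exists_unit {σ : ℝ} (hσ : σ * σ = 1) : ∃ u : ℤˣ, ((u : ℤ) : ℝ) = σ := by
  rcases mul_self_eq_one_iff.1 hσ with rfl | rfl
  · exact ⟨1, by simp⟩
  · exact ⟨-1, by simp⟩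

lemma ne_rev (k : Fin 2) : k ≠ k.rev := by fin_cases k <;> decide

lemma eq_rev {k k' : Fin 2} (h : k ≠ k') : k' = k.rev := by
  fin_cases k <;> fin_cases k' <;> first | exact absurd rfl h | rfl

lemma isProbe_probe {M : ℕ} (hM : 0 < M) (p : Plane) (j : ProbeIndex M) :
    IsProbe p (p + (probe M j).vec) (probe M j).e (probe M j).e' (probe M j).κ (probe M j).κ' := by
  rcases j with ⟨σ, σ'⟩ | ⟨k, σ, j⟩
  · exact isProbe_corner (by decide) (unit_mul_self σ) (unit_mul_self σ') p
  · have hM' : (0 : ℝ) < M := by exact_mod_cast hM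
    have h0 : (0 : ℝ) ≤ (j : ℕ) / (M : ℝ) := by positivity
    have h1 : (j : ℕ) / (M : ℝ) ≤ 1 := by
      rw [div_le_one hM']
      exact_mod_cast Nat.lt_succ_iff.1 j.2
    exact isProbe_side (ne_rev k) (unit_mul_self σ) (by linarith) (by linarith) p

section Exits

set_option linter.unusedSectionVars false

variable {ι : Type*} [Fintype ι] [LinearOrder ι] (φ : ι → Plane →ᵃ[ℝ] ℝ)

/-- The lines translated by `-τ`. -/
noncomputable def shift (τ : Plane) (i : ι) : Plane →ᵃ[ℝ] ℝ :=
  φ i + AffineMap.const ℝ Plane ((φ i).linear τ)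

variable {φ} {e e' : Plane} {ε κ κ' : ℝ}

lemma shift_apply (τ : Plane) (i : ι) (p : Plane) : shift φ τ i p = φ i (p + τ) := by
  simp [shift, affine_add]

lemma reach_shift (τ : Plane) (i : ι) (p : Plane) :
    reach (shift φ τ) e i p = reach φ e i (p + τ) := by
  rw [reach_apply, reach_apply, shift_apply]
  simp [shift]

lemma mem_piece_shift {τ p : Plane} {t : (ι → SignType) × ι × ι} :
    p ∈ piece (shift φ τ) ε e e' κ κ' t ↔ p + τ ∈ piece φ ε e e' κ κ' t := by
  have h : sgn (shift φ τ) p = sgn φ (p + τ) := funext fun i => by rw [sgn, sgn, shift_apply]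
  simp only [piece, Set.mem_ofPred_eq, h, Exit, reach_shift, shift_apply]

lemma fewCrossings_corner {σ σ' : ℝ} (hε1 : ε ≤ 1)
    (hno : NoInterior φ ε (EuclideanSpace.single 0 σ) (EuclideanSpace.single 1 σ') 1 1) :
    FewCrossings φ ε (EuclideanSpace.single 0 σ) (EuclideanSpace.single 1 σ') 1 1 :=
  fun _ hl s => (encard_crossing_le_two hε1 hε1 hno hl s).trans (by norm_num)

/-- A coordinate as a linear functional. -/
noncomputable def coord (k : Fin 2) : Plane →ₗ[ℝ] ℝ :=
  (EuclideanSpace.proj k : Plane →L[ℝ] ℝ).toLinearMap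

lemma coord_apply (k : Fin 2) (v : Plane) : coord k v = v k := rfl

lemma coord_rev_eq_zero (k : Fin 2) (v : Plane) (h : coord k.rev v = 0) :
    ∃ r : ℝ, v = r • (EuclideanSpace.single k 1 : Plane) := by
  refine ⟨v k, plane_ext (ne_rev k) ?_ ?_⟩
  · simp
  · rw [coord_apply] at h
    simp [h, (ne_rev k).symm]

lemma card_pieceIndices_probe {M : ℕ} (j : ProbeIndex M) :
    (pieceIndices φ ε (probe M j).e (probe M j).e' (probe M j).κ (probe M j).κ').card ≤
      9 * (Fintype.card ι * (2 * Fintype.card ι + 1)) := by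
  rcases j with ⟨σ, σ'⟩ | ⟨k, σ, j⟩
  · refine card_pieceIndices_corner (ξ := ((σ : ℤ) : ℝ) • coord 0) (η := ((σ' : ℤ) : ℝ) • coord 1)
      fun v => plane_ext (k := 0) (k' := 1) (by decide) ?_ ?_
    · have := unit_mul_self σ
      simp [probe, coord_apply]
      linear_combination (-(v 0)) * this
    · have := unit_mul_self σ'
      simp [probe, coord_apply]
      linear_combination (-(v 1)) * this
  · exact card_pieceIndices_side (coord_rev_eq_zero k)

lemma fewCrossings_probe {M : ℕ} (hε1 : ε ≤ 1) (j : ProbeIndex M)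
    (hno : NoInterior φ ε (probe M j).e (probe M j).e' (probe M j).κ (probe M j).κ') :
    FewCrossings φ ε (probe M j).e (probe M j).e' (probe M j).κ (probe M j).κ' := by
  rcases j with ⟨σ, σ'⟩ | ⟨k, σ, j⟩
  · exact fewCrossings_corner hε1 hno
  · exact fun _ hl s => encard_crossing_le_three (coord_rev_eq_zero k) hno hl s

variable {L : Finset (AffineSubspace ℝ Plane)}

lemma epsPlacements_eq (hL : IsEquation φ L) (hε : 0 < ε) (hε1 : ε ≤ 1) {M : ℕ}
    (hM : 1 / ε < M) :
    epsPlacements L ε = ⋃ j : ProbeIndex M, ⋃ t, piece (shift φ (probe M j).vec) ε (probe M j).e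
      (probe M j).e' (probe M j).κ (probe M j).κ' t := by
  have hM0 : 0 < M := by
    have : (0 : ℝ) < M := (by positivity : (0 : ℝ) < 1 / ε).trans hM
    exact_mod_cast this
  ext p
  simp only [Set.mem_iUnion, mem_piece_shift]
  constructor
  · rintro ⟨s, hs⟩
    rcases hs.exists_probe hL hε hε1 hM with
      ⟨σ, σ', hσ, hσ', h⟩ | ⟨k, k', hk, σ, hσ, j, u, rfl, h⟩
    · obtain ⟨σ, rfl⟩ := exists_unit hσ
      obtain ⟨σ', rfl⟩ := exists_unit hσ'
      exact ⟨Sum.inl (σ, σ'), h⟩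
    · obtain ⟨σ, rfl⟩ := exists_unit hσ
      obtain rfl := eq_rev hk
      exact ⟨Sum.inr (k, σ, j), h⟩
  · rintro ⟨j, t, ht⟩
    obtain ⟨s, hs, -⟩ := (isProbe_probe hM0 p j).isEpsSegment hL ht
    exact ⟨s, hs⟩

/-- By general position the `ε`-segments through the point of a probe leave at most one degree of
freedom. -/
lemma noInterior_of_generalPosition (hL : IsEquation φ L) (hG : GeneralPosition L ε) {M : ℕ}
    (hM : 0 < M) (j : ProbeIndex M) :
    NoInterior (shift φ (probe M j).vec) ε (probe M j).e (probe M j).e' (probe M j).κ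
      (probe M j).κ' := by
  intro p hp
  simp only [mem_piece_shift] at hp
  obtain ⟨t, ht⟩ := hp.self_of_nhds
  obtain ⟨s, hs, hxs⟩ := (isProbe_probe hM p j).isEpsSegment hL ht
  apply hG.1 p s hs _ hxs
  filter_upwards [hp] with q hq
  obtain ⟨t, ht⟩ := hq
  rw [add_sub_cancel_left]
  exact (isProbe_probe hM q j).isEpsSegment hL ht

end Exits

lemma exists_isEquation {L : Finset (AffineSubspace ℝ Plane)} (hL : ∀ l ∈ L, IsLine l) :
    ∃ φ : Fin L.card → Plane →ᵃ[ℝ] ℝ, IsEquation φ L := by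
  choose ψ hψ using fun l : L => (hL l l.2).exists_equation
  refine ⟨fun i => ψ (L.equivFin.symm i), fun z => ?_⟩
  simp only [Set.mem_iUnion, SetLike.mem_coe, exists_prop]
  constructor
  · rintro ⟨l, hl, hz⟩
    refine ⟨L.equivFin ⟨l, hl⟩, ?_⟩
    rw [Equiv.symm_apply_apply]
    exact ((hψ ⟨l, hl⟩).2 z).1 hz
  · rintro ⟨i, hz⟩
    exact ⟨_, (L.equivFin.symm i).2, ((hψ _).2 z).2 hz⟩

lemma complexity_epsPlacements_le {L : Finset (AffineSubspace ℝ Plane)} {ε : ℝ}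
    (hL : ∀ l ∈ L, IsLine l) (hG : GeneralPosition L ε) (hε : 0 < ε) (hε1 : ε ≤ 1) {M B : ℕ}
    (hM : 1 / ε < M) (hB : 9 * (L.card * (2 * L.card + 1)) = B) :
    complexity (epsPlacements L ε) ≤
      ((15 * ((4 * M + 8) * B) + 4 * ((4 * M + 8) * ((4 * M + 8) * (3 * B + 2 * B))) + 1 : ℕ) :
        ℕ∞) := by
  obtain ⟨φ, hφ⟩ := exists_isEquation hL
  have hM0 : 0 < M := by
    have : (0 : ℝ) < M := (by positivity : (0 : ℝ) < 1 / ε).trans hM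
    exact_mod_cast this
  have hno := noInterior_of_generalPosition hφ hG hM0
  have h := complexity_le_of_families (B := B) _ _ _ _ _ _ (epsPlacements_eq hφ hε hε1 hM) hno
    (fun j => fewCrossings_probe hε1 j (hno j))
    (fun j => (card_pieceIndices_probe j).trans (by rw [Fintype.card_fin, hB]))
  have hJ : Fintype.card (ProbeIndex M) = 4 * M + 8 := by
    simp only [ProbeIndex, Fintype.card_sum, Fintype.card_prod, Fintype.card_units_int,
      Fintype.card_fin]
    ring
  have h2 : 18 * (L.card * (2 * L.card + 1)) = 2 * B := by omega
  rwa [hJ, Fintype.card_fin, h2] at h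

end SquarePlacement

theorem mainTheorem1 :
    ∃ C : ℝ, ∀ (n : ℕ) (ε : ℝ) (L : Finset (AffineSubspace ℝ SquarePlacement.Plane)),
      1 ≤ n → 0 < ε → ε ≤ 1 →
      L.card = n → (∀ l ∈ L, SquarePlacement.IsLine l) →
      SquarePlacement.GeneralPosition L ε →
      ∃ m : ℕ, SquarePlacement.complexity (SquarePlacement.epsPlacements L ε) = (m : ℕ∞) ∧
        (m : ℝ) ≤ C * ((n : ℝ) ^ 2 / ε ^ 2) := by
  refine ⟨144721, fun n ε L hn hε hε1 hcard hL hG => ?_⟩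
  -- a grid on the sides of the square with spacing `1 / M < ε`
  have hM : 1 / ε < ((⌊1 / ε⌋₊ + 1 : ℕ) : ℝ) := by push_cast; exact Nat.lt_floor_add_one _
  have h := SquarePlacement.complexity_epsPlacements_le hL hG hε hε1 hM rfl
  rw [hcard] at h
  obtain ⟨m, hm⟩ := ENat.ne_top_iff_exists.1 (ne_top_of_le_ne_top (ENat.natCast_ne_top _) h)
  refine ⟨m, hm.symm, ?_⟩
  rw [← hm, Nat.cast_le] at h
  have h := (Nat.cast_le (α := ℝ)).2 h
  push_cast at h
  have hn' : (1 : ℝ) ≤ n := by exact_mod_cast hn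
  have hf := Nat.floor_le (by positivity : 0 ≤ 1 / ε)
  have hr : 1 ≤ 1 / ε := by rw [le_div_iff₀ hε]; linarith
  have hC : (n : ℝ) ^ 2 / ε ^ 2 = (n : ℝ) ^ 2 * (1 / ε) ^ 2 := by field_simp
  rw [hC]
  generalize 1 / ε = r at hf hr h
  generalize hy : 4 * ((⌊r⌋₊ : ℝ) + 1) + 8 = y at h
  generalize hb : 9 * ((n : ℝ) * (2 * n + 1)) = b at h
  have hb0 : 0 ≤ b := by rw [← hb]; positivity
  have hb1 : b ≤ 27 * (n : ℝ) ^ 2 := by rw [← hb]; nlinarith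
  have hy0 : 0 ≤ y := by rw [← hy]; positivity
  have hy1 : y ≤ 16 * r := by linarith
  have hq : y * b ≤ 16 * r * (27 * (n : ℝ) ^ 2) := mul_le_mul hy1 hb1 hb0 (by linarith)
  have hq2 : y * (y * b) ≤ 16 * r * (16 * r * (27 * (n : ℝ) ^ 2)) :=
    mul_le_mul hy1 hq (mul_nonneg hy0 hb0) (by linarith)
  have hn2 : (1 : ℝ) ≤ (n : ℝ) ^ 2 := one_le_pow₀ hn'
  have hr2 : r * (n : ℝ) ^ 2 ≤ (n : ℝ) ^ 2 * r ^ 2 := by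
    have := mul_le_mul_of_nonneg_left hr (by positivity : 0 ≤ r * (n : ℝ) ^ 2)
    linarith
  have h1 : 1 ≤ (n : ℝ) ^ 2 * r ^ 2 := one_le_mul_of_one_le_of_one_le hn2 (one_le_pow₀ hr)
  linarith [h, hq, hq2, hr2, h1]
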